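/- Let $n\ge 1$, let $B_\pm\subset \mathrm{GL}_n(\mathbb C)$ be the upper/lower triangular subgroups, $H=B_+\cap B_-$, and $\mathrm{GL}_n^{u,v}=B_+uB_+\cap B_-vB_-$ for $u,v\in S_n$. Let $\mathbf i=(i(1),\dots,i(l))$, $i(k)\in\{\pm1,\dots,\pm(n-1)\}$, be a reduced word of $(u,v)$: its negative entries (with the sign removed) form a reduced word of $u$ and its positive entries a reduced word of $v$. *Bipartite graph and seeds.* Draw $n$ horizontal lines and, from left to right, for each $k$ a vertical edge across the $|i(k)|$-th spacing (between the lines $|i(k)|$ and $|i(k)|+1$ from the top), with white upper and black lower vertex if $i(k)>0$ and the colours exchanged if $i(k)<0$. The faces are the connected components of the complement (the region above all lines is in spacing $0$, the region below all lines in spacing $n$); the inner faces are those bounded by vertical edges on both sides. Put a counterclockwise oriented 3-cycle on the three faces around the black vertex of each vertical edge and cancel 2-cycles; let $\epsilon_{fg}$ be the number of arrows $f\to g$ minus the number of arrows $g\to f$. This defines a seed $\tilde{\mathbf i}$ on all faces and, by restriction, a seed (again denoted $\mathbf i$) on the inner faces, with tori $\mathcal X_{\tilde{\mathbf i}},\mathcal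 A_{\tilde{\mathbf i}}$ and $\mathcal X_{\mathbf i}$, the powers of $\mathbb C^*$ indexed by the faces, respectively by the inner faces. Let $q:\mathcal X_{\tilde{\mathbf i}}\to\mathcal X_{\mathbf i}$ be the coordinate projection and $\tilde p:\mathcal A_{\tilde{\mathbf i}}\to\mathcal X_{\tilde{\mathbf i}}$, $X_f=\prod_g A_g^{\epsilon_{fg}}$. *The map $\chi$.* Let $e_{i}=1+E_{i,i+1}$ and $e_{-i}=1+E_{i+1,i}$, and let $h^i(X)$ be the diagonal matrix whose first $i$ entries are $X$ and whose other entries are $1$. Then $\tilde\chi_{\mathbf i}:\mathcal X_{\tilde{\mathbf i}}\to\mathrm{GL}_n^{u,v}$ is the product, from left to right along the graph, of $h^i(X_f)$ for every face $f$ in the $i$-th spacing and of $e_{i(k)}$ for the $k$-th vertical edge. It induces through $q$ a map $\chi_{\mathbf i}:\mathcal X_{\mathbf i}\to H\backslash\mathrm{GL}_n^{u,v}/H$. *The map $\psi$.* For each line $a$, a right-going strand starts at the left end just above line $a$, and a left-going strand starts at the right end just below line $a$; strands follow the lines, except that at each vertical edge across the $i$-th spacing the two right-going strands (for $i(k)=-i$),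 respectively the two left-going strands (for $i(k)=i$), at lines $i$ and $i+1$ are exchanged. Let $I(f)$ (resp. $J(f)$) be the set of indices $a$ of the right-going (resp. left-going) strands passing above the face $f$, let $A_f(x)=\Delta^{I(f),J(f)}(x)$ be the minor of $x$ with rows $I(f)$ and columns $J(f)$, and let $\tilde\psi_{\mathbf i}:\mathrm{GL}_n^{u,v}\dashrightarrow\mathcal A_{\tilde{\mathbf i}}$, $x\mapsto(A_f(x))_f$. The composition $q\circ\tilde p\circ\tilde\psi_{\mathbf i}$ induces a rational map $\psi_{\mathbf i}:H\backslash\mathrm{GL}_n^{u,v}/H\dashrightarrow\mathcal X_{\mathbf i}$. *Cluster transformations.* For a seed $(I,\epsilon)$ and $k\in I$, the cluster mutation $\mu_k$ goes to the torus of the mutated seed, with $\epsilon'_{ij}=-\epsilon_{ij}$ if $k\in\{i,j\}$, $\epsilon'_{ij}=\epsilon_{ij}+|\epsilon_{ik}|\epsilon_{kj}$ if $k\notin\{i,j\}$ and $\epsilon_{ik}\epsilon_{kj}>0$, and $\epsilon'_{ij}=\epsilon_{ij}$ otherwise; it is given by $X'_k=X_k^{-1}$ and $X'_i=X_i\bigl(1+X_k^{-\mathrm{sign}\,\epsilon_{ik}}\bigr)^{-\epsilon_{ik}}$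 for $i\ne k$. A cluster isomorphism is the relabelling of coordinates $X'_{\sigma(i)}=X_i$ by a bijection $\sigma$ of index sets with $\epsilon'_{\sigma(i)\sigma(j)}=\epsilon_{ij}$. A cluster transformation is a rational map that is a finite composition of cluster mutations and cluster isomorphisms. **Proposition.** The composition $\psi\circ\chi$ on the cluster Poisson variety $\mathcal X_{|\mathbf i|}$ is a cluster transformation; that is, for all $u,v\in S_n$ and every reduced word $\mathbf i$ of $(u,v)$, the expression $$\psi_{\mathbf i}\circ\chi_{\mathbf i}:\mathcal X_{\mathbf i}\dashrightarrow\mathcal X_{\mathbf i}$$ of $\psi\circ\chi$ on the seed torus $\mathcal X_{\mathbf i}$ is a well-defined rational map and equals a finite composition of cluster mutations and cluster isomorphisms, starting and ending at the seed $\mathbf i$. -/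

import Mathlib

open Matrix

noncomputable section

namespace DoubleBruhat

/-! ## Seeds, cluster Poisson mutations and cluster transformations -/

/-- A seed: a finite index set with a skew-symmetric integer exchange matrix, equivalently a quiver
without loops and 2-cycles, where `ε i j` is the number of arrows from `i` to `j` minus the number
of arrows from `j` to `i`. There are no frozen vertices. -/
structure Seed where
  /-- the index set (the vertices of the quiver) -/
  I : Type
  [fin : Fintype I]
  [dec : DecidableEq I]
  /-- the exchange matrix -/
  ε : I → I → ℤ
  skew : ∀ i j, ε j i = -ε i j

attribute [instance] Seed.fin Seed.dec

/-- The split torus `(ℂ*)^I` attached to a seed; it serves both as the seed `𝒜`-torus and as the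
seed `𝒳`-torus, a point being given by its canonical coordinates. -/
abbrev Seed.Torus (s : Seed) : Type := s.I → ℂˣ

/-- Seed (quiver) mutation in direction `k`. -/
def Seed.mutate (s : Seed) (k : s.I) : Seed where
  I := s.I
  ε i j :=
    if i = k ∨ j = k then -s.ε i j
    else if 0 < s.ε i k * s.ε k j then s.ε i j + |s.ε i k| * s.ε k j
    else s.ε i j
  skew i j := by
    by_cases hij : i = k ∨ j = k
    · rw [if_pos hij, if_pos hij.symm, s.skew i j]
    · rw [if_neg hij, if_neg (fun h => hij h.symm), s.skew i j, s.skew k j, s.skew i k]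
      have e : -s.ε k j * -s.ε i k = s.ε i k * s.ε k j := by ring
      rw [e]
      split_ifs with h
      · rcases pos_and_pos_or_neg_and_neg_of_mul_pos h with ⟨h1, h2⟩ | ⟨h1, h2⟩
        · rw [abs_neg, abs_of_pos h1, abs_of_pos h2]; ring
        · rw [abs_neg, abs_of_neg h1, abs_of_neg h2]; ring
      · rfl

/-- The cluster `𝒳`-mutation in direction `k`, as the graph of a partially defined map between the
two seed tori: `X'ₖ = Xₖ⁻¹` and `X'ᵢ = Xᵢ (1 + Xₖ ^ (-sign εᵢₖ)) ^ (-εᵢₖ)` for `i ≠ k`.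
Since `X'ᵢ` has to be a unit, no point `X'` is related to `X` where the formula has a zero or a
pole. -/
def mutationRel (s : Seed) (k : s.I) (X : s.Torus) (X' : (s.mutate k).Torus) : Prop :=
  X' k = (X k)⁻¹ ∧
    ∀ i : s.I, i ≠ k →
      (X' i : ℂ) = (X i : ℂ) * (1 + (X k : ℂ) ^ (-Int.sign (s.ε i k))) ^ (-s.ε i k)

/-- A seed (quiver) isomorphism. -/
structure SeedIso (s t : Seed) where
  /-- the bijection of index sets -/
  toEquiv : s.I ≃ t.I
  map_ε : ∀ i j, t.ε (toEquiv i) (toEquiv j) = s.ε i j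

/-- The cluster isomorphism of `𝒳`-tori induced by a seed isomorphism `σ`, as a graph:
the coordinate `X'` at `σ i` is the coordinate `X` at `i`. -/
def isoRel {s t : Seed} (σ : SeedIso s t) (X : s.Torus) (X' : t.Torus) : Prop :=
  ∀ i : s.I, X' (σ.toEquiv i) = X i

/-- The (graphs of) finite compositions of cluster `𝒳`-mutations and cluster isomorphisms, starting
at the seed `s`. -/
inductive IsClusterComposition (s : Seed) : (t : Seed) → (s.Torus → t.Torus → Prop) → Prop
  | refl : IsClusterComposition s s Eq
  | mutation {t : Seed} {R : s.Torus → t.Torus → Prop} (h : IsClusterComposition s t R) (k : t.I) :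
      IsClusterComposition s (t.mutate k) (Relation.Comp R (mutationRel t k))
  | iso {t t' : Seed} {R : s.Torus → t.Torus → Prop} (h : IsClusterComposition s t R)
      (σ : SeedIso t t') : IsClusterComposition s t' (Relation.Comp R (isoRel σ))

/-- Two relations from a seed torus are the same rational map: on some nonempty Zariski open subset
of the (irreducible) torus, both are defined and single-valued, with the same value. -/
def RationallyEqual (s : Seed) {β : Type} (R R' : s.Torus → β → Prop) : Prop :=
  ∃ P : MvPolynomial s.I ℂ, P ≠ 0 ∧
    ∀ X : s.Torus, MvPolynomial.eval (fun i => (X i : ℂ)) P ≠ 0 →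
      ∃ y : β, ∀ z : β, (R X z ↔ z = y) ∧ (R' X z ↔ z = y)

/-- The relation `R` defines a rational map between the seed `𝒳`-tori of `s` and `t` and this
rational map is a cluster transformation, that is, equal to a composition of cluster mutations and
cluster isomorphisms. -/
def IsClusterTransformation (s t : Seed) (R : s.Torus → t.Torus → Prop) : Prop :=
  ∃ R' : s.Torus → t.Torus → Prop, IsClusterComposition s t R' ∧ RationallyEqual s R R'

/-- The map `p` from the seed `𝒜`-torus to the seed `𝒳`-torus, `Xᵢ = ∏ⱼ Aⱼ ^ εᵢⱼ`. -/
def Seed.p (s : Seed) (A : s.Torus) : s.Torus := fun i => ∏ j, A j ^ s.ε i j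

/-! ## Double Bruhat cells of `GLₙ(ℂ)` and their double quotients, with `n = r + 1`

Rows, columns and horizontal lines are numbered by `Fin (r + 1)`, so the line called `k` here is the
`(k + 1)`-st line in the usual numbering from 1. -/

/-- The group `GLₙ(ℂ)` with `n = r + 1`. -/
abbrev G (r : ℕ) : Type := GL (Fin (r + 1)) ℂ

/-- The homomorphism sending a tuple of nonzero numbers to the diagonal matrix. -/
def diag (r : ℕ) : (Fin (r + 1) → ℂˣ) →* G r :=
  (Units.map (diagonalRingHom (Fin (r + 1)) ℂ : (Fin (r + 1) → ℂ) →* Matrix _ _ ℂ)).comp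
    (MulEquiv.piUnits (ι := Fin (r + 1)) (M := fun _ => ℂ)).symm.toMonoidHom

/-- The maximal torus `H` of invertible diagonal matrices. -/
def H (r : ℕ) : Subgroup (G r) := (diag r).range

/-- The upper triangular Borel subgroup (as a set). -/
def Bplus (r : ℕ) : Set (G r) := {x | ∀ i j : Fin (r + 1), j < i → x.val i j = 0}

/-- The lower triangular Borel subgroup (as a set). -/
def Bminus (r : ℕ) : Set (G r) := {x | ∀ i j : Fin (r + 1), i < j → x.val i j = 0}

/-- The permutation matrix of `w`, which maps the basis vector `e_j` to `e_{w j}`; it represents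
`w` in the normalizer of `H`. -/
def weyl {r : ℕ} (w : Equiv.Perm (Fin (r + 1))) : G r :=
  GeneralLinearGroup.mkOfDetNeZero (Equiv.Perm.permMatrix ℂ w⁻¹) (by
    rw [det_permutation]
    exact_mod_cast (Equiv.Perm.sign w⁻¹).ne_zero)

/-- The double Bruhat cell `B₊ u B₊ ∩ B₋ v B₋`. -/
def cell {r : ℕ} (u v : Equiv.Perm (Fin (r + 1))) : Set (G r) :=
  DoubleCoset.doubleCoset (weyl u) (Bplus r) (Bplus r) ∩
    DoubleCoset.doubleCoset (weyl v) (Bminus r) (Bminus r)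

/-- Two elements of the double Bruhat cell are equivalent when one is `h x h'` for the other one `x`
and some `h, h' ∈ H`. -/
def cellSetoid {r : ℕ} (u v : Equiv.Perm (Fin (r + 1))) : Setoid (cell u v) :=
  (DoubleCoset.setoid (H r : Set (G r)) (H r : Set (G r))).comap Subtype.val

/-- The double quotient of the double Bruhat cell by `H` on both sides. -/
def CellQuotient {r : ℕ} (u v : Equiv.Perm (Fin (r + 1))) : Type := Quotient (cellSetoid u v)

/-! ## Words -/

/-- The letters of words of pairs of Weyl group elements: `pos i` is the letter `i + 1` and
`neg i` is the letter `-(i + 1)`. -/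
inductive Letter (r : ℕ) : Type
  | pos (i : Fin r) : Letter r
  | neg (i : Fin r) : Letter r

/-- The absolute value (minus 1) of a letter. -/
def Letter.index {r : ℕ} : Letter r → Fin r
  | .pos i => i
  | .neg i => i

/-- The positive letters. -/
def Letter.pos? {r : ℕ} : Letter r → Option (Fin r)
  | .pos i => some i
  | .neg _ => none

/-- The negative letters, with the sign removed. -/
def Letter.neg? {r : ℕ} : Letter r → Option (Fin r)
  | .pos _ => none
  | .neg i => some i

/-- The adjacent transposition of the `i`-th and the next position. -/
def simple {r : ℕ} (i : Fin r) : Equiv.Perm (Fin (r + 1)) := Equiv.swap i.castSucc i.succ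

/-- `l` is a reduced word of `w`: the product of its simple transpositions is `w`, and no shorter
word has this product. -/
def IsReducedWord {r : ℕ} (w : Equiv.Perm (Fin (r + 1))) (l : List (Fin r)) : Prop :=
  (l.map simple).prod = w ∧ ∀ l' : List (Fin r), (l'.map simple).prod = w → l.length ≤ l'.length

/-- `w` is a reduced word of the pair `(u, v)`: its negative letters, with the sign removed, form a
reduced word of `u`, and its positive letters form a reduced word of `v`. -/
def IsReducedPairWord {r : ℕ} (u v : Equiv.Perm (Fin (r + 1))) (w : List (Letter r)) : Prop :=
  IsReducedWord u (w.filterMap Letter.neg?) ∧ IsReducedWord v (w.filterMap Letter.pos?)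

/-! ## The bipartite graph of a word: faces, quivers, zig-zag strands

The graph has `r + 1` horizontal lines, and one vertical edge for every letter of the word, from left
to right; the edge of a letter `± (i + 1)` joins the consecutive lines `i` and `i + 1`, with a white
vertex on top and a black vertex at the bottom for a positive letter, and the colours exchanged for a
negative letter. The spacings between and around the lines are numbered by `s : Fin (r + 2)` from top
to bottom, spacing `0` being above all lines and spacing `r + 1` below all lines; spacing `s` is just
below the line `s - 1` and just above the line `s`. The position `m` is the place just after the
first `m` letters. -/

/-- The spacing crossed by the vertical edge of a letter. -/
def Letter.spacing {r : ℕ} (a : Letter r) : Fin (r + 2) := a.index.succ.castSucc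

/-- The next spacing above the vertical edge of a letter. -/
def Letter.above {r : ℕ} (a : Letter r) : Fin (r + 2) := a.index.castSucc.castSucc

/-- The next spacing below the vertical edge of a letter. -/
def Letter.below {r : ℕ} (a : Letter r) : Fin (r + 2) := a.index.succ.succ

/-- The number of vertical edges in the spacing `s`. -/
def occ {r : ℕ} (w : List (Letter r)) (s : Fin (r + 2)) : ℕ :=
  w.countP (fun a => decide (a.spacing = s))

/-- The faces: the vertical edges cut the spacing `s` into `occ w s + 1` faces, numbered from left to
right. -/
abbrev Face {r : ℕ} (w : List (Letter r)) : Type := (s : Fin (r + 2)) × Fin (occ w s + 1)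

/-- The face met in the spacing `s` at the position `m`. -/
def faceAt {r : ℕ} (w : List (Letter r)) (s : Fin (r + 2)) (m : ℕ) : Face w :=
  ⟨s, occ (w.take m) s, Nat.lt_succ_of_le ((List.take_sublist m w).countP_le)⟩

/-- The non-boundary faces: those bounded by vertical edges on both sides. -/
abbrev InnerFace {r : ℕ} (w : List (Letter r)) : Type :=
  {f : Face w // 0 < f.2.val ∧ f.2.val < occ w f.1}

/-- The number of arrows `f → g` in the oriented 3-cycle `a → b → c → a`. -/
def cycleArrows {α : Type} [DecidableEq α] (a b c f g : α) : ℤ :=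
  (if f = a ∧ g = b then 1 else 0) + (if f = b ∧ g = c then 1 else 0) +
    (if f = c ∧ g = a then 1 else 0)

/-- The number of arrows `f → g` in the counterclockwise cycle of the faces around the 3-valent black
vertex of the `k`-th vertical edge. This vertex is at the bottom for a positive letter, where the
cycle is left, below, right; it is on top for a negative letter, where the cycle is above, left,
right. -/
def blackArrows {r : ℕ} (w : List (Letter r)) (k : Fin w.length) (f g : Face w) : ℤ :=
  match w[k] with
  | .pos i =>
      let a := Letter.pos i
      cycleArrows (faceAt w a.spacing k) (faceAt w a.below k) (faceAt w a.spacing (k + 1)) f g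
  | .neg i =>
      let a := Letter.neg i
      cycleArrows (faceAt w a.above k) (faceAt w a.spacing k) (faceAt w a.spacing (k + 1)) f g

/-- The seed (quiver) of a word on all the faces: the counterclockwise cycles around the black
vertices, with 2-cycles removed. -/
def bigSeed {r : ℕ} (w : List (Letter r)) : Seed where
  I := Face w
  ε f g := ∑ k : Fin w.length, (blackArrows w k f g - blackArrows w k g f)
  skew f g := by rw [← Finset.sum_neg_distrib]; simp

/-- The boundary-removed seed (quiver) of a word. -/
def seed {r : ℕ} (w : List (Letter r)) : Seed where
  I := InnerFace w
  ε f g := (bigSeed w).ε f.1 g.1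
  skew f g := (bigSeed w).skew f.1 g.1

/-- The effect of a letter on the level (number of the line it follows) of a right-going zig-zag
strand: right-going strands run above the lines and cross only at negative letters, where the
strands at the two levels of the vertical edge are exchanged. -/
def Letter.crossRight {r : ℕ} (p : Fin (r + 1)) : Letter r → Fin (r + 1)
  | .pos _ => p
  | .neg i => simple i p

/-- The effect of a letter on the level of a left-going zig-zag strand: left-going strands cross only
at positive letters. -/
def Letter.crossLeft {r : ℕ} (a : Letter r) (p : Fin (r + 1)) : Fin (r + 1) :=
  match a with
  | .pos i => simple i p
  | .neg _ => p

/-- The level at the position `m` of the right-going zig-zag strand that starts on the line `a` at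
the left end. -/
def rightLevel {r : ℕ} (w : List (Letter r)) (m : ℕ) (a : Fin (r + 1)) : Fin (r + 1) :=
  (w.take m).foldl Letter.crossRight a

/-- The level at the position `m` of the left-going zig-zag strand that starts on the line `b` at
the right end. -/
def leftLevel {r : ℕ} (w : List (Letter r)) (m : ℕ) (b : Fin (r + 1)) : Fin (r + 1) :=
  (w.drop m).foldr Letter.crossLeft b

open Classical in
/-- The dominating set `I(f)`: the right-going zig-zag strands that pass above the face `f`
(at the positions where one meets `f`). -/
def domI {r : ℕ} (w : List (Letter r)) (f : Face w) : Finset (Fin (r + 1)) :=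
  {a | ∃ m ≤ w.length, faceAt w f.1 m = f ∧ (rightLevel w m a).val < f.1.val}

open Classical in
/-- The dominating set `J(f)`: the left-going zig-zag strands that pass above the face `f`. -/
def domJ {r : ℕ} (w : List (Letter r)) (f : Face w) : Finset (Fin (r + 1)) :=
  {b | ∃ m ≤ w.length, faceAt w f.1 m = f ∧ (leftLevel w m b).val < f.1.val}

/-- The minor of `x` with rows `I` and columns `J`; it is `0` if the sizes differ. -/
def minor {r : ℕ} (I J : Finset (Fin (r + 1))) (x : G r) : ℂ :=
  if h : J.card = I.card then
    (x.val.submatrix (I.orderEmbOfFin rfl) (J.orderEmbOfFin h)).det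
  else 0

/-- The face function `A_f`. -/
def faceMinor {r : ℕ} (w : List (Letter r)) (f : Face w) (x : G r) : ℂ :=
  minor (domI w f) (domJ w f) x

/-! ## The maps `χ` and `ψ` -/

/-- The element `e_{±i}`: the exponential of the elementary matrix with its entry just above
(positive letter) or just below (negative letter) the diagonal. -/
def Letter.e {r : ℕ} : Letter r → G r
  | .pos i => GeneralLinearGroup.mkOfDetNeZero (transvection i.castSucc i.succ (1 : ℂ)) (by
      rw [det_transvection_of_ne _ _ (Fin.castSucc_lt_succ).ne]; exact one_ne_zero)
  | .neg i => GeneralLinearGroup.mkOfDetNeZero (transvection i.succ i.castSucc (1 : ℂ)) (by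
      rw [det_transvection_of_ne _ _ (Fin.castSucc_lt_succ).ne']; exact one_ne_zero)

/-- The diagonal matrix `h^s(X)`, with its first `s` entries equal to `X` and the others to `1`. -/
def hmat {r : ℕ} (s : Fin (r + 2)) (X : ℂˣ) : G r :=
  diag r (fun k => if k.val < s.val then X else 1)

/-- The map `χ̃` of a word: going from left to right, multiply `h^s(X_f)` for every face `f` in the
spacing `s`, and `e_{±i}` for every vertical edge. The factor of a face is put immediately at its
left end; its place between the edges bounding the face does not matter, because `h^s` commutes with
the edges in the other spacings. -/
def chiTilde {r : ℕ} (w : List (Letter r)) (X : (bigSeed w).Torus) : G r :=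
  (List.ofFn fun s : Fin (r + 2) => hmat s (X (faceAt w s 0))).prod *
    (List.ofFn fun k : Fin w.length =>
      w[k].e * hmat w[k].spacing (X (faceAt w w[k].spacing (k + 1)))).prod

/-- The projection `q`, which forgets the coordinates at the boundary faces. -/
def q {r : ℕ} (w : List (Letter r)) (X : (bigSeed w).Torus) : (seed w).Torus :=
  fun f : InnerFace w => X f.1

/-- The map `χ` of a word into the double quotient of the double Bruhat cell, induced by `χ̃`
through `q`, as a graph. -/
def chi {r : ℕ} (u v : Equiv.Perm (Fin (r + 1))) (w : List (Letter r))
    (X : (seed w).Torus) (c : CellQuotient u v) : Prop :=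
  ∃ Xt : (bigSeed w).Torus, q w Xt = X ∧
    ∃ x : cell u v, x.1 = chiTilde w Xt ∧ Quotient.mk (cellSetoid u v) x = c

/-- The rational map `ψ̃` from the double Bruhat cell to the `𝒜`-torus, `A_f = A_f(x)`, as a
graph. -/
def psiTilde {r : ℕ} (u v : Equiv.Perm (Fin (r + 1))) (w : List (Letter r))
    (x : cell u v) (A : (bigSeed w).Torus) : Prop :=
  ∀ f : Face w, (A f : ℂ) = faceMinor w f x.1

/-- The rational map `ψ` from the double quotient of the double Bruhat cell to the `𝒳`-torus,
induced by the composition of `ψ̃`, `p` and `q`, as a graph. -/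
def psi {r : ℕ} (u v : Equiv.Perm (Fin (r + 1))) (w : List (Letter r))
    (c : CellQuotient u v) (Y : (seed w).Torus) : Prop :=
  ∃ x : cell u v, Quotient.mk (cellSetoid u v) x = c ∧
    ∃ A : (bigSeed w).Torus, psiTilde u v w x A ∧ q w ((bigSeed w).p A) = Y

end DoubleBruhat

end

/-! The statement is a comparison of two coordinate systems on one configuration of decorated flags.

Let b and a be the words of u and v read off from the word W, and let x be a point of the cell. The
negative letters give a chain of flags g(n)N₊ from N₊ to xN₊, the positive letters a chain of
opposite flags N₋k(m) from N₋ to N₋dx⁻¹, where d is diagonal. Every face of W meets one member of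
each chain, and the leading minor of k(m)g(n) of the size of its spacing is a face variable. By a
Gauss-type factorization of χ̃ (`exists_solves`, `Solves.diag_mul_chiMat`, `exists_chains`) such
variables exist for every X, with x equal to χ̃(X) up to the torus; by `Solves.telescopes` the
monomials p of these variables at the inner faces are the given coordinates X.

Now prolong both chains: the first beyond xN₊ by lifts of the reversed word a, the second before N₋
by lifts of the reversed word b. The leading minors along the mirror image of W, which uses only the
added parts, are the leading minors of w̄₁⁻¹ x w̄₂ for lifts w̄₁, w̄₂ of subwords, that is, the
minors A_f(x) (`faceMinor_eq`). So ψ∘χ carries the monomials in the pairings along W to those along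
its mirror image, and the reflection of faces identifies the two quivers at inner faces
(`eps_mirror_inner`).

One word is changed into the other by elementary moves. Exchanging neighbouring letters of different
sign does nothing if the indices differ, and is a mutation at the face between them if they agree
(`isMove_swap_of_opposite`): the three-term identity `lead_exchange` is the exchange relation, and
`mutationRel_p` transports it to 𝒳-coordinates. Changing the sign of the first or last letter
touches one boundary face only; there the exchange relation loses a term, because a pairing vanishes
for reduced words (`lead_conj_eq_zero`), and inner coordinates do not change (`isMove_first`,
`isMove_last`). Together these give `isMove_mirror` and `exists_composition`.

Two points remain. The torus on both sides multiplies the minors by weights with trivial monomials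
at inner faces (`exists_weights`), so choices of representatives do not matter. All mutations are
subtraction-free, so the composition is defined off the zero set of a nonzero polynomial
(`IsRegularComposition.generic`). -/

noncomputable section

namespace DoubleBruhat

/-! ## Faces as labels and the exchange matrix letter by letter -/

/-- A face, named by its spacing and its number in the spacing. -/
abbrev Label (r : ℕ) : Type := Fin (r + 2) × ℕ

/-- The numbers, in every spacing, of the faces met at some position. -/
abbrev Count (r : ℕ) : Type := Fin (r + 2) → ℕ

/-- The numbers of the faces met after a letter. -/
def Letter.step {r : ℕ} (c : Letter r) (n : Count r) : Count r :=
  fun s => n s + if c.spacing = s then 1 else 0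

/-- The face to the left of a letter. -/
def Letter.left {r : ℕ} (c : Letter r) (n : Count r) : Label r := (c.spacing, n c.spacing)

/-- The face to the right of a letter. -/
def Letter.right {r : ℕ} (c : Letter r) (n : Count r) : Label r := (c.spacing, n c.spacing + 1)

/-- The face above a letter. -/
def Letter.top {r : ℕ} (c : Letter r) (n : Count r) : Label r := (c.above, n c.above)

/-- The face below a letter. -/
def Letter.bot {r : ℕ} (c : Letter r) (n : Count r) : Label r := (c.below, n c.below)

/-- The skew-symmetrized arrows of a 3-cycle. -/
def cyc {α : Type} [DecidableEq α] (x y z f g : α) : ℤ :=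
  cycleArrows x y z f g - cycleArrows x y z g f

/-- The contribution of a letter to the exchange matrix. -/
def Letter.arr {r : ℕ} (c : Letter r) (n : Count r) (f g : Label r) : ℤ :=
  match c with
  | .pos i => cyc ((Letter.pos i).left n) ((Letter.pos i).bot n) ((Letter.pos i).right n) f g
  | .neg i => cyc ((Letter.neg i).top n) ((Letter.neg i).left n) ((Letter.neg i).right n) f g

/-- The exchange matrix of a word that starts at given faces. -/
def eps {r : ℕ} : Count r → List (Letter r) → Label r → Label r → ℤ
  | _, [], _, _ => 0
  | n, c :: w, f, g => c.arr n f g + eps (c.step n) w f g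

/-- The label of a face. -/
def lab {r : ℕ} {w : List (Letter r)} (f : Face w) : Label r := (f.1, f.2.val)

section basics
variable {r : ℕ}

@[simp] lemma pos_spacing_val (i : Fin r) : ((Letter.pos i).spacing : ℕ) = i + 1 := by
  simp [Letter.spacing, Letter.index]
@[simp] lemma neg_spacing_val (i : Fin r) : ((Letter.neg i).spacing : ℕ) = i + 1 := by
  simp [Letter.spacing, Letter.index]

lemma spacing_val (c : Letter r) : (c.spacing : ℕ) = c.index + 1 := by
  cases c <;> simp [Letter.index]

lemma above_val (c : Letter r) : (c.above : ℕ) = c.index := by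
  cases c <;> simp [Letter.index, Letter.above]

lemma below_val (c : Letter r) : (c.below : ℕ) = c.index + 2 := by
  cases c <;> simp [Letter.index, Letter.below]

lemma spacing_ne_above (c : Letter r) : c.spacing ≠ c.above := by
  simp [Fin.ext_iff, spacing_val, above_val]

lemma spacing_ne_below (c : Letter r) : c.spacing ≠ c.below := by
  simp [Fin.ext_iff, spacing_val, below_val]

lemma above_ne_below (c : Letter r) : c.above ≠ c.below := by
  simp [Fin.ext_iff, above_val, below_val]

lemma spacing_eq_iff (c d : Letter r) : c.spacing = d.spacing ↔ c.index = d.index := by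
  simp [Fin.ext_iff, spacing_val]

lemma occ_nil (s : Fin (r + 2)) : occ ([] : List (Letter r)) s = 0 := rfl

lemma occ_cons (c : Letter r) (w : List (Letter r)) (s : Fin (r + 2)) :
    occ (c :: w) s = occ w s + if c.spacing = s then 1 else 0 := by
  simp [occ, List.countP_cons]

lemma occ_append (w w' : List (Letter r)) (s : Fin (r + 2)) :
    occ (w ++ w') s = occ w s + occ w' s := by
  simp [occ]

lemma step_eq (c : Letter r) (n : Count r) : c.step n = fun s => n s + occ [c] s := by
  funext s; simp [Letter.step, occ_cons, occ_nil]

lemma step_spacing (c : Letter r) (n : Count r) : c.step n c.spacing = n c.spacing + 1 := by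
  simp [Letter.step]

lemma step_of_ne {c : Letter r} {s : Fin (r + 2)} (n : Count r) (h : c.spacing ≠ s) :
    c.step n s = n s := by
  simp [Letter.step, h]

lemma step_above (c : Letter r) (n : Count r) : c.step n c.above = n c.above :=
  step_of_ne n (spacing_ne_above c)

lemma step_below (c : Letter r) (n : Count r) : c.step n c.below = n c.below :=
  step_of_ne n (spacing_ne_below c)

lemma le_step (c : Letter r) (n : Count r) (s : Fin (r + 2)) : n s ≤ c.step n s := by
  simp [Letter.step]

lemma step_add_occ (c : Letter r) (w : List (Letter r)) (n : Count r) (s : Fin (r + 2)) :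
    c.step n s + occ w s = n s + occ (c :: w) s := by
  rw [occ_cons, Letter.step]; ring

lemma eps_append (w w' : List (Letter r)) (n : Count r) (f g : Label r) :
    eps n (w ++ w') f g = eps n w f g + eps (fun s => n s + occ w s) w' f g := by
  induction w generalizing n with
  | nil => simp [eps, occ_nil]
  | cons c w ih =>
    simp only [List.cons_append, eps, ih, add_assoc, step_add_occ]

lemma arr_skew (c : Letter r) (n : Count r) (f g : Label r) : c.arr n g f = -c.arr n f g := by
  cases c <;> simp [Letter.arr, cyc]

lemma eps_skew (n : Count r) (w : List (Letter r)) (f g : Label r) :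
    eps n w g f = -eps n w f g := by
  induction w generalizing n with
  | nil => simp [eps]
  | cons c w ih => rw [eps, eps, ih, arr_skew]; ring

lemma sum_arr (w : List (Letter r)) (n : Count r) (f g : Label r) :
    ∑ k : Fin w.length, (w[k]).arr (fun s => n s + occ (w.take k) s) f g = eps n w f g := by
  induction w generalizing n with
  | nil => simp [eps]
  | cons c w ih =>
    rw [eps, ← ih]
    refine (Fin.sum_univ_succ (n := w.length) _).trans ?_
    simp [occ_nil, step_add_occ]

lemma lab_injective (w : List (Letter r)) : Function.Injective (lab : Face w → Label r) := by
  rintro ⟨s, j⟩ ⟨t, k⟩ h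
  simp only [lab, Prod.mk.injEq] at h
  obtain ⟨rfl, h⟩ := h
  rw [Fin.ext h]

lemma lab_faceAt (w : List (Letter r)) (s : Fin (r + 2)) (m : ℕ) :
    lab (faceAt w s m) = (s, occ (w.take m) s) := rfl

lemma occ_take_succ (w : List (Letter r)) (k : Fin w.length) (s : Fin (r + 2)) :
    occ (w.take (k + 1)) s = occ (w.take k) s + if (w[k]).spacing = s then 1 else 0 := by
  rw [List.take_add_one, List.getElem?_eq_getElem k.2, Option.toList_some, occ_append]
  simp [occ_cons, occ_nil]

lemma cycleArrows_map {α β : Type} [DecidableEq α] [DecidableEq β] (φ : α → β)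
    (hφ : Function.Injective φ) (x y z f g : α) :
    cycleArrows (φ x) (φ y) (φ z) (φ f) (φ g) = cycleArrows x y z f g := by
  simp [cycleArrows, hφ.eq_iff]

lemma blackArrows_eq (w : List (Letter r)) (k : Fin w.length) (f g : Face w) :
    blackArrows w k f g - blackArrows w k g f =
      (w[k]).arr (fun s => occ (w.take k) s) (lab f) (lab g) := by
  have hs := occ_take_succ w k (w[k]).spacing
  simp only [if_true] at hs
  unfold blackArrows Letter.arr
  generalize w[k] = c at hs
  cases c <;>
  · simp only [cyc, ← cycleArrows_map lab (lab_injective w), lab_faceAt, hs, Letter.left,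
      Letter.right, Letter.top, Letter.bot]

lemma bigSeed_ε (w : List (Letter r)) (f g : Face w) :
    (bigSeed w).ε f g = eps 0 w (lab f) (lab g) := by
  rw [← sum_arr]
  simp only [bigSeed, blackArrows_eq, Pi.zero_apply, zero_add]

/-- Contributions vanish unless both faces touch the letter. -/
lemma arr_eq_zero_of_lt {c : Letter r} {n : Count r} {f g : Label r} (h : f.2 < n f.1) :
    c.arr n f g = 0 := by
  obtain ⟨s, j⟩ := f
  have h1 : (s, j) ≠ c.left n := by rintro e; simp [Letter.left] at e; simp_all
  have h2 : (s, j) ≠ c.right n := by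
    rintro e; simp [Letter.right] at e; obtain ⟨rfl, rfl⟩ := e; simp at h
  have h3 : (s, j) ≠ c.top n := by rintro e; simp [Letter.top] at e; simp_all
  have h4 : (s, j) ≠ c.bot n := by rintro e; simp [Letter.bot] at e; simp_all
  cases c <;> simp [Letter.arr, cyc, cycleArrows, h1, h2, h3, h4]

lemma arr_eq_zero_of_gt {c : Letter r} {n : Count r} {f g : Label r} (h : c.step n f.1 < f.2) :
    c.arr n f g = 0 := by
  obtain ⟨s, j⟩ := f
  have h1 : (s, j) ≠ c.left n := by
    rintro e; simp [Letter.left] at e; obtain ⟨rfl, rfl⟩ := e; simp [Letter.step] at h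
  have h2 : (s, j) ≠ c.right n := by
    rintro e; simp [Letter.right] at e; obtain ⟨rfl, rfl⟩ := e; simp [Letter.step] at h
  have h3 : (s, j) ≠ c.top n := by
    rintro e; simp [Letter.top] at e; obtain ⟨rfl, rfl⟩ := e; simp [Letter.step] at h
  have h4 : (s, j) ≠ c.bot n := by
    rintro e; simp [Letter.bot] at e; obtain ⟨rfl, rfl⟩ := e; simp [Letter.step] at h
  cases c <;> simp [Letter.arr, cyc, cycleArrows, h1, h2, h3, h4]

/-- A letter touches only faces open at its position. Together with the lemma for later faces, this
isolates the arrows at a face that lies between two consecutive letters. -/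
lemma eps_eq_zero_of_lt {n : Count r} {w : List (Letter r)} {f g : Label r} (h : f.2 < n f.1) :
    eps n w f g = 0 := by
  induction w generalizing n with
  | nil => rfl
  | cons c w ih =>
    rw [eps, arr_eq_zero_of_lt h, ih (h.trans_le (le_step c n _)), add_zero]

lemma eps_eq_zero_of_gt {n : Count r} {w : List (Letter r)} {f g : Label r}
    (h : n f.1 + occ w f.1 < f.2) : eps n w f g = 0 := by
  induction w generalizing n with
  | nil => rfl
  | cons c w ih =>
    rw [← step_add_occ] at h
    rw [eps, arr_eq_zero_of_gt (by omega), ih h, add_zero]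

/-! ## Products of face variables letter by letter -/

/-- The factor contributed by a 3-cycle to the monomial of the face `f`. -/
def cycProd (x y z : Label r) (a : Label r → ℂˣ) (f : Label r) : ℂˣ :=
  (if f = x then a y / a z else 1) * (if f = y then a z / a x else 1) *
    (if f = z then a x / a y else 1)

/-- The factor contributed by a letter to the monomial of the face `f`. -/
def Letter.ctr (c : Letter r) (n : Count r) (a : Label r → ℂˣ) (f : Label r) : ℂˣ :=
  match c with
  | .pos i => cycProd ((Letter.pos i).left n) ((Letter.pos i).bot n) ((Letter.pos i).right n) a f
  | .neg i => cycProd ((Letter.neg i).top n) ((Letter.neg i).left n) ((Letter.neg i).right n) a f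

/-- The monomial of the face `f` contributed by a word. -/
def prodCtr : Count r → List (Letter r) → (Label r → ℂˣ) → Label r → ℂˣ
  | _, [], _, _ => 1
  | n, c :: w, a, f => c.ctr n a f * prodCtr (c.step n) w a f

lemma prod_zpow_single {W : List (Letter r)} (a : Label r → ℂˣ) (x : Face W) (P : Prop)
    [Decidable P] :
    ∏ g : Face W, a (lab g) ^ (if P ∧ lab g = lab x then (1 : ℤ) else 0) =
      if P then a (lab x) else 1 := by
  by_cases hP : P
  · simp only [hP, true_and, if_true]
    rw [Finset.prod_eq_single x]
    · simp
    · intro b _ hb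
      rw [if_neg (fun h => hb (lab_injective W h)), zpow_zero]
    · simp
  · simp [hP]

lemma prod_zpow_cyc {W : List (Letter r)} (a : Label r → ℂˣ) (x y z : Face W) (f : Label r) :
    ∏ g : Face W, a (lab g) ^ cyc (lab x) (lab y) (lab z) f (lab g) =
      cycProd (lab x) (lab y) (lab z) a f := by
  have e : ∀ g : Face W, a (lab g) ^ cyc (lab x) (lab y) (lab z) f (lab g) =
      a (lab g) ^ (if f = lab x ∧ lab g = lab y then (1 : ℤ) else 0) *
      a (lab g) ^ (if f = lab y ∧ lab g = lab z then (1 : ℤ) else 0) *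
      a (lab g) ^ (if f = lab z ∧ lab g = lab x then (1 : ℤ) else 0) *
      (a (lab g) ^ (if f = lab y ∧ lab g = lab x then (1 : ℤ) else 0))⁻¹ *
      (a (lab g) ^ (if f = lab z ∧ lab g = lab y then (1 : ℤ) else 0))⁻¹ *
      (a (lab g) ^ (if f = lab x ∧ lab g = lab z then (1 : ℤ) else 0))⁻¹ := by
    intro g
    simp only [← _root_.zpow_neg, ← _root_.zpow_add]
    congr 1
    simp only [cyc, cycleArrows, and_comm (b := lab g = _)]
    simp only [and_comm (a := lab g = _)]
    ring
  simp only [e, Finset.prod_mul_distrib, Finset.prod_inv_distrib, prod_zpow_single, cycProd]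
  split_ifs <;> (apply Units.ext; push_cast; field_simp)

lemma exists_face {W : List (Letter r)} {x : Label r} (h : x.2 ≤ occ W x.1) :
    ∃ f : Face W, lab f = x := ⟨⟨x.1, x.2, Nat.lt_succ_of_le h⟩, rfl⟩

lemma prod_zpow_arr {W : List (Letter r)} (a : Label r → ℂˣ) (c : Letter r) (n : Count r)
    (hn : ∀ s, c.step n s ≤ occ W s) (f : Label r) :
    ∏ g : Face W, a (lab g) ^ c.arr n f (lab g) = c.ctr n a f := by
  obtain ⟨l, hl⟩ := exists_face (W := W) (x := c.left n) ((le_step c n _).trans (hn _))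
  obtain ⟨R, hR⟩ := exists_face (W := W) (x := c.right n)
    (by simpa [Letter.right, step_spacing] using hn c.spacing)
  obtain ⟨t, ht⟩ := exists_face (W := W) (x := c.top n) ((le_step c n _).trans (hn _))
  obtain ⟨b, hb⟩ := exists_face (W := W) (x := c.bot n) ((le_step c n _).trans (hn _))
  cases c <;> simp only [Letter.arr, Letter.ctr, ← hl, ← hR, ← ht, ← hb, prod_zpow_cyc]

/-- The face set is that of `W`, while `w` may be any word that fits into it. All words reached by
the moves have the same number of letters in every spacing, so one fixed set of faces serves for all
of them. -/
lemma prod_zpow_eps {W : List (Letter r)} (a : Label r → ℂˣ) (w : List (Letter r)) (n : Count r)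
    (hn : ∀ s, n s + occ w s ≤ occ W s) (f : Label r) :
    ∏ g : Face W, a (lab g) ^ eps n w f (lab g) = prodCtr n w a f := by
  induction w generalizing n with
  | nil => simp [eps, prodCtr]
  | cons c w ih =>
    simp only [eps, prodCtr, _root_.zpow_add, Finset.prod_mul_distrib]
    rw [ih _ (fun s => by rw [step_add_occ]; exact hn s), prod_zpow_arr]
    intro s
    have := hn s
    rw [← step_add_occ] at this
    omega

lemma prodCtr_append (w w' : List (Letter r)) (n : Count r) (a : Label r → ℂˣ) (f : Label r) :
    prodCtr n (w ++ w') a f = prodCtr n w a f * prodCtr (fun s => n s + occ w s) w' a f := by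
  induction w generalizing n with
  | nil => simp [prodCtr, occ_nil]
  | cons c w ih =>
    simp only [List.cons_append, prodCtr, ih, mul_assoc, step_add_occ]

lemma ctr_congr (c : Letter r) {n : Count r} {a a' : Label r → ℂˣ}
    (h : ∀ s j, n s ≤ j → j ≤ c.step n s → a (s, j) = a' (s, j)) (f : Label r) :
    c.ctr n a f = c.ctr n a' f := by
  have hl : a (c.left n) = a' (c.left n) := h _ _ le_rfl (le_step _ _ _)
  have hr : a (c.right n) = a' (c.right n) := h _ _ (by simp) (by simp [step_spacing])
  have ht : a (c.top n) = a' (c.top n) := h _ _ le_rfl (le_step _ _ _)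
  have hb : a (c.bot n) = a' (c.bot n) := h _ _ le_rfl (le_step _ _ _)
  cases c <;> simp only [Letter.ctr, cycProd, hl, hr, ht, hb]

lemma prodCtr_congr (w : List (Letter r)) {n : Count r} {a a' : Label r → ℂˣ}
    (h : ∀ s j, n s ≤ j → j ≤ n s + occ w s → a (s, j) = a' (s, j)) (f : Label r) :
    prodCtr n w a f = prodCtr n w a' f := by
  induction w generalizing n with
  | nil => rfl
  | cons c w ih =>
    rw [prodCtr, prodCtr, ctr_congr c (fun s j h1 h2 => h s j h1 (by
      rw [← step_add_occ]; omega)), ih (fun s j h1 h2 => h s j ((le_step c n s).trans h1) (by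
      rw [← step_add_occ]; omega))]

/-- The monomials of the faces met by a letter. -/
lemma ctr_left (c : Letter r) (n : Count r) (a : Label r → ℂˣ) :
    c.ctr n a (c.left n) = match c with
      | .pos i => a ((Letter.pos i).bot n) / a ((Letter.pos i).right n)
      | .neg i => a ((Letter.neg i).right n) / a ((Letter.neg i).top n) := by
  have h1 := spacing_ne_above c
  have h2 := spacing_ne_below c
  cases c <;> simp [Letter.ctr, cycProd, Letter.left, Letter.right, Letter.top, Letter.bot, h1, h2]

lemma ctr_right (c : Letter r) (n : Count r) (a : Label r → ℂˣ) :
    c.ctr n a (c.right n) = match c with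
      | .pos i => a ((Letter.pos i).left n) / a ((Letter.pos i).bot n)
      | .neg i => a ((Letter.neg i).top n) / a ((Letter.neg i).left n) := by
  have h1 := spacing_ne_above c
  have h2 := spacing_ne_below c
  cases c <;> simp [Letter.ctr, cycProd, Letter.left, Letter.right, Letter.top, Letter.bot, h1, h2]

lemma ctr_top (c : Letter r) (n : Count r) (a : Label r → ℂˣ) :
    c.ctr n a (c.top n) = match c with
      | .pos _ => 1
      | .neg i => a ((Letter.neg i).left n) / a ((Letter.neg i).right n) := by
  have h1 := (spacing_ne_above c).symm
  have h2 := above_ne_below c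
  cases c <;> simp [Letter.ctr, cycProd, Letter.left, Letter.right, Letter.top, Letter.bot, h1, h2]

lemma ctr_bot (c : Letter r) (n : Count r) (a : Label r → ℂˣ) :
    c.ctr n a (c.bot n) = match c with
      | .pos i => a ((Letter.pos i).right n) / a ((Letter.pos i).left n)
      | .neg _ => 1 := by
  have h1 := (spacing_ne_below c).symm
  have h2 := (above_ne_below c).symm
  cases c <;> simp [Letter.ctr, cycProd, Letter.left, Letter.right, Letter.top, Letter.bot, h1, h2]

lemma ctr_other (c : Letter r) (n : Count r) (a : Label r → ℂˣ) {f : Label r}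
    (hl : f ≠ c.left n) (hr : f ≠ c.right n) (ht : f ≠ c.top n) (hb : f ≠ c.bot n) :
    c.ctr n a f = 1 := by
  cases c <;> simp [Letter.ctr, cycProd, hl, hr, ht, hb]

end basics

/-! ## Compositions of mutations and isomorphisms on generic points -/

/-- A cluster composition `R`, together with its restriction `C` to the points where all the
mutations are defined and `1 + Xₖ ≠ 0` whenever one mutates at `k`. -/
inductive IsRegularComposition (s : Seed) :
    (t : Seed) → (s.Torus → t.Torus → Prop) → (s.Torus → t.Torus → Prop) → Prop
  | refl : IsRegularComposition s s Eq Eq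
  | mutation {t : Seed} {R C : s.Torus → t.Torus → Prop} (h : IsRegularComposition s t R C)
      (k : t.I) :
      IsRegularComposition s (t.mutate k) (Relation.Comp R (mutationRel t k))
        (Relation.Comp C (fun X X' => mutationRel t k X X' ∧ 1 + (X k : ℂ) ≠ 0))
  | iso {t t' : Seed} {R C : s.Torus → t.Torus → Prop} (h : IsRegularComposition s t R C)
      (σ : SeedIso t t') :
      IsRegularComposition s t' (Relation.Comp R (isoRel σ)) (Relation.Comp C (isoRel σ))

namespace IsRegularComposition

lemma isClusterComposition {s t : Seed} {R C : s.Torus → t.Torus → Prop}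
    (h : IsRegularComposition s t R C) : IsClusterComposition s t R := by
  induction h with
  | refl => exact .refl
  | mutation _ k ih => exact .mutation ih k
  | iso _ σ ih => exact .iso ih σ

lemma trans {s t u : Seed} {R C : s.Torus → t.Torus → Prop} {R' C' : t.Torus → u.Torus → Prop}
    (h : IsRegularComposition s t R C) (h' : IsRegularComposition t u R' C') :
    IsRegularComposition s u (Relation.Comp R R') (Relation.Comp C C') := by
  induction h' with
  | refl => rwa [Relation.comp_eq, Relation.comp_eq]
  | mutation _ k ih => rw [← Relation.comp_assoc, ← Relation.comp_assoc]; exact .mutation ih k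
  | iso _ σ ih => rw [← Relation.comp_assoc, ← Relation.comp_assoc]; exact .iso ih σ

end IsRegularComposition

/-- Polynomials with positive values at positive points. -/
def IsPositive {I : Type} (P : MvPolynomial I ℂ) : Prop :=
  ∀ x : I → ℝ, (∀ i, 0 < x i) →
    ∃ c : ℝ, 0 < c ∧ MvPolynomial.eval (fun i => (x i : ℂ)) P = c

namespace IsPositive
variable {I : Type} {P Q : MvPolynomial I ℂ}

lemma one : IsPositive (1 : MvPolynomial I ℂ) := fun _ _ => ⟨1, one_pos, by simp⟩

lemma X (i : I) : IsPositive (MvPolynomial.X i : MvPolynomial I ℂ) :=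
  fun x hx => ⟨x i, hx i, by simp⟩

lemma add (hP : IsPositive P) (hQ : IsPositive Q) : IsPositive (P + Q) := fun x hx => by
  obtain ⟨c, hc, h⟩ := hP x hx
  obtain ⟨d, hd, h'⟩ := hQ x hx
  exact ⟨c + d, add_pos hc hd, by simp [h, h']⟩

lemma mul (hP : IsPositive P) (hQ : IsPositive Q) : IsPositive (P * Q) := fun x hx => by
  obtain ⟨c, hc, h⟩ := hP x hx
  obtain ⟨d, hd, h'⟩ := hQ x hx
  exact ⟨c * d, mul_pos hc hd, by simp [h, h']⟩

lemma pow (hP : IsPositive P) (n : ℕ) : IsPositive (P ^ n) := fun x hx => by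
  obtain ⟨c, hc, h⟩ := hP x hx
  exact ⟨c ^ n, pow_pos hc n, by simp [h]⟩

lemma ne_zero (hP : IsPositive P) : P ≠ 0 := by
  rintro rfl
  obtain ⟨c, hc, h⟩ := hP (fun _ => 1) (fun _ => one_pos)
  simp only [map_zero] at h
  exact hc.ne (by exact_mod_cast h)

end IsPositive

/-- The value of a polynomial at a point of a seed torus. -/
abbrev Seed.ev {s : Seed} (X : s.Torus) (P : MvPolynomial s.I ℂ) : ℂ :=
  MvPolynomial.eval (fun i => (X i : ℂ)) P

/-- Mutation of fractions uses only products and the sum `Nk + Dk`, so numerators and denominators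
stay subtraction-free. -/
lemma mutation_fraction {Ni Di Nk Dk : ℂ} (e : ℤ) (hN : Nk ≠ 0) (hD : Dk ≠ 0)
    (hND : Nk + Dk ≠ 0) :
    Ni / Di * (1 + (Nk / Dk) ^ (-Int.sign e)) ^ (-e) =
      Ni * (if 0 < e then Nk else Nk + Dk) ^ e.natAbs /
        (Di * (if 0 < e then Nk + Dk else Dk) ^ e.natAbs) := by
  rcases lt_trichotomy e 0 with h | rfl | h
  · obtain ⟨n, rfl⟩ : ∃ n : ℕ, e = -(n : ℤ) := ⟨e.natAbs, by omega⟩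
    have h0 : ¬ (0 : ℤ) < -(n : ℤ) := by omega
    rw [Int.sign_eq_neg_one_of_neg h, if_neg h0, if_neg h0]
    simp only [neg_neg, _root_.zpow_one, zpow_natCast, Int.natAbs_neg, Int.natAbs_natCast]
    rw [show 1 + Nk / Dk = (Nk + Dk) / Dk by field_simp; ring, div_pow, div_mul_div_comm]
  · simp
  · obtain ⟨n, rfl⟩ : ∃ n : ℕ, e = (n : ℤ) := ⟨e.natAbs, by omega⟩
    rw [Int.sign_eq_one_of_pos h, if_pos h, if_pos h]
    simp only [Int.natAbs_natCast]
    rw [_root_.zpow_neg, _root_.zpow_neg, _root_.zpow_one, zpow_natCast,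
      show 1 + (Nk / Dk)⁻¹ = (Nk + Dk) / Nk by field_simp, div_pow, inv_div, div_mul_div_comm]

/-- Inductively every coordinate is a quotient of polynomials positive at positive points. Then `1 +
Xₖ` has numerator `N k + D k`, again positive and hence not the zero polynomial, so each further
mutation excludes only a proper closed subset. -/
lemma IsRegularComposition.generic {s t : Seed} {R C : s.Torus → t.Torus → Prop}
    (h : IsRegularComposition s t R C) :
    ∃ P : MvPolynomial s.I ℂ, IsPositive P ∧ ∃ N D : t.I → MvPolynomial s.I ℂ,
      (∀ i, IsPositive (N i)) ∧ (∀ i, IsPositive (D i)) ∧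
      ∀ X : s.Torus, Seed.ev X P ≠ 0 →
        ∃ z : t.Torus, C X z ∧ (∀ z', R X z' ↔ z' = z) ∧
          ∀ i, Seed.ev X (N i) ≠ 0 ∧ Seed.ev X (D i) ≠ 0 ∧
            (z i : ℂ) = Seed.ev X (N i) / Seed.ev X (D i) := by
  induction h with
  | refl =>
    refine ⟨1, .one, fun i => MvPolynomial.X i, fun _ => 1, IsPositive.X, fun _ => .one,
      fun X _ => ⟨X, rfl, fun z' => eq_comm, fun i => ?_⟩⟩
    simp [Seed.ev]
  | @iso t t' R C _ σ ih =>
    obtain ⟨P, hP, N, D, hN, hD, H⟩ := ih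
    refine ⟨P, hP, fun i => N (σ.toEquiv.symm i), fun i => D (σ.toEquiv.symm i), fun i => hN _,
      fun i => hD _, fun X hX => ?_⟩
    obtain ⟨z, hz, hz', Hz⟩ := H X hX
    have key : ∀ z', isoRel σ z z' ↔ z' = fun i => z (σ.toEquiv.symm i) := by
      intro z'
      constructor
      · intro h
        funext i
        rw [← h, Equiv.apply_symm_apply]
      · rintro rfl i
        simp
    refine ⟨fun i => z (σ.toEquiv.symm i), ⟨z, hz, (key _).2 rfl⟩, fun z' => ?_, fun i => Hz _⟩
    rw [← key]
    constructor
    · rintro ⟨y, hy, hy'⟩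
      rwa [(hz' y).1 hy] at hy'
    · intro h
      exact ⟨z, (hz' z).2 rfl, h⟩
  | @mutation t R C _ k ih =>
    obtain ⟨P, hP, N, D, hN, hD, H⟩ := ih
    -- The only new condition is that `N k + D k` does not vanish; the exponents then follow
    -- `mutation_fraction`.
    refine ⟨P * (N k + D k), hP.mul ((hN k).add (hD k)),
      fun (i : t.I) => if i = k then D k else
        N i * (if 0 < t.ε i k then N k else N k + D k) ^ (t.ε i k).natAbs,
      fun (i : t.I) => if i = k then N k else
        D i * (if 0 < t.ε i k then N k + D k else D k) ^ (t.ε i k).natAbs, ?_, ?_, ?_⟩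
    · intro (i : t.I)
      dsimp only
      split_ifs
      exacts [hD k, (hN i).mul ((hN k).pow _), (hN i).mul (((hN k).add (hD k)).pow _)]
    · intro (i : t.I)
      dsimp only
      split_ifs
      exacts [hN k, (hD i).mul (((hN k).add (hD k)).pow _), (hD i).mul ((hD k).pow _)]
    · intro X hX
      simp only [Seed.ev, map_mul, map_add, mul_ne_zero_iff] at hX
      obtain ⟨z, hz, hz', Hz⟩ := H X hX.1
      obtain ⟨hNk, hDk, hzk⟩ := Hz k
      have hND := hX.2
      have e : ∀ i, i ≠ k →
          (z i : ℂ) * (1 + (z k : ℂ) ^ (-Int.sign (t.ε i k))) ^ (-t.ε i k) =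
          Seed.ev X (N i * (if 0 < t.ε i k then N k else N k + D k) ^ (t.ε i k).natAbs) /
          Seed.ev X (D i * (if 0 < t.ε i k then N k + D k else D k) ^ (t.ε i k).natAbs) := by
        intro i hi
        rw [(Hz i).2.2, hzk, mutation_fraction _ hNk hDk hND]
        simp only [Seed.ev, map_mul, map_pow]
        split_ifs <;> simp
      have hNi : ∀ i, Seed.ev X
          (N i * (if 0 < t.ε i k then N k else N k + D k) ^ (t.ε i k).natAbs) ≠ 0 := by
        intro i
        simp only [Seed.ev, map_mul, map_pow]
        refine mul_ne_zero (Hz i).1 (pow_ne_zero _ ?_)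
        split_ifs
        exacts [hNk, by simpa using hND]
      have hDi : ∀ i, Seed.ev X
          (D i * (if 0 < t.ε i k then N k + D k else D k) ^ (t.ε i k).natAbs) ≠ 0 := by
        intro i
        simp only [Seed.ev, map_mul, map_pow]
        refine mul_ne_zero (Hz i).2.1 (pow_ne_zero _ ?_)
        split_ifs
        exacts [by simpa using hND, hDk]
      let z₁ : (t.mutate k).Torus := fun i : t.I => if i = k then (z k)⁻¹ else
        Units.mk0 _ (div_ne_zero (hNi i) (hDi i))
      have hk : z₁ k = (z k)⁻¹ := if_pos rfl
      have hik : ∀ i : t.I, i ≠ k → (z₁ i : ℂ) =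
          (z i : ℂ) * (1 + (z k : ℂ) ^ (-Int.sign (t.ε i k))) ^ (-t.ε i k) := by
        intro i hi
        rw [e i hi]
        simp only [z₁]
        rw [if_neg hi, Units.val_mk0]
      have key : ∀ z', mutationRel t k z z' ↔ z' = z₁ := by
        intro z'
        constructor
        · rintro ⟨h1, h2⟩
          refine funext fun (i : t.I) => ?_
          by_cases hi : i = k
          · subst hi
            rw [h1, hk]
          · apply Units.ext
            rw [h2 i hi, hik i hi]
        · rintro rfl
          exact ⟨hk, hik⟩
      refine ⟨z₁, ⟨z, hz, (key _).2 rfl, ?_⟩, fun z' => ?_, fun i => ?_⟩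
      · rw [hzk, show 1 + Seed.ev X (N k) / Seed.ev X (D k) =
          (Seed.ev X (N k) + Seed.ev X (D k)) / Seed.ev X (D k) by field_simp; ring]
        exact div_ne_zero hND hDk
      · rw [← key]
        constructor
        · rintro ⟨y, hy, hy'⟩
          rwa [(hz' y).1 hy] at hy'
        · intro h
          exact ⟨z, (hz' z).2 rfl, h⟩
      · revert i
        intro (i : t.I)
        by_cases hi : i = k
        · subst hi
          simp only [if_true]
          refine ⟨hDk, hNk, ?_⟩
          rw [hk, Units.val_inv_eq_inv_val, hzk, inv_div]
        · simp only [if_neg hi]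
          refine ⟨hNi i, hDi i, ?_⟩
          rw [hik i hi, e i hi]

/-! ## Mutations and the map `p` -/

/-- The map `p` intertwines the `𝒜`-mutation, given by the exchange relation, with the
`𝒳`-mutation. -/
lemma mutationRel_p (S : Seed) (k : S.I) (a a' : S.Torus) (ha : ∀ j, j ≠ k → a' j = a j)
    (hk : (a' k : ℂ) * a k =
      ((∏ j, a j ^ max (S.ε k j) 0 : ℂˣ) : ℂ) + ((∏ j, a j ^ max (-S.ε k j) 0 : ℂˣ) : ℂ)) :
    mutationRel S k (S.p a) ((S.mutate k).p a') := by
  have hkk : S.ε k k = 0 := by have := S.skew k k; omega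
  set Np := ∏ j, a j ^ max (S.ε k j) 0 with hNp
  set Nm := ∏ j, a j ^ max (-S.ε k j) 0 with hNm
  have hX : S.p a k = Np / Nm := by
    rw [hNp, hNm, ← Finset.prod_div_distrib]
    refine Finset.prod_congr rfl fun j _ => ?_
    rw [div_eq_mul_inv, ← _root_.zpow_sub]
    congr 1
    rcases le_total (S.ε k j) 0 with h | h
    · rw [max_eq_right h, max_eq_left (by omega)]; ring
    · rw [max_eq_left h, max_eq_right (by omega)]; ring
  -- Here `m` is to be the positive or the negative part of row `k`, according to the sign of `ε i
  -- k`. Then `∏ a ^ m` is `Np` or `Nm`, and dividing it by `a' k * a k = Np + Nm` produces the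
  -- factor of the 𝒳-mutation.
  have hmain : ∀ i, i ≠ k → ∀ m : S.I → ℤ, m k = 0 →
      (∀ j, j ≠ k → (S.mutate k).ε i j = S.ε i j + S.ε i k * m j) →
      (S.mutate k).p a' i =
        S.p a i * (∏ j, a j ^ m j) ^ S.ε i k * (a' k * a k) ^ (-S.ε i k) := by
    intro i hi m hm h
    have e : (a' k * a k) ^ (-S.ε i k) =
        ∏ j, if j = k then (a' k * a k) ^ (-S.ε i k) else 1 := by simp
    change ∏ j : S.I, a' j ^ (S.mutate k).ε i j = (∏ j, a j ^ S.ε i j) * _ * _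
    rw [e, ← Finset.prod_zpow, ← Finset.prod_mul_distrib,
      ← Finset.prod_mul_distrib]
    refine Finset.prod_congr rfl fun j _ => ?_
    by_cases hj : j = k
    · subst hj
      have : (S.mutate j).ε i j = -S.ε i j := by simp [Seed.mutate]
      rw [if_pos rfl, hm, this, _root_.zpow_zero, _root_.one_zpow, _root_.mul_zpow]
      rw [_root_.zpow_neg (a j)]
      simp [mul_comm]
    · rw [if_neg hj, h j hj, ha j hj, _root_.zpow_add, mul_one, ← _root_.zpow_mul,
        mul_comm (m j)]
  have hkC : ((a' k * a k : ℂˣ) : ℂ) = Np + Nm := by rw [← hk]; push_cast; ring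
  refine ⟨?_, fun i hi => ?_⟩
  · change ∏ j : S.I, a' j ^ (S.mutate k).ε k j = (∏ j, a j ^ S.ε k j)⁻¹
    rw [← Finset.prod_inv_distrib]
    refine Finset.prod_congr rfl fun j _ => ?_
    have : (S.mutate k).ε k j = -S.ε k j := by simp [Seed.mutate]
    rw [this, _root_.zpow_neg]
    by_cases hj : j = k
    · subst hj; simp [hkk]
    · rw [ha j hj]
  · have hne : (Np : ℂ) + Nm ≠ 0 := by rw [← hkC]; exact Units.ne_zero _
    have hp := Np.ne_zero
    have hm := Nm.ne_zero
    rcases lt_trichotomy (S.ε i k) 0 with h | h | h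
    · rw [hmain i hi (fun j => max (-S.ε k j) 0) (by simp [hkk]), ← hNm,
        Int.sign_eq_neg_one_of_neg h, hX]
      · push_cast [hkC]
        rw [_root_.zpow_one, mul_assoc,
          show (1 + (Np : ℂ) / Nm) = (Np + Nm) / Nm by field_simp; ring, div_zpow,
          _root_.zpow_neg (Nm : ℂ), div_inv_eq_mul, mul_comm ((Nm : ℂ) ^ _)]
      · intro j hj
        simp only [Seed.mutate, hi, hj, or_self, if_false, abs_of_neg h]
        rcases le_or_gt 0 (S.ε k j) with h' | h'
        · rw [if_neg (by nlinarith), max_eq_right (by omega)]; ring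
        · rw [if_pos (by nlinarith), max_eq_left (by omega)]; ring
    · rw [hmain i hi (fun j => 0) rfl]
      · simp [h]
      · intro j hj
        simp [Seed.mutate, hi, hj, h]
    · rw [hmain i hi (fun j => max (S.ε k j) 0) (by simp [hkk]), ← hNp,
        Int.sign_eq_one_of_pos h, hX]
      · push_cast [hkC]
        rw [_root_.zpow_neg ((Np : ℂ) / Nm) 1, _root_.zpow_one, mul_assoc,
          show (1 + ((Np : ℂ) / Nm)⁻¹) = (Np + Nm) / Np by field_simp, div_zpow,
          _root_.zpow_neg (Np : ℂ), div_inv_eq_mul, mul_comm ((Np : ℂ) ^ _)]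
      · intro j hj
        simp only [Seed.mutate, hi, hj, or_self, if_false, abs_of_pos h]
        rcases le_or_gt (S.ε k j) 0 with h' | h'
        · rw [if_neg (by nlinarith), max_eq_right (by omega)]; ring
        · rw [if_pos (by nlinarith), max_eq_left (by omega)]

/-! ## Seeds of words with the faces of a fixed word -/

/-- The seed of the word `w` on the labels of all faces of the word `W`. -/
def bigSeedOn {r : ℕ} (W w : List (Letter r)) : Seed where
  I := Face W
  ε f g := eps 0 w (lab f) (lab g)
  skew _ _ := eps_skew _ _ _ _

/-- The seed of the word `w` on the labels of the inner faces of the word `W`. -/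
def innerSeedOn {r : ℕ} (W w : List (Letter r)) : Seed where
  I := InnerFace W
  ε f g := eps 0 w (lab f.1) (lab g.1)
  skew _ _ := eps_skew _ _ _ _

/-- Two letters are opposite if they are `i` and `-i` for some `i`. -/
def Opposite {r : ℕ} (c d : Letter r) : Prop :=
  ∃ i, (c = .pos i ∧ d = .neg i) ∨ (c = .neg i ∧ d = .pos i)

/-! ### Exchange of opposite letters as quiver mutation -/

section swap
variable {r : ℕ}

/-- The indicator function of a label. -/
def ind (x f : Label r) : ℤ := if f = x then 1 else 0

lemma ind_self (x : Label r) : ind x x = 1 := if_pos rfl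

lemma ind_of_ne {x f : Label r} (h : f ≠ x) : ind x f = 0 := if_neg h

/-- In this form identities between quivers become polynomial identities in indicator functions. -/
lemma cyc_eq_ind (x y z f g : Label r) :
    cyc x y z f g = ind x f * ind y g + ind y f * ind z g + ind z f * ind x g -
      (ind y f * ind x g + ind z f * ind y g + ind x f * ind z g) := by
  simp only [cyc, cycleArrows, ind, ite_and, mul_ite, mul_one, mul_zero]
  split_ifs <;> rfl

/-- The sign of a letter. -/
def Letter.sgn {r : ℕ} : Letter r → ℤ
  | .pos _ => 1
  | .neg _ => -1

/-- The indicator function of the faces above and below a letter. -/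
def indV (c : Letter r) (n : Count r) (f : Label r) : ℤ := ind (c.top n) f + ind (c.bot n) f

/-- The indicator function of the outer faces of two letters of the same index. -/
def indH (c : Letter r) (n : Count r) (f : Label r) : ℤ :=
  ind (c.left n) f + ind (c.spacing, n c.spacing + 2) f

lemma Opposite.symm {c d : Letter r} (h : Opposite c d) : Opposite d c := by
  obtain ⟨i, h | h⟩ := h
  exacts [⟨i, Or.inr h.symm⟩, ⟨i, Or.inl h.symm⟩]

lemma Opposite.faces {c d : Letter r} (h : Opposite c d) (n : Count r) :
    d.spacing = c.spacing ∧ d.top n = c.top n ∧ d.bot n = c.bot n ∧ d.left n = c.left n ∧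
      d.right n = c.right n ∧ d.step n = c.step n ∧ d.sgn = -c.sgn ∧ d.above = c.above ∧
      d.below = c.below ∧ d.index = c.index := by
  obtain ⟨i, ⟨rfl, rfl⟩ | ⟨rfl, rfl⟩⟩ := h <;> exact ⟨rfl, rfl, rfl, rfl, rfl, rfl, rfl, rfl, rfl, rfl⟩

lemma Opposite.step_faces {c d : Letter r} (h : Opposite c d) (n : Count r) :
    d.left (c.step n) = c.right n ∧ d.right (c.step n) = (c.spacing, n c.spacing + 2) ∧
      d.top (c.step n) = c.top n ∧ d.bot (c.step n) = c.bot n := by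
  have e := h.faces n
  refine ⟨?_, ?_, ?_, ?_⟩
  · simp only [Letter.left, Letter.right, e, step_spacing]
  · simp only [Letter.right, e, step_spacing]
  · simp only [Letter.top, e, step_above]
  · simp only [Letter.bot, e, step_below]

/-- The arrows between the neighbours of the middle face. -/
def outerArr (c : Letter r) (n : Count r) (f g : Label r) : ℤ :=
  let L := c.left n
  let R : Label r := (c.spacing, n c.spacing + 2)
  let T := c.top n
  let B := c.bot n
  match c with
  | .pos _ => ind L f * ind B g - ind B f * ind L g + (ind R f * ind T g - ind T f * ind R g)
  | .neg _ => ind T f * ind L g - ind L f * ind T g + (ind B f * ind R g - ind R f * ind B g)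

/-- The sum of the contributions of two consecutive opposite letters. -/
lemma arr_add_arr {c d : Letter r} (h : Opposite c d) (n : Count r) (f g : Label r) :
    c.arr n f g + d.arr (c.step n) f g =
      c.sgn * ((indV c n f - indH c n f) * ind (c.right n) g -
        ind (c.right n) f * (indV c n g - indH c n g)) + outerArr c n f g := by
  obtain ⟨e1, e2, e3, e4⟩ := h.step_faces n
  obtain ⟨i, ⟨rfl, rfl⟩ | ⟨rfl, rfl⟩⟩ := h
  · simp only [Letter.arr, e1, e2, e3, cyc_eq_ind, Letter.sgn, indV, indH, outerArr]
    ring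
  · simp only [Letter.arr, e1, e2, e4, cyc_eq_ind, Letter.sgn, indV, indH, outerArr]
    ring

/-- Reversing the order of the two triangles changes the arrows between outer faces by the wedge of
the vertical with the horizontal neighbours. These are the arrows that mutation composes through the
middle face. -/
lemma outerArr_symm {c d : Letter r} (h : Opposite c d) (n : Count r) (f g : Label r) :
    outerArr d n f g =
      outerArr c n f g + c.sgn * (indV c n f * indH c n g - indH c n f * indV c n g) := by
  have e := h.faces n
  simp only [outerArr, e, indV, indH]
  obtain ⟨i, ⟨rfl, rfl⟩ | ⟨rfl, rfl⟩⟩ := h <;> simp only [Letter.sgn] <;> ring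

/-- The faces around the middle face of two consecutive letters of the same index. -/
lemma faces_ne (c : Letter r) (n : Count r) :
    let L := c.left n
    let M := c.right n
    let R : Label r := (c.spacing, n c.spacing + 2)
    let T := c.top n
    let B := c.bot n
    L ≠ M ∧ L ≠ R ∧ L ≠ T ∧ L ≠ B ∧ M ≠ R ∧ M ≠ T ∧ M ≠ B ∧ R ≠ T ∧ R ≠ B ∧ T ≠ B := by
  have h1 := spacing_ne_above c
  have h2 := spacing_ne_below c
  have h3 := above_ne_below c
  simp [Letter.left, Letter.right, Letter.top, Letter.bot, h1, h2, h3]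

lemma ind_middle (c : Letter r) (n : Count r) :
    indV c n (c.right n) = 0 ∧ indH c n (c.right n) = 0 := by
  obtain ⟨h1, -, -, -, h5, h6, h7, -⟩ := faces_ne c n
  simp [indV, indH, ind_of_ne h1.symm, ind_of_ne h5, ind_of_ne h6, ind_of_ne h7]

/-- The four neighbours of the middle face form two opposite pairs. -/
lemma neighbours_cases (c : Letter r) (n : Count r) (f : Label r) :
    (indV c n f = 0 ∧ indH c n f = 0) ∨ (indV c n f = 1 ∧ indH c n f = 0) ∨
      (indV c n f = 0 ∧ indH c n f = 1) := by
  obtain ⟨-, h1, h2, h3, -, -, -, h4, h5, h6⟩ := faces_ne c n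
  simp only [ind, indV, indH]
  by_cases a1 : f = c.top n
  · subst a1; simp [h2.symm, h4.symm, h6]
  by_cases a2 : f = c.bot n
  · subst a2; simp [h3.symm, h5.symm, h6.symm]
  by_cases a3 : f = c.left n
  · subst a3; simp [h1, h2, h3]
  by_cases a4 : f = (c.spacing, n c.spacing + 2)
  · subst a4; simp [h1.symm, h4, h5]
  · simp [a1, a2, a3, a4]

lemma outerArr_middle (c : Letter r) (n : Count r) (f : Label r) :
    outerArr c n f (c.right n) = 0 := by
  obtain ⟨h1, -, -, -, h5, h6, h7, -⟩ := faces_ne c n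
  cases c <;> simp only [outerArr, ind_of_ne h1.symm, ind_of_ne h5, ind_of_ne h6, ind_of_ne h7] <;>
    ring

lemma eps_split (w₁ w₂ : List (Letter r)) (c d : Letter r) (f g : Label r) :
    eps 0 (w₁ ++ c :: d :: w₂) f g =
      eps 0 w₁ f g + (c.arr (occ w₁) f g + d.arr (c.step (occ w₁)) f g) +
        eps (d.step (c.step (occ w₁))) w₂ f g := by
  have : (fun s => (0 : Count r) s + occ w₁ s) = occ w₁ := by simp
  rw [eps_append, eps, eps, this]; ring

/-- The row of the middle face. -/
lemma eps_middle (w₁ w₂ : List (Letter r)) {c d : Letter r} (h : Opposite c d) (f : Label r) :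
    eps 0 (w₁ ++ c :: d :: w₂) f (c.right (occ w₁)) =
      c.sgn * (indV c (occ w₁) f - indH c (occ w₁) f) := by
  have h1 : eps 0 w₁ f (c.right (occ w₁)) = 0 := by
    rw [eps_skew, eps_eq_zero_of_gt, neg_zero]
    simp [Letter.right]
  have h2 : eps (d.step (c.step (occ w₁))) w₂ f (c.right (occ w₁)) = 0 := by
    rw [eps_skew, eps_eq_zero_of_lt, neg_zero]
    simp [Letter.right, Letter.step, (h.faces 0).1]
  rw [eps_split, h1, h2, arr_add_arr h, (ind_middle c _).1, (ind_middle c _).2,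
    outerArr_middle, ind_self]
  ring

/-- Exchanging two consecutive opposite letters mutates the quiver at the face between them. -/
lemma eps_swap (w₁ w₂ : List (Letter r)) {c d : Letter r} (h : Opposite c d) (f g : Label r) :
    let M := c.right (occ w₁)
    let ε := eps 0 (w₁ ++ c :: d :: w₂)
    (if f = M ∨ g = M then -ε f g
      else if 0 < ε f M * ε M g then ε f g + |ε f M| * ε M g else ε f g) =
      eps 0 (w₁ ++ d :: c :: w₂) f g := by
  intro M ε
  have e := h.faces (occ w₁)
  have hV : indV d (occ w₁) = indV c (occ w₁) := by funext f; simp only [indV, e]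
  have hH : indH d (occ w₁) = indH c (occ w₁) := by funext f; simp only [indH, e]
  have hM : ∀ f, ε f M = c.sgn * (indV c (occ w₁) f - indH c (occ w₁) f) :=
    fun f => eps_middle w₁ w₂ h f
  have hM' : ∀ f, eps 0 (w₁ ++ d :: c :: w₂) f M = -ε f M := by
    intro f
    have := eps_middle w₁ w₂ h.symm f
    rw [hV, hH, e.2.2.2.2.1, e.2.2.2.2.2.2.1] at this
    rw [hM, this]; ring
  have hskew : ∀ g, ε M g = -ε g M := fun g => eps_skew _ _ _ _
  split_ifs with hfM hpos
  · rcases hfM with rfl | rfl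
    · rw [eps_skew 0 (w₁ ++ d :: c :: w₂), hM', hskew]
    · rw [hM']
  all_goals
    rw [not_or] at hfM
    have hdiff : eps 0 (w₁ ++ d :: c :: w₂) f g = ε f g + c.sgn *
        (indV c (occ w₁) f * indH c (occ w₁) g - indH c (occ w₁) f * indV c (occ w₁) g) := by
      have hst : c.step (d.step (occ w₁)) = d.step (c.step (occ w₁)) := by
        rw [e.2.2.2.2.2.1, (h.faces _).2.2.2.2.2.1]
      simp only [ε]
      rw [eps_split, eps_split, arr_add_arr h, arr_add_arr h.symm, outerArr_symm h, hst,
        e.2.2.2.2.1, hV, hH, ind_of_ne hfM.1, ind_of_ne hfM.2]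
      ring
    rw [hdiff]
    rw [hskew, hM, hM] at *
    have hσ : c.sgn = 1 ∨ c.sgn = -1 := by cases c <;> simp [Letter.sgn]
    -- Each of the two faces is a vertical neighbour, a horizontal neighbour or neither; with the
    -- sign of the letter this leaves eighteen cases about small integers.
    rcases neighbours_cases c (occ w₁) f with hf | hf | hf <;>
    rcases neighbours_cases c (occ w₁) g with hg | hg | hg <;>
    rcases hσ with hσ | hσ <;>
    simp_all

end swap

/-! ## Pairings of two chains of flags and moves of words -/

/-- The negative letters of a word. -/
def negs {r : ℕ} (w : List (Letter r)) : List (Fin r) := w.filterMap Letter.neg?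

/-- The positive letters of a word. -/
def poss {r : ℕ} (w : List (Letter r)) : List (Fin r) := w.filterMap Letter.pos?

section letters
variable {r : ℕ}

@[simp] lemma negs_nil : negs ([] : List (Letter r)) = [] := rfl
@[simp] lemma poss_nil : poss ([] : List (Letter r)) = [] := rfl
@[simp] lemma negs_cons_neg (i : Fin r) (w) : negs (.neg i :: w) = i :: negs w := rfl
@[simp] lemma negs_cons_pos (i : Fin r) (w) : negs (.pos i :: w) = negs w := rfl
@[simp] lemma poss_cons_neg (i : Fin r) (w) : poss (.neg i :: w) = poss w := rfl
@[simp] lemma poss_cons_pos (i : Fin r) (w) : poss (.pos i :: w) = i :: poss w := rfl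
@[simp] lemma negs_append (w w' : List (Letter r)) : negs (w ++ w') = negs w ++ negs w' := by
  simp [negs]
@[simp] lemma poss_append (w w' : List (Letter r)) : poss (w ++ w') = poss w ++ poss w' := by
  simp [poss]

end letters

/-- The properties of the pairings `Pr s n m` in spacing `s` of the `n`-th member of the chain of
flags with letters `b ++ a.reverse` and the `m`-th member of the chain of opposite flags with letters
`b.reverse ++ a`. -/
structure IsPairing {r : ℕ} (b a : List (Fin r)) (Pr : Fin (r + 2) → ℕ → ℕ → ℂ) : Prop where
  top_const : ∀ n i, (b ++ a.reverse)[n]? = some i → ∀ s, (Letter.neg i).spacing ≠ s →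
    ∀ m, Pr s (n + 1) m = Pr s n m
  bot_const : ∀ m i, (b.reverse ++ a)[m]? = some i → ∀ s, (Letter.pos i).spacing ≠ s →
    ∀ n, Pr s n (m + 1) = Pr s n m
  exchange : ∀ n m i, (b ++ a.reverse)[n]? = some i → (b.reverse ++ a)[m]? = some i →
    Pr (Letter.pos i).above n m ≠ 0 →
    Pr (Letter.pos i).spacing n (m + 1) * Pr (Letter.pos i).spacing (n + 1) m =
      Pr (Letter.pos i).spacing n m * Pr (Letter.pos i).spacing (n + 1) (m + 1) +
        Pr (Letter.pos i).above n m * Pr (Letter.pos i).below n m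
  -- This and the next condition annihilate one term of the exchange relation at the left or right
  -- boundary face, which is what allows the sign of an extreme letter to change.
  left_zero : ∀ b₁ i b₂, b = b₁ ++ i :: b₂ → Pr (Letter.pos i).spacing b₁.length b₂.length = 0
  right_zero : ∀ a₁ i a₂, a = a₁ ++ i :: a₂ →
    Pr (Letter.pos i).spacing (b.length + a₂.length + 1) (b.length + a₁.length + 1) = 0

/-- The pairing at the end of the word `v` that starts at the members `n` and `m` of the chains. -/
def pairAt {r : ℕ} (Pr : Fin (r + 2) → ℕ → ℕ → ℂ) (n m : ℕ) (v : List (Letter r))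
    (s : Fin (r + 2)) : ℂ :=
  Pr s (n + (negs v).length) (m + (poss v).length)

/-- The word `w` fits into the chains of flags at the members `n` and `m`. -/
def Fits {r : ℕ} (b a : List (Fin r)) (w : List (Letter r)) (n m : ℕ) : Prop :=
  negs w <+: (b ++ a.reverse).drop n ∧ poss w <+: (b.reverse ++ a).drop m

/-- The face variables of the word `w` are the pairings. -/
def IsFaceVar {r : ℕ} (Pr : Fin (r + 2) → ℕ → ℕ → ℂ) (w : List (Letter r)) (n m : ℕ)
    (x : Label r → ℂˣ) : Prop :=
  ∀ v v', w = v ++ v' → ∀ s, (x (s, occ v s) : ℂ) = pairAt Pr n m v s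

/-- The coordinates `X` on the inner faces are the monomials in the pairings. -/
def IsCoord {r : ℕ} (W : List (Letter r)) (Pr : Fin (r + 2) → ℕ → ℕ → ℂ) (w : List (Letter r))
    (n m : ℕ) (X : InnerFace W → ℂˣ) : Prop :=
  ∃ x : Label r → ℂˣ, IsFaceVar Pr w n m x ∧ ∀ f : InnerFace W, X f = prodCtr 0 w x (lab f.1)

/-- The monomials in the pairings along one word are taken to those along the other word by a
cluster composition. -/
def IsMove {r : ℕ} (W : List (Letter r)) (b a : List (Fin r)) (w : List (Letter r)) (n m : ℕ)
    (w' : List (Letter r)) (n' m' : ℕ) : Prop :=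
  ∃ R C, IsRegularComposition (innerSeedOn W w) (innerSeedOn W w') R C ∧
    ∀ Pr, IsPairing b a Pr → ∀ X z, IsCoord W Pr w n m X → C X z → IsCoord W Pr w' n' m' z

/-! ### Moves exchanging neighbouring letters -/

section moves
variable {r : ℕ} {W : List (Letter r)} {b a : List (Fin r)}

lemma IsMove.refl (w : List (Letter r)) (n m : ℕ) : IsMove W b a w n m w n m :=
  ⟨_, _, .refl, fun _ _ _ _ h e => e ▸ h⟩

lemma IsMove.trans {w w' w'' : List (Letter r)} {n m n' m' n'' m'' : ℕ}
    (h : IsMove W b a w n m w' n' m') (h' : IsMove W b a w' n' m' w'' n'' m'') :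
    IsMove W b a w n m w'' n'' m'' := by
  obtain ⟨R, C, hRC, H⟩ := h
  obtain ⟨R', C', hRC', H'⟩ := h'
  refine ⟨_, _, hRC.trans hRC', fun Pr hPr X z hX => ?_⟩
  rintro ⟨y, hy, hz⟩
  exact H' Pr hPr _ _ (H Pr hPr _ _ hX hy) hz

lemma occ_swap (w₁ w₂ : List (Letter r)) (c d : Letter r) (s : Fin (r + 2)) :
    occ (w₁ ++ d :: c :: w₂) s = occ (w₁ ++ c :: d :: w₂) s := by
  simp only [occ_append, occ_cons]; ring

/-- After an exchange of two neighbours only the prefix ending between them is new, up to the order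
of its letters; face variables at the other prefixes are inherited. -/
lemma prefix_cases {α : Type} {w₁ w₂ v v' : List α} {d c : α}
    (h : w₁ ++ d :: c :: w₂ = v ++ v') :
    (∃ t, w₁ = v ++ t) ∨ v = w₁ ++ [d] ∨ ∃ t, v = w₁ ++ d :: c :: t ∧ w₂ = t ++ v' := by
  rcases List.append_eq_append_iff.1 h with ⟨t, h1, h2⟩ | ⟨t, h1, -⟩
  · rcases t with _ | ⟨x, _ | ⟨y, t⟩⟩
    · exact Or.inl ⟨[], by simpa using h1.symm⟩
    · simp only [List.cons_append, List.nil_append, List.cons.injEq] at h2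
      exact Or.inr (Or.inl (by rw [h1, h2.1]))
    · simp only [List.cons_append, List.cons.injEq] at h2
      exact Or.inr (Or.inr ⟨t, by rw [h1, h2.1, h2.2.1], h2.2.2⟩)
  · exact Or.inl ⟨t, h1⟩

/-- The signs of two letters are different. -/
def Letter.Differ (c d : Letter r) : Prop :=
  ∃ i j, (c = .pos i ∧ d = .neg j) ∨ (c = .neg i ∧ d = .pos j)

lemma Letter.Differ.symm {c d : Letter r} (h : c.Differ d) : d.Differ c := by
  obtain ⟨i, j, h | h⟩ := h
  exacts [⟨j, i, Or.inr h.symm⟩, ⟨j, i, Or.inl h.symm⟩]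

lemma Letter.Differ.opposite {c d : Letter r} (h : c.Differ d) (e : c.spacing = d.spacing) :
    Opposite c d := by
  rw [spacing_eq_iff] at e
  obtain ⟨i, j, ⟨rfl, rfl⟩ | ⟨rfl, rfl⟩⟩ := h
  · obtain rfl : i = j := e; exact ⟨i, Or.inl ⟨rfl, rfl⟩⟩
  · obtain rfl : i = j := e; exact ⟨i, Or.inr ⟨rfl, rfl⟩⟩

lemma Letter.Differ.pairAt_swap {c d : Letter r} (h : c.Differ d) (Pr : Fin (r + 2) → ℕ → ℕ → ℂ)
    (n m : ℕ) (w₁ w₂ : List (Letter r)) (s : Fin (r + 2)) :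
    pairAt Pr n m (w₁ ++ d :: c :: w₂) s = pairAt Pr n m (w₁ ++ c :: d :: w₂) s := by
  obtain ⟨i, j, ⟨rfl, rfl⟩ | ⟨rfl, rfl⟩⟩ := h <;> simp [pairAt]

lemma prefix_drop_getElem? {α : Type} {l L : List α} {n : ℕ} (h : l <+: L.drop n) {k : ℕ} {x : α}
    (hk : l[k]? = some x) : L[n + k]? = some x := by
  obtain ⟨t, ht⟩ := h
  have hlt : k < l.length := by
    by_contra hlt
    rw [List.getElem?_eq_none (by omega)] at hk
    simp at hk
  rw [← List.getElem?_drop, ← ht, List.getElem?_append_left hlt, hk]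

/-- Letters change the pairings only in their spacing. -/
lemma IsPairing.pairAt_letter {Pr : Fin (r + 2) → ℕ → ℕ → ℂ} (hPr : IsPairing b a Pr)
    {w v v' : List (Letter r)} {n m : ℕ} (hw : Fits b a w n m) (c : Letter r)
    (e : w = v ++ c :: v') {s : Fin (r + 2)} (hs : c.spacing ≠ s) :
    pairAt Pr n m (v ++ [c]) s = pairAt Pr n m v s := by
  subst e
  cases c with
  | pos i =>
    have := hPr.bot_const (m + (poss v).length) i (prefix_drop_getElem? hw.2 (by
      simp)) s hs (n + (negs v).length)
    simpa [pairAt, add_assoc] using this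
  | neg i =>
    have := hPr.top_const (n + (negs v).length) i (prefix_drop_getElem? hw.1 (by
      simp)) s hs (m + (poss v).length)
    simpa [pairAt, add_assoc] using this

lemma Fits.swap {c d : Letter r} (h : c.Differ d) {w₁ w₂ : List (Letter r)} {n m : ℕ}
    (hw : Fits b a (w₁ ++ c :: d :: w₂) n m) : Fits b a (w₁ ++ d :: c :: w₂) n m := by
  obtain ⟨i, j, ⟨rfl, rfl⟩ | ⟨rfl, rfl⟩⟩ := h <;>
    simpa [Fits] using hw

lemma IsPairing.pairAt_exchange {Pr : Fin (r + 2) → ℕ → ℕ → ℂ} (hPr : IsPairing b a Pr)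
    {w₁ w₂ : List (Letter r)} {n m : ℕ} {c d : Letter r} (h : Opposite c d)
    (hw : Fits b a (w₁ ++ c :: d :: w₂) n m) (h0 : pairAt Pr n m w₁ c.above ≠ 0) :
    pairAt Pr n m (w₁ ++ [c]) c.spacing * pairAt Pr n m (w₁ ++ [d]) c.spacing =
      pairAt Pr n m w₁ c.spacing * pairAt Pr n m (w₁ ++ [c, d]) c.spacing +
        pairAt Pr n m w₁ c.above * pairAt Pr n m w₁ c.below := by
  obtain ⟨i, ⟨rfl, rfl⟩ | ⟨rfl, rfl⟩⟩ := h
  · have := hPr.exchange (n + (negs w₁).length) (m + (poss w₁).length) i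
      (prefix_drop_getElem? hw.1 (by simp))
      (prefix_drop_getElem? hw.2 (by simp)) h0
    simpa [pairAt, add_assoc] using this
  · have := hPr.exchange (n + (negs w₁).length) (m + (poss w₁).length) i
      (prefix_drop_getElem? hw.1 (by simp))
      (prefix_drop_getElem? hw.2 (by simp)) h0
    rw [mul_comm] at this
    have e : (Letter.neg i).spacing = (Letter.pos i).spacing ∧
      (Letter.neg i).above = (Letter.pos i).above ∧
      (Letter.neg i).below = (Letter.pos i).below := ⟨rfl, rfl, rfl⟩
    simpa [pairAt, add_assoc, e] using this

/-- The cluster composition given by equality of exchange matrices. -/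
lemma isRegularComposition_of_eps_eq {w w' : List (Letter r)}
    (h : ∀ f g : InnerFace W, eps 0 w' (lab f.1) (lab g.1) = eps 0 w (lab f.1) (lab g.1)) :
    IsRegularComposition (innerSeedOn W w) (innerSeedOn W w') (fun X z => z = X)
      (fun X z => z = X) := by
  have key := IsRegularComposition.iso (.refl (s := innerSeedOn W w))
    (⟨Equiv.refl _, h⟩ : SeedIso (innerSeedOn W w) (innerSeedOn W w'))
  have e : Relation.Comp Eq (isoRel (⟨Equiv.refl _, h⟩ :
      SeedIso (innerSeedOn W w) (innerSeedOn W w'))) = fun X z => z = X := by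
    funext X z
    rw [Relation.eq_comp]
    exact propext ⟨fun H => funext fun i => H i, fun H i => congrFun H i⟩
  rwa [e] at key

/-- The two triangles interact only if the positive letter is in the spacing directly above that of
the negative one. Then either order of the letters cuts the same oriented 4-cycle of faces by one of
its two diagonals, and the arrows along the diagonal cancel. -/
lemma eps_swap_of_ne (w₁ w₂ : List (Letter r)) {c d : Letter r} (h : c.Differ d)
    (hcd : c.spacing ≠ d.spacing) (f g : Label r) :
    eps 0 (w₁ ++ d :: c :: w₂) f g = eps 0 (w₁ ++ c :: d :: w₂) f g := by
  wlog hc : ∃ i, c = .pos i generalizing c d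
  · have h' := h.symm
    obtain ⟨i, j, ⟨rfl, rfl⟩ | ⟨rfl, rfl⟩⟩ := h
    · exact absurd ⟨i, rfl⟩ hc
    · exact (this h' hcd.symm ⟨j, rfl⟩).symm
  obtain ⟨i, rfl⟩ := hc
  obtain ⟨j, rfl⟩ : ∃ j, d = .neg j := by
    obtain ⟨i', j, ⟨-, rfl⟩ | ⟨h, -⟩⟩ := h
    · exact ⟨j, rfl⟩
    · cases h
  set c : Letter r := .pos i with hc
  set d : Letter r := .neg j with hd
  rw [eps_split, eps_split]
  have hst : ∀ n, c.step (d.step n) = d.step (c.step n) := by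
    intro n; funext s; simp only [Letter.step]; ring
  rw [hst]
  congr 2
  generalize occ w₁ = n
  have e1 : d.left (c.step n) = d.left n := by simp only [Letter.left, step_of_ne n hcd]
  have e2 : d.right (c.step n) = d.right n := by simp only [Letter.right, step_of_ne n hcd]
  have e3 : c.left (d.step n) = c.left n := by simp only [Letter.left, step_of_ne n hcd.symm]
  have e4 : c.right (d.step n) = c.right n := by simp only [Letter.right, step_of_ne n hcd.symm]
  by_cases hji : c.spacing = d.above
  · have hij : c.below = d.spacing := by
      rw [Fin.ext_iff, spacing_val, above_val] at hji
      rw [Fin.ext_iff, spacing_val, below_val]; omega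
    have e5 : d.top (c.step n) = c.right n := by
      rw [Letter.top, ← hji, step_spacing, Letter.right]
    have e6 : c.bot (d.step n) = d.right n := by
      rw [Letter.bot, hij, step_spacing, Letter.right]
    have e7 : d.top n = c.left n := by rw [Letter.top, ← hji, Letter.left]
    have e8 : c.bot n = d.left n := by rw [Letter.bot, hij, Letter.left]
    simp only [hc, hd, Letter.arr] at *
    simp only [e1, e2, e3, e4, e5, e6, e7, e8, cyc_eq_ind]
    ring
  · have hij : d.spacing ≠ c.below := by
      intro h
      apply hji
      rw [Fin.ext_iff, spacing_val, below_val] at h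
      rw [Fin.ext_iff, spacing_val, above_val]; omega
    have e5 : d.top (c.step n) = d.top n := by simp only [Letter.top, step_of_ne n hji]
    have e6 : c.bot (d.step n) = c.bot n := by simp only [Letter.bot, step_of_ne n hij]
    simp only [hc, hd, Letter.arr] at *
    simp only [e1, e2, e3, e4, e5, e6]
    ring

lemma prodCtr_eq_prod {w : List (Letter r)} (hW : ∀ s, occ w s = occ W s) (x : Label r → ℂˣ)
    (f : Label r) : prodCtr 0 w x f = ∏ g : Face W, x (lab g) ^ eps 0 w f (lab g) :=
  (prod_zpow_eps x w 0 (fun s => by simp [hW s]) f).symm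

/-- Exchanging two consecutive letters of different signs and different indices. -/
lemma isMove_swap_of_ne {w₁ w₂ : List (Letter r)} {n m : ℕ} {c d : Letter r} (h : c.Differ d)
    (hW : ∀ s, occ (w₁ ++ c :: d :: w₂) s = occ W s)
    (hw : Fits b a (w₁ ++ c :: d :: w₂) n m) (hcd : c.spacing ≠ d.spacing) :
    IsMove W b a (w₁ ++ c :: d :: w₂) n m (w₁ ++ d :: c :: w₂) n m := by
  refine ⟨_, _, isRegularComposition_of_eps_eq fun f g => eps_swap_of_ne w₁ w₂ h hcd _ _, ?_⟩
  rintro Pr hPr X z ⟨x, hx, hX⟩ rfl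
  refine ⟨x, fun v v' hv s => ?_, fun f => ?_⟩
  · rcases prefix_cases hv with ⟨t, rfl⟩ | rfl | ⟨t, rfl, rfl⟩
    · exact hx v (t ++ c :: d :: w₂) (by simp) s
    -- In the old word the face to the right of `d` is first met after both letters; `c` lies in
    -- another spacing and does not change the pairing there.
    · by_cases hs : d.spacing = s
      · subst hs
        have h1 := hx (w₁ ++ [c, d]) w₂ (by simp) d.spacing
        rw [← h.pairAt_swap, ← occ_swap] at h1
        have h2 := hPr.pairAt_letter (hw.swap h) (v := w₁ ++ [d]) (v' := w₂) c (by simp) hcd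
        rw [← h2]
        simpa [occ_append, occ_cons, hcd] using h1
      · rw [hPr.pairAt_letter (hw.swap h) d rfl hs, ← hx w₁ _ rfl]
        simp [occ_append, occ_cons, hs, occ_nil]
    · rw [occ_swap, h.pairAt_swap]
      exact hx _ v' (by simp) s
  · rw [hX, prodCtr_eq_prod hW, prodCtr_eq_prod (fun s => (occ_swap _ _ _ _ s).trans (hW s))]
    simp only [eps_swap_of_ne w₁ w₂ h hcd]

lemma prod_zpow_ind (x : Label r → ℂˣ) (F : Face W) :
    ∏ g : Face W, x (lab g) ^ ind (lab F) (lab g) = x (lab F) := by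
  simpa [ind] using prod_zpow_single x F True

/-- Exchanging two consecutive opposite letters. -/
lemma isMove_swap_of_opposite {w₁ w₂ : List (Letter r)} {n m : ℕ} {c d : Letter r}
    (h : Opposite c d) (hW : ∀ s, occ (w₁ ++ c :: d :: w₂) s = occ W s)
    (hw : Fits b a (w₁ ++ c :: d :: w₂) n m) :
    IsMove W b a (w₁ ++ c :: d :: w₂) n m (w₁ ++ d :: c :: w₂) n m := by
  set w := w₁ ++ c :: d :: w₂ with hwdef
  set w' := w₁ ++ d :: c :: w₂ with hwdef'
  have e := h.faces (occ w₁)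
  have hdiff : c.Differ d := by obtain ⟨i, h⟩ := h; exact ⟨i, i, h⟩
  have hW' : ∀ s, occ w' s = occ W s := fun s => (occ_swap _ _ _ _ s).trans (hW s)
  have hocc : occ w₁ c.spacing + 2 ≤ occ W c.spacing := by
    rw [← hW, hwdef, occ_append, occ_cons, occ_cons, e.1]; simp
  obtain ⟨M, hM⟩ : ∃ M : InnerFace W, lab M.1 = c.right (occ w₁) :=
    ⟨⟨⟨c.spacing, occ w₁ c.spacing + 1, by omega⟩, by simp; omega⟩, rfl⟩
  obtain ⟨L, hL⟩ : ∃ f : Face W, lab f = c.left (occ w₁) :=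
    exists_face (by simp [Letter.left]; omega)
  obtain ⟨R, hR⟩ : ∃ f : Face W, lab f = (c.spacing, occ w₁ c.spacing + 2) :=
    exists_face hocc
  obtain ⟨T, hT⟩ : ∃ f : Face W, lab f = c.top (occ w₁) :=
    exists_face (by rw [← hW, hwdef, occ_append]; simp [Letter.top])
  obtain ⟨B, hB⟩ : ∃ f : Face W, lab f = c.bot (occ w₁) :=
    exists_face (by rw [← hW, hwdef, occ_append]; simp [Letter.bot])
  have hεmut : ∀ f g : Face W, (Seed.mutate (bigSeedOn W w) M.1).ε f g =
      eps 0 w' (lab f) (lab g) := by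
    intro f g
    have := eps_swap w₁ w₂ h (lab f) (lab g)
    rw [← hM] at this
    simp only [(lab_injective W).eq_iff] at this
    exact this
  let hσ : SeedIso ((innerSeedOn W w).mutate M) (innerSeedOn W w') :=
    ⟨Equiv.refl _, fun (f g : InnerFace W) => by
      have := hεmut f.1 g.1
      refine this.symm.trans ?_
      simp only [Seed.mutate, bigSeedOn, innerSeedOn, Subtype.ext_iff]⟩
  have hV : ∀ x : Label r → ℂˣ, ∏ g : Face W, x (lab g) ^ indV c (occ w₁) (lab g) =
      x (lab T) * x (lab B) := by
    intro x
    simp only [indV, ← hT, ← hB, _root_.zpow_add, Finset.prod_mul_distrib, prod_zpow_ind]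
  have hH : ∀ x : Label r → ℂˣ, ∏ g : Face W, x (lab g) ^ indH c (occ w₁) (lab g) =
      x (lab L) * x (lab R) := by
    intro x
    simp only [indH, ← hL, ← hR, _root_.zpow_add, Finset.prod_mul_distrib, prod_zpow_ind]
  have hrow : ∀ g : Face W, eps 0 w (lab M.1) (lab g) =
      c.sgn * (indH c (occ w₁) (lab g) - indV c (occ w₁) (lab g)) := by
    intro g
    rw [eps_skew, hM, eps_middle w₁ w₂ h]; ring
  have hrow' : (∀ g : Face W, max (eps 0 w (lab M.1) (lab g)) 0 = indH c (occ w₁) (lab g) ∧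
      max (-eps 0 w (lab M.1) (lab g)) 0 = indV c (occ w₁) (lab g)) ∨
      (∀ g : Face W, max (eps 0 w (lab M.1) (lab g)) 0 = indV c (occ w₁) (lab g) ∧
      max (-eps 0 w (lab M.1) (lab g)) 0 = indH c (occ w₁) (lab g)) := by
    have hs : c.sgn = 1 ∨ c.sgn = -1 := by cases c <;> simp [Letter.sgn]
    refine hs.imp (fun hs g => ?_) (fun hs g => ?_) <;>
    · rw [hrow, hs]
      rcases neighbours_cases c (occ w₁) (lab g) with hg | hg | hg <;> simp [hg]
  refine ⟨_, _, ((IsRegularComposition.refl).mutation M).iso hσ, ?_⟩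
  rintro Pr hPr X z ⟨x, hx, hX⟩ ⟨y, ⟨X', rfl, hmut, h1⟩, hiso⟩
  have q0 : ∀ s, (x (s, occ w₁ s) : ℂ) = pairAt Pr n m w₁ s := hx w₁ _ rfl
  have qL : (x (lab L) : ℂ) = pairAt Pr n m w₁ c.spacing := by rw [hL]; exact q0 _
  have qT : (x (lab T) : ℂ) = pairAt Pr n m w₁ c.above := by rw [hT]; exact q0 _
  have qB : (x (lab B) : ℂ) = pairAt Pr n m w₁ c.below := by rw [hB]; exact q0 _
  have qM : (x (lab M.1) : ℂ) = pairAt Pr n m (w₁ ++ [c]) c.spacing := by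
    rw [hM, ← hx (w₁ ++ [c]) (d :: w₂) (by simp [hwdef])]
    simp [occ_append, occ_cons, occ_nil, Letter.right]
  have qR : (x (lab R) : ℂ) = pairAt Pr n m (w₁ ++ [c, d]) c.spacing := by
    rw [hR, ← hx (w₁ ++ [c, d]) w₂ (by simp [hwdef])]
    simp [occ_append, occ_cons, occ_nil, e.1]
  have hex := hPr.pairAt_exchange h hw (by rw [← qT]; exact Units.ne_zero _)
  rw [← qL, ← qT, ← qB, ← qM, ← qR] at hex
  have hXM : (X M : ℂ) = (x (lab L) * x (lab R)) / (x (lab T) * x (lab B)) ∨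
      (X M : ℂ) = (x (lab T) * x (lab B)) / (x (lab L) * x (lab R)) := by
    have hXM := hX M
    rw [prodCtr_eq_prod hW] at hXM
    simp only [hrow] at hXM
    rcases (show c.sgn = 1 ∨ c.sgn = -1 by cases c <;> simp [Letter.sgn]) with hs | hs
    · left
      rw [hXM]
      simp only [hs, one_mul, _root_.zpow_sub, Finset.prod_mul_distrib, Finset.prod_inv_distrib,
        hV, hH]
      push_cast
      rw [div_eq_mul_inv]
    · right
      rw [hXM]
      simp only [hs, neg_one_mul, neg_sub, _root_.zpow_sub, Finset.prod_mul_distrib,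
        Finset.prod_inv_distrib, hV, hH]
      push_cast
      rw [div_eq_mul_inv]
  -- This is where `1 + X M ≠ 0` is needed separately: if `M` has no arrows to inner faces, the
  -- mutation relation alone does not force it.
  have hsum : (x (lab L) : ℂ) * x (lab R) + x (lab T) * x (lab B) ≠ 0 := by
    have l0 := (x (lab L)).ne_zero
    have r0 := (x (lab R)).ne_zero
    have t0 := (x (lab T)).ne_zero
    have b0 := (x (lab B)).ne_zero
    intro h0
    apply h1
    rcases hXM with hXM | hXM
    · rw [hXM]; field_simp; linear_combination h0
    · rw [hXM]; field_simp; linear_combination h0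
  have hqd : pairAt Pr n m (w₁ ++ [d]) c.spacing ≠ 0 := by
    intro h0
    rw [h0, mul_zero] at hex
    exact hsum hex.symm
  -- Only the face between the two letters changes its variable; the new value is the pairing after
  -- `d` alone, a unit by the exchange relation.
  set x' : Label r → ℂˣ := Function.update x (lab M.1) (Units.mk0 _ hqd) with hx'
  have hx'M : x' (lab M.1) = Units.mk0 _ hqd := Function.update_self _ _ _
  have hx'ne : ∀ l, l ≠ lab M.1 → x' l = x l := fun l hl => Function.update_of_ne hl _ _
  -- The mutation is first performed on all faces, where `p` has its full exponents, and then
  -- restricted to inner faces; the mutated face is itself inner.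
  have hp := mutationRel_p (bigSeedOn W w) M.1 (fun f => x (lab f)) (fun f => x' (lab f))
    (fun j hj => hx'ne _ (fun e => hj (lab_injective W e))) (by
      have e1 : ∏ j : Face W, x (lab j) ^ max (eps 0 w (lab M.1) (lab j)) 0 =
          x (lab L) * x (lab R) ∧
          ∏ j : Face W, x (lab j) ^ max (-eps 0 w (lab M.1) (lab j)) 0 =
          x (lab T) * x (lab B) ∨
          ∏ j : Face W, x (lab j) ^ max (eps 0 w (lab M.1) (lab j)) 0 =
          x (lab T) * x (lab B) ∧
          ∏ j : Face W, x (lab j) ^ max (-eps 0 w (lab M.1) (lab j)) 0 =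
          x (lab L) * x (lab R) := by
        rcases hrow' with hr | hr
        · left; simp only [hr, hV, hH, and_self]
        · right; simp only [hr, hV, hH, and_self]
      change (x' (lab M.1) : ℂ) * x (lab M.1) =
        ((∏ j : Face W, x (lab j) ^ max (eps 0 w (lab M.1) (lab j)) 0 : ℂˣ) : ℂ) +
        ((∏ j : Face W, x (lab j) ^ max (-eps 0 w (lab M.1) (lab j)) 0 : ℂˣ) : ℂ)
      rw [hx'M, Units.val_mk0]
      rcases e1 with ⟨e1, e2⟩ | ⟨e1, e2⟩ <;>
      · rw [e1, e2]
        push_cast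
        linear_combination hex)
  have hpX : ∀ f : InnerFace W, (bigSeedOn W w).p (fun f => x (lab f)) f.1 = X f := by
    intro f
    rw [hX f, prodCtr_eq_prod hW]
    rfl
  have hy : ∀ f : InnerFace W, y f =
      (Seed.mutate (bigSeedOn W w) M.1).p (fun f => x' (lab f)) f.1 := by
    intro f
    by_cases hf : f = M
    · subst hf
      exact hmut.1.trans ((congrArg (·⁻¹) (hpX f)).symm.trans hp.1.symm)
    · apply Units.ext
      refine (hmut.2 f hf).trans (Eq.trans ?_ (hp.2 f.1 (fun h => hf (Subtype.ext h))).symm)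
      rw [← hpX f, ← hpX M]
      rfl
  refine ⟨x', fun v v' hv s => ?_, fun f => ?_⟩
  · rcases prefix_cases hv with ⟨t, rfl⟩ | rfl | ⟨t, rfl, rfl⟩
    · rw [hx'ne, hx v (t ++ c :: d :: w₂) (by simp [hwdef]) s]
      rw [hM]
      intro h
      simp only [Letter.right, Prod.mk.injEq] at h
      obtain ⟨rfl, h⟩ := h
      rw [occ_append] at h
      omega
    · by_cases hs : c.spacing = s
      · subst hs
        have : (c.spacing, occ (w₁ ++ [d]) c.spacing) = lab M.1 := by
          rw [hM]
          simp [occ_append, occ_cons, occ_nil, Letter.right, e.1]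
        rw [this, hx'M, Units.val_mk0]
      · rw [hPr.pairAt_letter (hw.swap hdiff) d rfl (e.1 ▸ hs), ← hx w₁ _ rfl, hx'ne]
        · simp [occ_append, occ_cons, occ_nil, e.1, hs]
        · rw [hM]
          intro h
          exact hs (congrArg Prod.fst h).symm
    · rw [hx'ne, occ_swap, hdiff.pairAt_swap]
      · exact hx _ v' (by simp [hwdef]) s
      · rw [hM]
        intro h
        simp only [Letter.right, Prod.mk.injEq] at h
        obtain ⟨rfl, h⟩ := h
        simp only [occ_append, occ_cons, e.1, if_true] at h
        omega
  · have h2 : z f = y f := hiso f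
    rw [h2, hy, prodCtr_eq_prod hW']
    exact Finset.prod_congr rfl fun (g : Face W) _ =>
      congrArg (fun t : ℤ => x' (lab g) ^ t) (hεmut f.1 g)

end moves

/-! ### Changing the sign of the first or last letter -/

section flips
variable {r : ℕ} {W : List (Letter r)} {b a : List (Fin r)}

/-- Changing the sign of a negative first letter. -/
lemma isMove_first {w : List (Letter r)} {n m : ℕ} {i : Fin r}
    (hW : ∀ s, occ (.neg i :: w) s = occ W s) (hw : Fits b a (.neg i :: w) n (m + 1))
    (hU : (b.reverse ++ a)[m]? = some i)
    (h0 : ∀ Pr, IsPairing b a Pr → Pr (Letter.pos i).spacing n m = 0) :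
    IsMove W b a (.neg i :: w) n (m + 1) (.pos i :: w) (n + 1) m := by
  -- All faces around the first letter except its right one are the first in their spacing. Such a
  -- triangle has at most one inner vertex and gives no arrow between inner faces.
  have harr : ∀ f g : InnerFace W, (Letter.pos i).arr 0 (lab f.1) (lab g.1) = 0 ∧
      (Letter.neg i).arr 0 (lab f.1) (lab g.1) = 0 := by
    intro f g
    have key : ∀ (h : InnerFace W) (x : Label r), x.2 = 0 → ind x (lab h.1) = 0 := by
      intro h x hx
      refine ind_of_ne fun e => ?_
      have := h.2.1
      rw [← e] at hx
      simp only [lab] at hx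
      omega
    have kL := fun h => key h ((Letter.pos i).left 0) rfl
    have kB := fun h => key h ((Letter.pos i).bot 0) rfl
    have kL' := fun h => key h ((Letter.neg i).left 0) rfl
    have kT := fun h => key h ((Letter.neg i).top 0) rfl
    constructor <;> simp [Letter.arr, cyc_eq_ind, kL, kB, kL', kT]
  have heps : ∀ f g : InnerFace W, eps 0 (.pos i :: w) (lab f.1) (lab g.1) =
      eps 0 (.neg i :: w) (lab f.1) (lab g.1) := by
    intro f g
    rw [eps, eps, (harr f g).1, (harr f g).2]
    rfl
  have hT : (b ++ a.reverse)[n]? = some i := by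
    have := prefix_drop_getElem? (k := 0) hw.1 (x := i) (by simp)
    simpa using this
  refine ⟨_, _, isRegularComposition_of_eps_eq heps, ?_⟩
  rintro Pr hPr X z ⟨x, hx, hX⟩ rfl
  have q0 : ∀ s, (x (s, 0) : ℂ) = Pr s n (m + 1) := fun s => by
    simpa [pairAt, occ_nil] using hx [] _ rfl s
  have qc : ∀ s, (Letter.pos i).spacing ≠ s →
      Pr s n m = x (s, 0) ∧ Pr s (n + 1) m = x (s, 0) := by
    intro s hs
    rw [hPr.top_const n i hT s hs, q0, hPr.bot_const m i hU s hs]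
    simp
  have hex := hPr.exchange n m i hT hU (by
    rw [(qc _ (spacing_ne_above _)).1]; exact Units.ne_zero _)
  -- With the vanishing term gone, the old and new variables of the first face have product above
  -- times below.
  rw [h0 Pr hPr, zero_mul, zero_add, (qc _ (spacing_ne_above _)).1,
    (qc _ (spacing_ne_below _)).1, ← q0] at hex
  have hne : Pr (Letter.pos i).spacing (n + 1) m ≠ 0 := by
    intro h
    rw [h, mul_zero] at hex
    exact mul_ne_zero (Units.ne_zero _) (Units.ne_zero _) hex.symm
  set x' : Label r → ℂˣ := Function.update x ((Letter.pos i).spacing, 0) (Units.mk0 _ hne)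
  have hx'L : x' ((Letter.pos i).spacing, 0) = Units.mk0 _ hne := Function.update_self _ _ _
  have hx'ne : ∀ l, l ≠ ((Letter.pos i).spacing, 0) → x' l = x l :=
    fun l hl => Function.update_of_ne hl _ _
  refine ⟨x', fun v v' hv s => ?_, fun f => ?_⟩
  · rcases v with _ | ⟨c, v⟩
    · by_cases hs : (Letter.pos i).spacing = s
      · subst hs
        simp [occ_nil, hx'L, pairAt]
      · rw [hx'ne _ (fun e => hs (congrArg Prod.fst e).symm)]
        simp [pairAt, occ_nil, (qc s hs).2]
    · simp only [List.cons_append, List.cons.injEq] at hv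
      obtain ⟨rfl, rfl⟩ := hv
      rw [hx'ne]
      · have := hx (.neg i :: v) v' rfl s
        have e : (Letter.neg i).spacing = (Letter.pos i).spacing := rfl
        rw [occ_cons, e] at this
        rw [occ_cons, this, pairAt, pairAt]
        congr 1 <;> simp <;> ring
      · intro e
        simp only [Prod.mk.injEq] at e
        obtain ⟨rfl, e⟩ := e
        simp [occ_cons] at e
  · rw [hX, prodCtr, prodCtr]
    congr 1
    -- Only the monomial of the right face involves the changed variable: its factor is above/old
    -- before the flip and new/below after it, which agree by `hex`.
    · by_cases hf : lab f.1 = (Letter.pos i).right 0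
      · have e1 := ctr_right (.neg i) 0 x
        have e2 := ctr_right (.pos i) 0 x'
        have hb : x' ((Letter.pos i).bot 0) = x ((Letter.pos i).bot 0) :=
          hx'ne _ (fun e => spacing_ne_below (Letter.pos i) (congrArg Prod.fst e).symm)
        rw [hf]
        refine e1.trans (Eq.trans ?_ e2.symm)
        dsimp only
        rw [hb, div_eq_div_iff_mul_eq_mul]
        apply Units.ext
        push_cast
        have : (x' ((Letter.pos i).left 0) : ℂ) = Pr (Letter.pos i).spacing (n + 1) m := by
          simp [Letter.left, hx'L]
        rw [this]
        exact hex.symm.trans (mul_comm _ _)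
      · have hno : ∀ y : Label r, y.2 = 0 → lab f.1 ≠ y := by
          rintro y hy rfl
          have := f.2.1
          simp only [lab] at hy
          omega
        rw [ctr_other (.neg i) 0 x (hno _ rfl) hf (hno _ rfl) (hno _ rfl),
          ctr_other (.pos i) 0 x' (hno _ rfl) hf (hno _ rfl) (hno _ rfl)]
    · refine (prodCtr_congr w (fun s j h1 _ => (hx'ne _ ?_).symm) _).trans rfl
      rintro e
      simp only [Prod.mk.injEq] at e
      obtain ⟨rfl, rfl⟩ := e
      simp [Letter.step] at h1
      exact h1 rfl

/-- Changing the sign of a positive last letter. -/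
lemma isMove_last {w : List (Letter r)} {n m : ℕ} {i : Fin r}
    (hW : ∀ s, occ (w ++ [.pos i]) s = occ W s) (hw : Fits b a (w ++ [.pos i]) n m)
    (hT : (b ++ a.reverse)[n + (negs w).length]? = some i)
    (h0 : ∀ Pr, IsPairing b a Pr → Pr (Letter.pos i).spacing (n + (negs w).length + 1)
      (m + (poss w).length + 1) = 0) :
    IsMove W b a (w ++ [.pos i]) n m (w ++ [.neg i]) n m := by
  have hocc : ∀ s, (Letter.pos i).step (occ w) s = occ W s := by
    intro s
    rw [← hW, step_eq, occ_append]
  have hlast : ∀ (f : InnerFace W) (y : Label r), y.2 = occ W y.1 → lab f.1 ≠ y := by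
    rintro f y hy rfl
    have := f.2.2
    simp only [lab] at hy
    omega
  have lR : ((Letter.pos i).right (occ w)).2 = occ W ((Letter.pos i).right (occ w)).1 := by
    rw [← hocc]; simp only [Letter.right, step_spacing]
  have lT : ((Letter.pos i).top (occ w)).2 = occ W ((Letter.pos i).top (occ w)).1 := by
    rw [← hocc]; simp only [Letter.top, step_above]
  have lB : ((Letter.pos i).bot (occ w)).2 = occ W ((Letter.pos i).bot (occ w)).1 := by
    rw [← hocc]; simp only [Letter.bot, step_below]
  have harr : ∀ f g : InnerFace W, (Letter.pos i).arr (occ w) (lab f.1) (lab g.1) = 0 ∧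
      (Letter.neg i).arr (occ w) (lab f.1) (lab g.1) = 0 := by
    intro f g
    have kR := fun h : InnerFace W => ind_of_ne (hlast h _ lR)
    have kB := fun h : InnerFace W => ind_of_ne (hlast h _ lB)
    have kT : ∀ h : InnerFace W, ind ((Letter.neg i).top (occ w)) (lab h.1) = 0 :=
      fun h => ind_of_ne (hlast h _ lT)
    have kR' : ∀ h : InnerFace W, ind ((Letter.neg i).right (occ w)) (lab h.1) = 0 :=
      fun h => ind_of_ne (hlast h _ lR)
    constructor <;> simp [Letter.arr, cyc_eq_ind, kR, kB, kR', kT]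
  have hz : (fun s => (0 : Count r) s + occ w s) = occ w := by simp
  have heps : ∀ f g : InnerFace W, eps 0 (w ++ [.neg i]) (lab f.1) (lab g.1) =
      eps 0 (w ++ [.pos i]) (lab f.1) (lab g.1) := by
    intro f g
    rw [eps_append, eps_append, eps, eps, eps, eps, hz, (harr f g).1, (harr f g).2]
  have hU : (b.reverse ++ a)[m + (poss w).length]? = some i :=
    prefix_drop_getElem? hw.2 (x := i) (by simp)
  refine ⟨_, _, isRegularComposition_of_eps_eq heps, ?_⟩
  rintro Pr hPr X z ⟨x, hx, hX⟩ rfl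
  set N := n + (negs w).length
  set M := m + (poss w).length
  have q0 : ∀ s, (x (s, occ w s) : ℂ) = Pr s N M := fun s => hx w _ rfl s
  have qR : (x ((Letter.pos i).right (occ w)) : ℂ) = Pr (Letter.pos i).spacing N (M + 1) := by
    have := hx (w ++ [.pos i]) [] (by simp) (Letter.pos i).spacing
    simp only [occ_append, occ_cons, occ_nil, if_true, zero_add] at this
    rw [Letter.right, this, pairAt]
    simp [N, M, add_assoc]
  have hex := hPr.exchange N M i hT hU (by rw [← q0]; exact Units.ne_zero _)
  -- As for the first letter, the exchange relation becomes a product formula, now for the last face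
  -- of the spacing.
  rw [h0 Pr hPr, mul_zero, zero_add, ← q0, ← q0, ← qR] at hex
  have hne : Pr (Letter.pos i).spacing (N + 1) M ≠ 0 := by
    intro h
    rw [h, mul_zero] at hex
    exact mul_ne_zero (Units.ne_zero _) (Units.ne_zero _) hex.symm
  set x' : Label r → ℂˣ := Function.update x ((Letter.pos i).right (occ w)) (Units.mk0 _ hne)
  have hx'R : x' ((Letter.pos i).right (occ w)) = Units.mk0 _ hne := Function.update_self _ _ _
  have hx'ne : ∀ l, l ≠ (Letter.pos i).right (occ w) → x' l = x l :=
    fun l hl => Function.update_of_ne hl _ _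
  have hx'le : ∀ s j, j ≤ occ w s → x' (s, j) = x (s, j) := by
    intro s j h
    apply hx'ne
    intro e
    simp only [Letter.right, Prod.mk.injEq] at e
    obtain ⟨rfl, rfl⟩ := e
    omega
  refine ⟨x', fun v v' hv s => ?_, fun f => ?_⟩
  · rcases List.append_eq_append_iff.1 hv with ⟨t, h1, h2⟩ | ⟨t, h1, -⟩
    · rcases t with _ | ⟨c, t⟩
      · simp only [List.append_nil] at h1
        subst h1
        rw [hx'le _ _ le_rfl]
        exact q0 s
      · simp only [List.cons_append, List.cons.injEq] at h2
        obtain ⟨rfl, h2⟩ := h2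
        obtain ⟨rfl, rfl⟩ := List.append_eq_nil_iff.1 h2.symm
        subst h1
        by_cases hs : (Letter.pos i).spacing = s
        · subst hs
          have : ((Letter.pos i).spacing, occ (w ++ [.neg i]) (Letter.pos i).spacing) =
              (Letter.pos i).right (occ w) := by
            rw [occ_append, occ_cons]
            simp [Letter.right, occ_nil]
            rfl
          rw [this, hx'R, Units.val_mk0, pairAt]
          simp [N, M, add_assoc]
        · have e : occ (w ++ [.neg i]) s = occ w s := by
            have hs' : (Letter.neg i).spacing ≠ s := hs
            simp [occ_append, occ_cons, occ_nil, hs']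
          rw [e, hx'le _ _ le_rfl, q0, ← hPr.top_const N i hT s hs, pairAt]
          simp [N, M, add_assoc]
    · subst h1
      rw [hx'le]
      · exact hx v (t ++ [.pos i]) (by simp) s
      · simp [occ_append]
  · rw [hX, prodCtr_append, prodCtr_append, prodCtr, prodCtr, prodCtr, prodCtr, mul_one, mul_one]
    congr 1
    · exact prodCtr_congr w (fun s j _ h => (hx'le s j (by simpa using h)).symm) _
    · rw [hz]
      -- The left face has the factor below/old before the flip and new/above after it.
      by_cases hf : lab f.1 = (Letter.pos i).left (occ w)
      · have e1 := ctr_left (.neg i) (occ w) x'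
        have e2 := ctr_left (.pos i) (occ w) x
        rw [hf]
        refine e2.trans (Eq.trans ?_ e1.symm)
        dsimp only
        have ht : x' ((Letter.neg i).top (occ w)) = x ((Letter.pos i).top (occ w)) :=
          hx'le _ _ le_rfl
        rw [ht, div_eq_div_iff_mul_eq_mul]
        apply Units.ext
        push_cast
        have : (x' ((Letter.neg i).right (occ w)) : ℂ) = Pr (Letter.pos i).spacing (N + 1) M := by
          have : (Letter.neg i).right (occ w) = (Letter.pos i).right (occ w) := rfl
          rw [this, hx'R, Units.val_mk0]
        rw [this]
        exact (mul_comm _ _).trans (hex.symm.trans (mul_comm _ _))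
      · rw [ctr_other (.pos i) (occ w) x hf (hlast f _ lR) (hlast f _ lT) (hlast f _ lB),
          ctr_other (.neg i) (occ w) x' hf (hlast f _ lR) (hlast f _ lT) (hlast f _ lB)]

end flips

/-! ## The sequence of moves -/

section sequence
variable {r : ℕ} {W : List (Letter r)} {b a : List (Fin r)}

/-- Moves in both directions that keep the start. -/
def IsBiMove (W : List (Letter r)) (b a : List (Fin r)) (n m : ℕ) (w w' : List (Letter r)) : Prop :=
  IsMove W b a w n m w' n m ∧ IsMove W b a w' n m w n m

lemma IsBiMove.refl (n m : ℕ) (w : List (Letter r)) : IsBiMove W b a n m w w :=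
  ⟨.refl _ _ _, .refl _ _ _⟩

lemma IsBiMove.trans {n m : ℕ} {w w' w'' : List (Letter r)} (h : IsBiMove W b a n m w w')
    (h' : IsBiMove W b a n m w' w'') : IsBiMove W b a n m w w'' :=
  ⟨h.1.trans h'.1, h'.2.trans h.2⟩

/-- The word with all negative letters first. -/
def sorted {r : ℕ} (b a : List (Fin r)) : List (Letter r) := b.map .neg ++ a.map .pos

@[simp] lemma negs_map_neg (l : List (Fin r)) : negs (l.map .neg) = l := by
  induction l <;> simp_all

@[simp] lemma poss_map_neg (l : List (Fin r)) : poss (l.map .neg) = [] := by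
  induction l <;> simp_all

@[simp] lemma negs_map_pos (l : List (Fin r)) : negs (l.map .pos) = [] := by
  induction l <;> simp_all

@[simp] lemma poss_map_pos (l : List (Fin r)) : poss (l.map .pos) = l := by
  induction l <;> simp_all

@[simp] lemma negs_sorted (b a : List (Fin r)) : negs (sorted b a) = b := by simp [sorted]

@[simp] lemma poss_sorted (b a : List (Fin r)) : poss (sorted b a) = a := by simp [sorted]

lemma occ_eq_countP (w : List (Letter r)) (s : Fin (r + 2)) :
    occ w s = (negs w ++ poss w).countP (fun i => decide ((Letter.pos i).spacing = s)) := by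
  rw [List.countP_append]
  induction w with
  | nil => rfl
  | cons c w ih =>
    rw [occ_cons, ih]
    cases c with
    | pos i => simp only [negs_cons_pos, poss_cons_pos, List.countP_cons, decide_eq_true_eq]; ring
    | neg i =>
      have e : (Letter.neg i).spacing = (Letter.pos i).spacing := rfl
      simp only [negs_cons_neg, poss_cons_neg, List.countP_cons, decide_eq_true_eq, e]
      ring

lemma occ_eq_of_perm {w w' : List (Letter r)}
    (h : (negs w ++ poss w).Perm (negs w' ++ poss w')) (s : Fin (r + 2)) : occ w s = occ w' s := by
  rw [occ_eq_countP, occ_eq_countP, h.countP_eq]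

lemma Fits.of_eq {w w' : List (Letter r)} {n m : ℕ} (h : Fits b a w n m) (h1 : negs w' = negs w)
    (h2 : poss w' = poss w) : Fits b a w' n m := by
  rwa [Fits, h1, h2]

lemma isBiMove_swap {w₁ w₂ : List (Letter r)} {n m : ℕ} {c d : Letter r} (h : c.Differ d)
    (hW : ∀ s, occ (w₁ ++ c :: d :: w₂) s = occ W s) (hw : Fits b a (w₁ ++ c :: d :: w₂) n m) :
    IsBiMove W b a n m (w₁ ++ c :: d :: w₂) (w₁ ++ d :: c :: w₂) := by
  have hW' : ∀ s, occ (w₁ ++ d :: c :: w₂) s = occ W s :=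
    fun s => (occ_swap _ _ _ _ s).trans (hW s)
  by_cases hcd : c.spacing = d.spacing
  · exact ⟨isMove_swap_of_opposite (h.opposite hcd) hW hw,
      isMove_swap_of_opposite (h.opposite hcd).symm hW' (hw.swap h)⟩
  · exact ⟨isMove_swap_of_ne h hW hw hcd,
      isMove_swap_of_ne h.symm hW' (hw.swap h) (fun e => hcd e.symm)⟩

lemma isBiMove_pass {n m : ℕ} (i : Fin r) (l : List (Fin r)) (w₁ w₂ : List (Letter r))
    (hW : ∀ s, occ (w₁ ++ .pos i :: (l.map .neg ++ w₂)) s = occ W s)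
    (hw : Fits b a (w₁ ++ .pos i :: (l.map .neg ++ w₂)) n m) :
    IsBiMove W b a n m (w₁ ++ .pos i :: (l.map .neg ++ w₂)) (w₁ ++ l.map .neg ++ .pos i :: w₂) := by
  induction l generalizing w₁ with
  | nil => simpa using IsBiMove.refl n m _
  | cons j l ih =>
    have h1 : IsBiMove W b a n m (w₁ ++ .pos i :: .neg j :: (l.map .neg ++ w₂))
        (w₁ ++ .neg j :: .pos i :: (l.map .neg ++ w₂)) :=
      isBiMove_swap ⟨i, j, Or.inl ⟨rfl, rfl⟩⟩ hW hw
    have h2 := ih (w₁ ++ [.neg j]) (fun s => by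
        rw [← hW]; refine occ_eq_of_perm ?_ s; simp)
      (hw.of_eq (by simp) (by simp))
    simpa using h1.trans (by simpa using h2)

lemma isBiMove_sort {n m : ℕ} (w₁ w : List (Letter r))
    (hW : ∀ s, occ (w₁ ++ w) s = occ W s) (hw : Fits b a (w₁ ++ w) n m) :
    IsBiMove W b a n m (w₁ ++ w) (w₁ ++ sorted (negs w) (poss w)) := by
  induction w generalizing w₁ with
  | nil => simpa [sorted] using IsBiMove.refl n m _
  | cons c w ih =>
    have h1 := ih (w₁ ++ [c]) (by simpa using hW) (by simpa using hw)
    cases c with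
    | neg i => simpa [sorted] using h1
    | pos i =>
      have h2 := isBiMove_pass (W := W) (b := b) (a := a) (n := n) (m := m) i (negs w) w₁
        ((poss w).map .pos) (fun s => by
          rw [← hW]; refine occ_eq_of_perm ?_ s; simp)
        (hw.of_eq (by simp) (by simp))
      have h3 := h1.trans (by simpa [sorted] using h2)
      simpa [sorted] using h3

/-- Both words have the same sorted form. The path to the second word runs its sorting backwards,
hence the moves in both directions. -/
lemma isBiMove_of_eq {n m : ℕ} {w w' : List (Letter r)} (hW : ∀ s, occ w s = occ W s)
    (hw : Fits b a w n m) (h1 : negs w' = negs w) (h2 : poss w' = poss w) :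
    IsBiMove W b a n m w w' := by
  have k1 := isBiMove_sort [] w hW hw
  have k2 := isBiMove_sort [] w' (fun s => by
    rw [← hW]; exact occ_eq_of_perm (by simp [h1, h2]) s) (hw.of_eq (by simpa) (by simpa))
  rw [h1, h2] at k2
  exact k1.trans ⟨k2.2, k2.1⟩

/-- Each round flips the leading negative letter `i` of `b₂` and sorts again, so that `i` goes to
the head of the positive letters. The start passes from `(|b₁|, |b₂| + 1)` to `(|b₁| + 1, |b₂|)`,
exactly around the zero given by `left_zero` for `b = b₁ ++ i :: b₂`. -/
lemma isMove_negs (hW : ∀ s, occ (sorted b a) s = occ W s) (b₁ b₂ : List (Fin r))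
    (hb : b = b₁ ++ b₂) :
    IsMove W b a (sorted b₂ (b₁.reverse ++ a)) b₁.length b₂.length
      (sorted [] (b.reverse ++ a)) b.length 0 := by
  induction b₂ generalizing b₁ with
  | nil =>
    obtain rfl : b = b₁ := by simpa using hb
    exact .refl _ _ _
  | cons i b₂ ih =>
    have hocc : ∀ s, occ (sorted (i :: b₂) (b₁.reverse ++ a)) s = occ W s := by
      intro s
      rw [← hW]
      refine occ_eq_of_perm ?_ s
      simp only [negs_sorted, poss_sorted, hb, ← List.append_assoc]
      exact (List.perm_append_comm.trans
        (List.Perm.append_right _ b₁.reverse_perm)).append_right a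
    have h1 := isMove_first (W := W) (b := b) (a := a) (n := b₁.length) (m := b₂.length) (i := i)
      (w := sorted b₂ (b₁.reverse ++ a)) (by simpa [sorted] using hocc) (by
        constructor
        · simp [hb]
        · have : (b.reverse ++ a).drop (b₂.length + 1) = b₁.reverse ++ a := by
            rw [hb]
            simp only [List.reverse_append, List.reverse_cons, List.append_assoc]
            rw [← List.append_assoc b₂.reverse, List.drop_left' (by simp)]
          rw [this]
          simp)
      (by rw [hb]; simp)
      (fun Pr hPr => hPr.left_zero _ _ _ hb)
    have h2 := isBiMove_of_eq (W := W) (b := b) (a := a) (n := b₁.length + 1) (m := b₂.length)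
      (w := .pos i :: sorted b₂ (b₁.reverse ++ a))
      (w' := sorted b₂ ((b₁ ++ [i]).reverse ++ a)) (fun s => by
        rw [← hocc]
        refine occ_eq_of_perm ?_ s
        simp) (by
        constructor
        · rw [hb]
          have : (b₁ ++ i :: b₂ ++ a.reverse).drop (b₁.length + 1) = b₂ ++ a.reverse := by
            rw [List.append_cons b₁, List.append_assoc, List.drop_left' (by simp)]
          rw [this]
          simp
        · have : (b.reverse ++ a).drop b₂.length = i :: b₁.reverse ++ a := by
            rw [hb]
            simp only [List.reverse_append, List.reverse_cons, List.append_assoc]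
            rw [List.drop_left' (by simp)]
            simp
          rw [this]
          simp) (by simp) (by simp)
    have h3 := ih (b₁ ++ [i]) (by simp [hb])
    rw [List.length_append] at h3
    have h4 := h1.trans (h2.1.trans h3)
    simpa [sorted] using h4

/-- Each round flips the last positive letter of `a₁` and sorts it to the end of the negative
letters, so the letters of `a` appear there in reversed order. The start stays fixed, and
`right_zero` supplies the vanishing pairing. -/
lemma isMove_poss (hW : ∀ s, occ (sorted b a) s = occ W s) (a₁ a₂ : List (Fin r))
    (ha : a = a₁ ++ a₂) :
    IsMove W b a (sorted a₂.reverse (b.reverse ++ a₁)) b.length 0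
      (sorted a.reverse b.reverse) b.length 0 := by
  induction a₁ using List.reverseRecOn generalizing a₂ with
  | nil =>
    obtain rfl : a = a₂ := by simpa using ha
    simpa using IsMove.refl _ _ _
  | append_singleton a₁ i ih =>
    have hocc : ∀ s, occ (sorted a₂.reverse (b.reverse ++ (a₁ ++ [i]))) s = occ W s := by
      intro s
      rw [← hW]
      refine occ_eq_of_perm ?_ s
      simp only [negs_sorted, poss_sorted, ha]
      refine List.perm_append_comm.trans ?_
      rw [List.append_assoc]
      exact List.Perm.append b.reverse_perm (List.Perm.append_left _ a₂.reverse_perm)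
    have h1 := isMove_last (W := W) (b := b) (a := a) (n := b.length) (m := 0) (i := i)
      (w := sorted a₂.reverse (b.reverse ++ a₁)) (by simpa [sorted] using hocc) (by
        constructor
        · simp [ha]
        · simp [ha])
      (by simp [ha])
      (fun Pr hPr => by
        have := hPr.right_zero a₁ i a₂ (by simp [ha])
        simpa [add_assoc] using this)
    have h2 := isBiMove_of_eq (W := W) (b := b) (a := a) (n := b.length) (m := 0)
      (w := sorted a₂.reverse (b.reverse ++ a₁) ++ [.neg i])
      (w' := sorted (i :: a₂).reverse (b.reverse ++ a₁)) (fun s => by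
        rw [← hocc]
        refine occ_eq_of_perm ?_ s
        simp only [negs_append, poss_append, negs_sorted, poss_sorted, negs_cons_neg, poss_cons_neg,
          negs_nil, poss_nil, List.append_nil, List.append_assoc]
        refine List.Perm.append_left _ ?_
        rw [← List.append_assoc b.reverse]
        exact List.perm_append_comm) (by
        constructor
        · simp [ha]
        · simp [ha]) (by simp) (by simp)
    have h3 := ih (i :: a₂) (by simp [ha])
    have h4 := h1.trans (h2.1.trans h3)
    simpa [sorted] using h4

/-- The letter with the other sign. -/
def Letter.flip {r : ℕ} : Letter r → Letter r
  | .pos i => .neg i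
  | .neg i => .pos i

/-- The word of the transposed elements. -/
def mirror {r : ℕ} (w : List (Letter r)) : List (Letter r) := (w.map Letter.flip).reverse

lemma mirror_cons (c : Letter r) (w : List (Letter r)) : mirror (c :: w) = mirror w ++ [c.flip] := by
  simp [mirror]

lemma negs_mirror (w : List (Letter r)) : negs (mirror w) = (poss w).reverse := by
  induction w with
  | nil => rfl
  | cons c w ih => cases c <;> simp [mirror_cons, ih, Letter.flip]

lemma poss_mirror (w : List (Letter r)) : poss (mirror w) = (negs w).reverse := by
  induction w with
  | nil => rfl
  | cons c w ih => cases c <;> simp [mirror_cons, ih, Letter.flip]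

/-- The monomials in the pairings along a word are taken to those along its mirror image. -/
theorem isMove_mirror (W : List (Letter r)) :
    IsMove W (negs W) (poss W) W 0 (negs W).length (mirror W) (negs W).length 0 := by
  set b := negs W with hb
  set a := poss W with ha
  have hW : ∀ s, occ (sorted b a) s = occ W s := occ_eq_of_perm (by simp [hb, ha])
  have h1 : IsBiMove W b a 0 b.length W (sorted b a) :=
    isBiMove_of_eq (fun _ => rfl) ⟨by simp [hb], by simp [ha]⟩ (by simp [hb]) (by simp [ha])
  have h2 := isMove_negs (W := W) (b := b) (a := a) hW [] b rfl
  have h3 := isMove_poss (W := W) (b := b) (a := a) hW a [] (by simp)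
  have h4 : IsBiMove W b a b.length 0 (sorted a.reverse b.reverse) (mirror W) :=
    isBiMove_of_eq (fun s => by
      rw [← hW]
      refine occ_eq_of_perm ?_ s
      simp only [negs_sorted, poss_sorted]
      exact List.perm_append_comm.trans (List.Perm.append b.reverse_perm a.reverse_perm))
      ⟨by simp, by simp⟩ (by simp [negs_mirror, ha]) (by simp [poss_mirror, hb])
  exact h1.1.trans ((by simpa using h2 : IsMove W b a (sorted b a) 0 b.length _ _ _).trans
    ((by simpa using h3 : IsMove W b a (sorted [] (b.reverse ++ a)) b.length 0 _ _ _).trans h4.1))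

end sequence

/-! ## The mirror image of a word -/

section mirror
variable {r : ℕ} {W : List (Letter r)}

/-- The mirror image of a label, where `M` are the numbers of the last faces. -/
def mir {r : ℕ} (M : Count r) (f : Label r) : Label r := (f.1, M f.1 - f.2)

/-- The wedge of two indicator functions. -/
def wed {r : ℕ} (x y f g : Label r) : ℤ := ind x f * ind y g - ind y f * ind x g

/-- The sum of the wedges of vertically neighbouring faces at some position. -/
def columnArr {r : ℕ} (n : Count r) (f g : Label r) : ℤ :=
  ∑ s : Fin (r + 1), wed (s.castSucc, n s.castSucc) (s.succ, n s.succ) f g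

lemma columnArr_eq_zero {n : Count r} {f g : Label r} (h : f.2 ≠ n f.1) : columnArr n f g = 0 := by
  have key : ∀ s, ind (s, n s) f = 0 := by
    intro s
    refine ind_of_ne ?_
    rintro rfl
    exact h rfl
  refine Finset.sum_eq_zero fun s _ => ?_
  rw [wed, key, key]; ring

lemma columnArr_step (c : Letter r) (n : Count r) (f g : Label r) :
    columnArr (c.step n) f g - columnArr n f g =
      wed (c.top n) (c.right n) f g - wed (c.top n) (c.left n) f g +
        (wed (c.right n) (c.bot n) f g - wed (c.left n) (c.bot n) f g) := by
  have e1 : c.index.castSucc.castSucc = c.above := rfl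
  have e2 : c.index.castSucc.succ = c.spacing := rfl
  have e3 : c.index.succ.castSucc = c.spacing := rfl
  have e4 : c.index.succ.succ = c.below := rfl
  have hne : c.index.castSucc ≠ c.index.succ := (Fin.castSucc_lt_succ).ne
  rw [columnArr, columnArr, ← Finset.sum_sub_distrib,
    ← Finset.sum_subset (Finset.subset_univ {c.index.castSucc, c.index.succ}),
    Finset.sum_pair hne]
  · rw [e1, e2, e3, e4, step_spacing, step_above, step_below]
    rfl
  · intro s _ hs
    simp only [Finset.mem_insert, Finset.mem_singleton, not_or] at hs
    have h1 : c.spacing ≠ s.castSucc := by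
      intro h
      rw [← e3] at h
      exact hs.2 (Fin.castSucc_injective _ h).symm
    have h2 : c.spacing ≠ s.succ := by
      intro h
      rw [← e2] at h
      exact hs.1 (Fin.succ_injective _ h).symm
    rw [step_of_ne n h1, step_of_ne n h2, sub_self]

lemma ind_mir {M : Count r} {f : Label r} (hf : f.2 ≤ M f.1) (s : Fin (r + 2)) {j k : ℕ}
    (hjk : j + k = M s) : ind (s, j) (mir M f) = ind (s, k) f := by
  obtain ⟨t, l⟩ := f
  simp only [ind, mir, Prod.mk.injEq]
  refine if_congr ?_ rfl rfl
  constructor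
  · rintro ⟨rfl, h⟩
    simp only at hf
    exact ⟨rfl, by omega⟩
  · rintro ⟨rfl, rfl⟩
    exact ⟨rfl, by omega⟩

lemma flip_spacing (c : Letter r) : c.flip.spacing = c.spacing := by cases c <;> rfl

lemma flip_above (c : Letter r) : c.flip.above = c.above := by cases c <;> rfl

lemma flip_below (c : Letter r) : c.flip.below = c.below := by cases c <;> rfl

lemma occ_mirror (w : List (Letter r)) (s : Fin (r + 2)) : occ (mirror w) s = occ w s := by
  refine occ_eq_of_perm ?_ s
  rw [negs_mirror, poss_mirror]
  exact List.perm_append_comm.trans (List.Perm.append (List.reverse_perm _) (List.reverse_perm _))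

/-- The triangle of a letter and the reflected triangle of its flip lie on opposite sides of the
line of the horizontal arrow and share this arrow. Their other arrows differ by the change of the
column of vertical arrows at the letter. -/
lemma arr_flip (c : Letter r) {n M k : Count r} (hk : ∀ s, k s + c.step n s = M s) {f g : Label r}
    (hf : f.2 ≤ M f.1) (hg : g.2 ≤ M g.1) :
    c.flip.arr k (mir M f) (mir M g) =
      c.arr n f g + (columnArr (c.step n) f g - columnArr n f g) := by
  have h1 : ∀ h : Label r, h.2 ≤ M h.1 → ind (c.flip.left k) (mir M h) = ind (c.right n) h := by
    intro h hh
    rw [Letter.left, flip_spacing]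
    exact ind_mir hh _ (by rw [← hk, step_spacing])
  have h2 : ∀ h : Label r, h.2 ≤ M h.1 → ind (c.flip.right k) (mir M h) = ind (c.left n) h := by
    intro h hh
    rw [Letter.right, flip_spacing]
    exact ind_mir hh _ (by rw [← hk, step_spacing]; ring)
  have h3 : ∀ h : Label r, h.2 ≤ M h.1 → ind (c.flip.top k) (mir M h) = ind (c.top n) h := by
    intro h hh
    rw [Letter.top, flip_above]
    exact ind_mir hh _ (by rw [← hk, step_above])
  have h4 : ∀ h : Label r, h.2 ≤ M h.1 → ind (c.flip.bot k) (mir M h) = ind (c.bot n) h := by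
    intro h hh
    rw [Letter.bot, flip_below]
    exact ind_mir hh _ (by rw [← hk, step_below])
  rw [columnArr_step]
  cases c <;>
  · simp only [Letter.flip] at h1 h2 h3 h4
    simp only [Letter.flip, Letter.arr, cyc_eq_ind, wed, h1 _ hf, h1 _ hg, h2 _ hf, h2 _ hg,
      h3 _ hf, h3 _ hg, h4 _ hf, h4 _ hg]
    ring

/-- The column corrections telescope, so only the first and last columns survive; these consist of
boundary faces and do not meet the rows of inner faces. -/
lemma eps_mirror (w : List (Letter r)) {n M : Count r} (hM : ∀ s, n s + occ w s = M s)
    {f g : Label r} (hf : f.2 ≤ M f.1) (hg : g.2 ≤ M g.1) :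
    eps 0 (mirror w) (mir M f) (mir M g) =
      eps n w f g + (columnArr M f g - columnArr n f g) := by
  induction w generalizing n with
  | nil =>
    have : n = M := funext fun s => by simpa [occ_nil] using hM s
    simp [mirror, eps, this]
  | cons c w ih =>
    have hM' : ∀ s, c.step n s + occ w s = M s := fun s => by rw [step_add_occ, hM]
    rw [mirror_cons, eps_append, ih hM', eps, eps, eps, arr_flip c (n := n) (M := M) _ hf hg]
    · ring
    · intro s
      rw [← hM' s, occ_mirror]
      simp [add_comm]

/-- The exchange matrices of a word and its mirror image have the same rows at inner faces. -/
lemma eps_mirror_inner (f : InnerFace W) (g : Face W) :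
    eps 0 (mirror W) (mir (occ W) (lab f.1)) (mir (occ W) (lab g)) = eps 0 W (lab f.1) (lab g) := by
  have h1 := f.2.1
  have h2 := f.2.2
  rw [eps_mirror W (n := 0) (M := occ W) (by simp)]
  · rw [columnArr_eq_zero, columnArr_eq_zero]
    · ring
    · exact h1.ne'
    · exact h2.ne
  · exact h2.le
  · exact Nat.lt_succ_iff.1 g.2.2

/-- The reflection of the faces. -/
def faceRev {r : ℕ} (W : List (Letter r)) : Face W ≃ Face W where
  toFun f := ⟨f.1, f.2.rev⟩
  invFun f := ⟨f.1, f.2.rev⟩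
  left_inv f := by simp
  right_inv f := by simp

lemma lab_faceRev (f : Face W) : lab (faceRev W f) = mir (occ W) (lab f) := by
  simp [lab, faceRev, mir, Fin.val_rev]

/-- The reflection of the inner faces. -/
def innerRev {r : ℕ} (W : List (Letter r)) : InnerFace W ≃ InnerFace W where
  toFun f := ⟨faceRev W f.1, by
    have h1 := f.2.1
    have h2 := f.2.2
    simp only [faceRev, Equiv.coe_fn_mk, Fin.val_rev]
    omega⟩
  invFun f := ⟨faceRev W f.1, by
    have h1 := f.2.1
    have h2 := f.2.2
    simp only [faceRev, Equiv.coe_fn_mk, Fin.val_rev]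
    omega⟩
  left_inv f := Subtype.ext ((faceRev W).left_inv f.1)
  right_inv f := Subtype.ext ((faceRev W).right_inv f.1)

lemma mir_mir {M : Count r} {f : Label r} (hf : f.2 ≤ M f.1) : mir M (mir M f) = f := by
  obtain ⟨s, j⟩ := f
  simp only [mir, Prod.mk.injEq, true_and]
  simp only at hf
  omega

/-- The monomials in the pairings along a word are taken by a cluster composition to the monomials
in the pairings along the mirror image, with the faces of the original word. -/
theorem exists_composition (W : List (Letter r)) :
    ∃ R C, IsRegularComposition (seed W) (seed W) R C ∧
      ∀ Pr, IsPairing (negs W) (poss W) Pr → ∀ X z,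
        IsCoord W Pr W 0 (negs W).length X → C X z →
        ∃ x : Label r → ℂˣ, (∀ v v', W = v ++ v' → ∀ s, (x (s, occ v s) : ℂ) =
            Pr s ((negs W).length + (poss v').length) (negs v').length) ∧
          ∀ f : InnerFace W, z f = prodCtr 0 W x (lab f.1) := by
  obtain ⟨R, C, hRC, H⟩ := isMove_mirror W
  let σ₁ : SeedIso (seed W) (innerSeedOn W W) :=
    ⟨Equiv.refl _, fun (f g : InnerFace W) => (bigSeed_ε W f.1 g.1).symm⟩
  let σ₂ : SeedIso (innerSeedOn W (mirror W)) (seed W) :=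
    ⟨innerRev W, fun (f g : InnerFace W) => by
      have e1 : (seed W).ε (innerRev W f) (innerRev W g) =
        eps 0 W (lab (innerRev W f).1) (lab (innerRev W g).1) := bigSeed_ε W _ _
      have e2 := eps_mirror_inner (innerRev W f) (innerRev W g).1
      have e3 : ∀ f : InnerFace W, mir (occ W) (lab (innerRev W f).1) = lab f.1 := by
        intro f
        change mir (occ W) (lab (faceRev W f.1)) = _
        rw [lab_faceRev, mir_mir f.2.2.le]
      rw [e3, e3] at e2
      exact e1.trans e2.symm⟩
  refine ⟨_, _, ((IsRegularComposition.refl.iso σ₁).trans hRC).iso σ₂, ?_⟩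
  rintro Pr hPr X z hX ⟨y, ⟨X', ⟨X'', rfl, hX'⟩, hy⟩, hz⟩
  have hXX' : X' = X := funext fun f => hX' f
  subst hXX'
  obtain ⟨x, hx, hyx⟩ := H Pr hPr _ _ hX hy
  refine ⟨fun l => x (mir (occ W) l), fun v v' hv s => ?_, fun f => ?_⟩
  · dsimp only
    have h1 := hx (mirror v') (mirror v) (by simp [hv, mirror]) s
    have h2 : mir (occ W) (s, occ v s) = (s, occ (mirror v') s) := by
      rw [occ_mirror, hv]; simp [mir, occ_append]
    rw [h2, h1, pairAt, negs_mirror, poss_mirror]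
    simp
  · have h1 : z f = y (innerRev W f) := by
      have := hz (innerRev W f)
      rw [← this]
      congr 1
      exact ((innerRev W).left_inv f).symm
    have h2 : lab (innerRev W f).1 = mir (occ W) (lab f.1) := lab_faceRev f.1
    rw [h1, hyx, h2, prodCtr_eq_prod (fun s => occ_mirror W s),
      prodCtr_eq_prod (fun _ => rfl), ← Equiv.prod_comp (faceRev W)]
    refine Finset.prod_congr rfl fun g _ => ?_
    rw [lab_faceRev, eps_mirror_inner]

end mirror

/-! ## Reduced words of permutations -/

section reduced
variable {r : ℕ}

/-- The permutation of a word. -/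
def permOf {r : ℕ} (l : List (Fin r)) : Equiv.Perm (Fin (r + 1)) := (l.map simple).prod

/-- No shorter word has the same permutation. -/
def Reduced {r : ℕ} (l : List (Fin r)) : Prop := ∀ l', permOf l' = permOf l → l.length ≤ l'.length

@[simp] lemma permOf_nil : permOf ([] : List (Fin r)) = 1 := rfl

@[simp] lemma permOf_cons (i : Fin r) (l : List (Fin r)) : permOf (i :: l) = simple i * permOf l := by
  simp [permOf]

@[simp] lemma permOf_append (l l' : List (Fin r)) : permOf (l ++ l') = permOf l * permOf l' := by
  simp [permOf]

@[simp] lemma simple_mul_self (i : Fin r) : simple i * simple i = 1 := Equiv.swap_mul_self _ _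

@[simp] lemma simple_inv (i : Fin r) : (simple i)⁻¹ = simple i := Equiv.swap_inv _ _

@[simp] lemma simple_simple (i : Fin r) (a : Fin (r + 1)) : simple i (simple i a) = a :=
  Equiv.swap_apply_self _ _ _

@[simp] lemma simple_castSucc (i : Fin r) : simple i i.castSucc = i.succ := Equiv.swap_apply_left _ _

@[simp] lemma simple_succ (i : Fin r) : simple i i.succ = i.castSucc := Equiv.swap_apply_right _ _

lemma permOf_reverse (l : List (Fin r)) : permOf l.reverse = (permOf l)⁻¹ := by
  induction l with
  | nil => simp
  | cons i l ih => simp [ih]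

lemma IsReducedWord.reduced {w : Equiv.Perm (Fin (r + 1))} {l : List (Fin r)}
    (h : IsReducedWord w l) : permOf l = w ∧ Reduced l :=
  ⟨h.1, fun l' hl' => h.2 l' (hl'.trans h.1)⟩

lemma Reduced.left {l l' : List (Fin r)} (h : Reduced (l ++ l')) : Reduced l := by
  intro l₁ h₁
  have := h (l₁ ++ l') (by simp [h₁])
  simpa using this

lemma Reduced.right {l l' : List (Fin r)} (h : Reduced (l ++ l')) : Reduced l' := by
  intro l₁ h₁
  have := h (l ++ l₁) (by simp [h₁])
  simpa using this

lemma Reduced.reverse {l : List (Fin r)} (h : Reduced l) : Reduced l.reverse := by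
  intro l₁ h₁
  have := h l₁.reverse (by rw [permOf_reverse, h₁, permOf_reverse, inv_inv])
  simpa using this

lemma simple_lt_simple {i : Fin r} {a b : Fin (r + 1)} (h : a < b)
    (hab : ¬(a = i.castSucc ∧ b = i.succ)) : simple i a < simple i b := by
  simp only [simple, Equiv.swap_apply_def, Fin.lt_def, Fin.ext_iff, Fin.val_castSucc,
    Fin.val_succ] at *
  split_ifs <;> simp_all <;> omega

/-- The exchange condition. -/
lemma exists_shorter (l : List (Fin r)) {a b : Fin (r + 1)} (hab : a < b)
    (h : permOf l b < permOf l a) :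
    ∃ l', l'.length < l.length ∧ permOf l' = permOf l * Equiv.swap a b := by
  induction l using List.reverseRecOn generalizing a b with
  | nil => simp at h; exact absurd h hab.asymm
  | append_singleton l j ih =>
    by_cases hj : a = j.castSucc ∧ b = j.succ
    · obtain ⟨rfl, rfl⟩ := hj
      refine ⟨l, by simp, ?_⟩
      have : Equiv.swap j.castSucc j.succ = simple j := rfl
      simp [this, mul_assoc]
    -- The last letter keeps the order of `a` and `b`, so induction applies to their images under
    -- it; conjugating the transposition by this letter returns to `a` and `b`.
    · obtain ⟨l', h1, h2⟩ := ih (simple_lt_simple hab hj) (by simpa using h)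
      refine ⟨l' ++ [j], by simpa using h1, ?_⟩
      rw [permOf_append, h2, Equiv.swap_apply_apply]
      simp [mul_assoc]

/-- If the inequality failed, the exchange condition would give a shorter word for the permutation
of `l ++ [i]`. This order relation is the only form in which reducedness is used for matrices and
minors. -/
lemma Reduced.lt {l : List (Fin r)} {i : Fin r} (h : Reduced (l ++ [i])) :
    permOf l i.castSucc < permOf l i.succ := by
  by_contra hlt
  have hne : permOf l i.succ ≠ permOf l i.castSucc :=
    fun e => (Fin.castSucc_lt_succ).ne' ((permOf l).injective e)
  obtain ⟨l', h1, h2⟩ := exists_shorter l (Fin.castSucc_lt_succ (i := i))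
    (lt_of_le_of_ne (not_lt.1 hlt) hne)
  have := h l' (by rw [h2]; simp [simple])
  simp at this
  omega

lemma Reduced.inv_lt {l : List (Fin r)} {i : Fin r} (h : Reduced (i :: l)) :
    (permOf l)⁻¹ i.castSucc < (permOf l)⁻¹ i.succ := by
  rw [← permOf_reverse]
  apply Reduced.lt
  simpa using h.reverse

end reduced

/-! ## Triangular and monomial matrices -/

section matrices
variable {r : ℕ}

lemma diag_val (d : Fin (r + 1) → ℂˣ) : (diag r d).val = diagonal (fun k => (d k : ℂ)) := rfl

lemma diag_apply (d : Fin (r + 1) → ℂˣ) (a b : Fin (r + 1)) :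
    (diag r d).val a b = if a = b then (d b : ℂ) else 0 := by
  rw [diag_val, diagonal_apply]
  split_ifs with h
  · rw [h]
  · rfl

lemma weyl_val (w : Equiv.Perm (Fin (r + 1))) :
    (weyl w).val = Equiv.Perm.permMatrix ℂ w⁻¹ := rfl

lemma weyl_apply (w : Equiv.Perm (Fin (r + 1))) (a b : Fin (r + 1)) :
    (weyl w).val a b = if a = w b then 1 else 0 := by
  rw [weyl_val, Equiv.Perm.permMatrix, PEquiv.toMatrix_apply]
  simp [Equiv.toPEquiv_apply, Equiv.Perm.inv_def, Equiv.eq_symm_apply, eq_comm]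

lemma weyl_mul (w w' : Equiv.Perm (Fin (r + 1))) : weyl w * weyl w' = weyl (w * w') := by
  apply Units.ext
  change (weyl w).val * (weyl w').val = _
  ext a b
  rw [mul_apply, weyl_apply, Finset.sum_eq_single (w' b)]
  · rw [weyl_apply, weyl_apply, if_pos rfl, mul_one, Equiv.Perm.mul_apply]
  · intro c _ hc
    rw [weyl_apply w', if_neg hc, mul_zero]
  · simp

lemma mul_diag_apply (M : Matrix (Fin (r + 1)) (Fin (r + 1)) ℂ) (d : Fin (r + 1) → ℂˣ)
    (a b : Fin (r + 1)) : (M * (diag r d).val) a b = M a b * d b := by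
  rw [diag_val, mul_diagonal]

lemma diag_mul_apply (M : Matrix (Fin (r + 1)) (Fin (r + 1)) ℂ) (d : Fin (r + 1) → ℂˣ)
    (a b : Fin (r + 1)) : ((diag r d).val * M) a b = d a * M a b := by
  rw [diag_val, diagonal_mul]

lemma mul_weyl_apply (M : Matrix (Fin (r + 1)) (Fin (r + 1)) ℂ) (w : Equiv.Perm (Fin (r + 1)))
    (a b : Fin (r + 1)) : (M * (weyl w).val) a b = M a (w b) := by
  simp [mul_apply, weyl_apply]

lemma diag_mul_weyl (d : Fin (r + 1) → ℂˣ) (w : Equiv.Perm (Fin (r + 1))) :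
    diag r d * weyl w = weyl w * diag r (d ∘ w) := by
  apply Units.ext
  change (diag r d).val * (weyl w).val = (weyl w).val * (diag r (d ∘ w)).val
  ext a b
  rw [mul_weyl_apply, mul_diag_apply, diag_apply, weyl_apply]
  split_ifs with h <;> simp

/-- The transpose of an invertible matrix. -/
def tr {r : ℕ} (x : G r) : G r :=
  ⟨x.valᵀ, (x⁻¹).valᵀ, by rw [← transpose_mul, ← Units.val_mul]; simp,
    by rw [← transpose_mul, ← Units.val_mul]; simp⟩

lemma tr_val (x : G r) : (tr x).val = x.valᵀ := rfl

@[simp] lemma tr_tr (x : G r) : tr (tr x) = x := rfl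

@[simp] lemma tr_mul (x y : G r) : tr (x * y) = tr y * tr x := Units.ext (transpose_mul _ _)

@[simp] lemma tr_one : tr (1 : G r) = 1 := Units.ext transpose_one

@[simp] lemma tr_inv (x : G r) : tr x⁻¹ = (tr x)⁻¹ := rfl

@[simp] lemma tr_diag (d : Fin (r + 1) → ℂˣ) : tr (diag r d) = diag r d :=
  Units.ext (diagonal_transpose _)

/-- The upper unitriangular group. -/
def Nplus (r : ℕ) : Subgroup (G r) where
  carrier := {x | (∀ i j, j < i → x.val i j = 0) ∧ ∀ i, x.val i i = 1}
  one_mem' := ⟨fun i j h => one_apply_ne h.ne', fun i => one_apply_eq i⟩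
  mul_mem' := by
    rintro x y ⟨hx, hx'⟩ ⟨hy, hy'⟩
    constructor
    · intro i j hij
      rw [Units.val_mul, mul_apply]
      refine Finset.sum_eq_zero fun k _ => ?_
      rcases lt_or_ge k i with h | h
      · rw [hx i k h, zero_mul]
      · rw [hy k j (hij.trans_le h), mul_zero]
    · intro i
      rw [Units.val_mul, mul_apply, Finset.sum_eq_single i]
      · rw [hx', hy', mul_one]
      · intro k _ hk
        rcases lt_or_gt_of_ne hk with h | h
        · rw [hx i k h, zero_mul]
        · rw [hy k i h, mul_zero]
      · simp
  inv_mem' := by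
    rintro x ⟨hx, hx'⟩
    have hb : BlockTriangular x.val id := fun i j h => hx i j h
    have : Invertible x.val := x.invertible
    have hb' : BlockTriangular (x⁻¹).val id := by
      rw [coe_units_inv]
      exact blockTriangular_inv_of_blockTriangular hb
    refine ⟨fun i j h => hb' h, fun i => ?_⟩
    have h1 : (x.val * (x⁻¹).val) i i = 1 := by
      rw [← Units.val_mul, mul_inv_cancel]; exact one_apply_eq i
    rw [mul_apply, Finset.sum_eq_single i, hx', one_mul] at h1
    · exact h1
    · intro k _ hk
      rcases lt_or_gt_of_ne hk with h | h
      · rw [hx i k h, zero_mul]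
      · rw [hb' h, mul_zero]
    · simp

/-- The lower unitriangular group. -/
def Nminus (r : ℕ) : Subgroup (G r) where
  carrier := {x | tr x ∈ Nplus r}
  one_mem' := by simp
  mul_mem' := by
    intro x y hx hy
    simpa using (Nplus r).mul_mem hy hx
  inv_mem' := by
    intro x hx
    simpa using (Nplus r).inv_mem hx

/-- The representative of a simple transposition with the block `(0, -1; 1, 0)`. -/
def sbar {r : ℕ} (i : Fin r) : G r :=
  weyl (simple i) * diag r (fun k => if k = i.succ then -1 else 1)

/-- The sign of a column of `sbar i`. -/
def sg {r : ℕ} (i : Fin r) (b : Fin (r + 1)) : ℂ := if b = i.succ then -1 else 1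

lemma mul_sbar_apply (M : Matrix (Fin (r + 1)) (Fin (r + 1)) ℂ) (i : Fin r) (a b : Fin (r + 1)) :
    (M * (sbar i).val) a b = M a (simple i b) * sg i b := by
  rw [sbar, Units.val_mul, ← Matrix.mul_assoc, mul_diag_apply, mul_weyl_apply, sg]
  split_ifs <;> simp

lemma sbar_apply (i : Fin r) (a b : Fin (r + 1)) :
    (sbar i).val a b = if a = simple i b then sg i b else 0 := by
  have := mul_sbar_apply 1 i a b
  rw [Matrix.one_mul] at this
  rw [this, one_apply]
  split_ifs <;> simp

lemma sg_mul_self (i : Fin r) (b : Fin (r + 1)) : sg i b * sg i b = 1 := by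
  rw [sg]; split_ifs <;> simp

/-- A signed permutation matrix is orthogonal. Transposition therefore converts statements about
`Nplus` and right multiplication into statements about `Nminus` and left multiplication. -/
lemma tr_sbar (i : Fin r) : tr (sbar i) = (sbar i)⁻¹ := by
  rw [eq_inv_iff_mul_eq_one]
  apply Units.ext
  rw [Units.val_mul, tr_val]
  ext a b
  rw [mul_sbar_apply, transpose_apply, sbar_apply, Units.val_one, one_apply]
  simp only [(simple i).injective.eq_iff]
  by_cases h : a = b
  · subst h; simp [sg_mul_self]
  · rw [if_neg (fun e => h e.symm), if_neg h, zero_mul]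

lemma sbar_inv_mul_apply (M : Matrix (Fin (r + 1)) (Fin (r + 1)) ℂ) (i : Fin r)
    (a b : Fin (r + 1)) : (((sbar i)⁻¹ : G r).val * M) a b = sg i a * M (simple i a) b := by
  have h : (((sbar i)⁻¹ : G r).val * M) = (Mᵀ * (sbar i).val)ᵀ := by
    rw [transpose_mul, transpose_transpose, ← tr_val, tr_sbar]
  rw [h, transpose_apply, mul_sbar_apply, transpose_apply, mul_comm]

/-- The representative of a permutation given by a word. -/
def wbar {r : ℕ} (l : List (Fin r)) : G r := (l.map sbar).prod

@[simp] lemma wbar_nil : wbar ([] : List (Fin r)) = 1 := rfl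

@[simp] lemma wbar_cons (i : Fin r) (l : List (Fin r)) : wbar (i :: l) = sbar i * wbar l := by
  simp [wbar]

@[simp] lemma wbar_append (l l' : List (Fin r)) : wbar (l ++ l') = wbar l * wbar l' := by
  simp [wbar]

lemma tr_wbar (l : List (Fin r)) : tr (wbar l) = (wbar l)⁻¹ := by
  induction l with
  | nil => simp
  | cons i l ih => simp [ih, tr_sbar]

lemma wbar_eq (l : List (Fin r)) : ∃ d : Fin (r + 1) → ℂˣ, wbar l = weyl (permOf l) * diag r d := by
  induction l with
  | nil =>
    refine ⟨1, ?_⟩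
    rw [map_one, mul_one, wbar_nil, permOf_nil]
    apply Units.ext
    ext a b
    rw [weyl_apply, Units.val_one, one_apply]
    rfl
  | cons i l ih =>
    obtain ⟨d, hd⟩ := ih
    refine ⟨((fun k => if k = i.succ then -1 else 1) ∘ permOf l) * d, ?_⟩
    rw [wbar_cons, hd, sbar, mul_assoc, ← mul_assoc (diag r _), diag_mul_weyl, permOf_cons,
      ← weyl_mul, map_mul]
    simp only [mul_assoc]

end matrices

/-! ### Leading minors -/

section leading
variable {r : ℕ}

/-- The leading minor of size `s`. -/
def lead {r : ℕ} (s : Fin (r + 2)) (M : Matrix (Fin (r + 1)) (Fin (r + 1)) ℂ) : ℂ :=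
  (M.submatrix (Fin.castLE (Nat.lt_succ_iff.1 s.2)) (Fin.castLE (Nat.lt_succ_iff.1 s.2))).det

lemma lead_transpose (s : Fin (r + 2)) (M : Matrix (Fin (r + 1)) (Fin (r + 1)) ℂ) :
    lead s Mᵀ = lead s M := by
  rw [lead, ← transpose_submatrix, det_transpose, lead]

/-- The hypothesis makes `N` block upper triangular at size `s`, so the leading block of the product
is the product of the leading blocks. -/
lemma lead_mul_right (s : Fin (r + 2)) (M N : Matrix (Fin (r + 1)) (Fin (r + 1)) ℂ)
    (h : ∀ a b : Fin (r + 1), b.val < s.val → s.val ≤ a.val → N a b = 0) :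
    lead s (M * N) = lead s M * lead s N := by
  rw [lead, lead, lead, ← det_mul]
  congr 1
  ext a b
  rw [submatrix_apply, mul_apply, mul_apply]
  symm
  refine Fintype.sum_of_injective _ (Fin.castLE_injective (Nat.lt_succ_iff.1 s.2)) _ _ ?_
    (fun c => rfl)
  intro c hc
  rw [h c _ b.2, mul_zero]
  by_contra hlt
  exact hc ⟨⟨c.val, not_le.1 hlt⟩, rfl⟩

lemma lead_upper (s : Fin (r + 2)) {M : Matrix (Fin (r + 1)) (Fin (r + 1)) ℂ}
    (h : ∀ a b, b < a → M a b = 0) :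
    lead s M = ∏ j : Fin s.val, M (Fin.castLE (Nat.lt_succ_iff.1 s.2) j)
      (Fin.castLE (Nat.lt_succ_iff.1 s.2) j) := by
  rw [lead, det_of_isUpperTriangular]
  · rfl
  · intro a b hab
    exact h _ _ hab

lemma lead_mul_Nplus (s : Fin (r + 2)) (M : Matrix (Fin (r + 1)) (Fin (r + 1)) ℂ) {n : G r}
    (hn : n ∈ Nplus r) : lead s (M * n.val) = lead s M := by
  rw [lead_mul_right s _ _ fun a b hb ha => hn.1 a b (hb.trans_le ha), lead_upper s hn.1]
  simp [hn.2]

lemma lead_Nminus_mul (s : Fin (r + 2)) (M : Matrix (Fin (r + 1)) (Fin (r + 1)) ℂ) {n : G r}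
    (hn : n ∈ Nminus r) : lead s (n.val * M) = lead s M := by
  rw [← lead_transpose, transpose_mul, ← tr_val, lead_mul_Nplus s _ hn, lead_transpose]

lemma lead_diag (s : Fin (r + 2)) (d : Fin (r + 1) → ℂˣ) :
    lead s (diag r d).val = ∏ j : Fin s.val, (d (Fin.castLE (Nat.lt_succ_iff.1 s.2) j) : ℂ) := by
  rw [lead_upper s]
  · simp [diag_apply]
  · intro a b h
    rw [diag_apply, if_neg h.ne']

lemma lead_mul_diag (s : Fin (r + 2)) (M : Matrix (Fin (r + 1)) (Fin (r + 1)) ℂ)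
    (d : Fin (r + 1) → ℂˣ) :
    lead s (M * (diag r d).val) = lead s M * lead s (diag r d).val := by
  refine lead_mul_right s _ _ fun a b hb ha => ?_
  rw [diag_apply, if_neg]
  rintro rfl
  omega

end leading

/-! ### Elementary matrices and identities in SL₂ -/

section elementary
variable {r : ℕ}

/-- The elementary matrix with an entry just above the diagonal. -/
def ep {r : ℕ} (i : Fin r) (c : ℂ) : G r :=
  GeneralLinearGroup.mkOfDetNeZero (transvection i.castSucc i.succ c) (by
    rw [det_transvection_of_ne _ _ (Fin.castSucc_lt_succ).ne]; exact one_ne_zero)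

/-- The elementary matrix with an entry just below the diagonal. -/
def fm {r : ℕ} (i : Fin r) (c : ℂ) : G r := tr (ep i c)

lemma mul_ep_apply (M : Matrix (Fin (r + 1)) (Fin (r + 1)) ℂ) (i : Fin r) (c : ℂ)
    (a b : Fin (r + 1)) :
    (M * (ep i c).val) a b = M a b + if b = i.succ then c * M a i.castSucc else 0 := by
  change (M * transvection i.castSucc i.succ c) a b = _
  rw [transvection, Matrix.mul_add, Matrix.mul_one, Matrix.add_apply]
  congr 1
  split_ifs with h
  · rw [h, mul_single_apply_same, mul_comm]
  · rw [mul_single_apply_of_ne _ _ _ _ _ h]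

lemma ep_mul_apply (M : Matrix (Fin (r + 1)) (Fin (r + 1)) ℂ) (i : Fin r) (c : ℂ)
    (a b : Fin (r + 1)) :
    ((ep i c).val * M) a b = M a b + if a = i.castSucc then c * M i.succ b else 0 := by
  change (transvection i.castSucc i.succ c * M) a b = _
  rw [transvection, Matrix.add_mul, Matrix.one_mul, Matrix.add_apply]
  congr 1
  split_ifs with h
  · rw [h, single_mul_apply_same]
  · rw [single_mul_apply_of_ne _ _ _ _ _ h]

lemma mul_fm_apply (M : Matrix (Fin (r + 1)) (Fin (r + 1)) ℂ) (i : Fin r) (c : ℂ)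
    (a b : Fin (r + 1)) :
    (M * (fm i c).val) a b = M a b + if b = i.castSucc then c * M a i.succ else 0 := by
  have : M * (fm i c).val = ((ep i c).val * Mᵀ)ᵀ := by
    rw [transpose_mul, transpose_transpose]; rfl
  rw [this, transpose_apply, ep_mul_apply]
  rfl

lemma ep_apply (i : Fin r) (c : ℂ) (a b : Fin (r + 1)) :
    (ep i c).val a b = (if a = b then 1 else 0) + if b = i.succ then
      c * (if a = i.castSucc then 1 else 0) else 0 := by
  have := mul_ep_apply 1 i c a b
  rwa [Matrix.one_mul, one_apply, one_apply] at this

lemma ep_mem (i : Fin r) (c : ℂ) : ep i c ∈ Nplus r := by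
  have hne : i.castSucc ≠ i.succ := (Fin.castSucc_lt_succ).ne
  refine ⟨fun a b hab => ?_, fun a => ?_⟩
  · rw [ep_apply, if_neg hab.ne']
    split_ifs with h1 h2
    · subst h1 h2; exact absurd hab (Fin.castSucc_lt_succ).asymm
    all_goals simp
  · rw [ep_apply, if_pos rfl]
    split_ifs with h1 h2
    · exact absurd (h2.symm.trans h1) hne
    all_goals simp

lemma fm_mem (i : Fin r) (c : ℂ) : fm i c ∈ Nminus r := ep_mem i c

@[simp] lemma ep_zero (i : Fin r) : ep i 0 = 1 := by
  apply Units.ext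
  change transvection _ _ _ = _
  simp

lemma ep_mul_ep (i : Fin r) (c d : ℂ) : ep i c * ep i d = ep i (c + d) := by
  apply Units.ext
  change transvection _ _ _ * transvection _ _ _ = transvection _ _ _
  exact transvection_mul_transvection_same _ _ (Fin.castSucc_lt_succ).ne c d

lemma ep_inv (i : Fin r) (c : ℂ) : (ep i c)⁻¹ = ep i (-c) := by
  rw [inv_eq_iff_mul_eq_one, ep_mul_ep, add_neg_cancel, ep_zero]

lemma fm_inv (i : Fin r) (c : ℂ) : (fm i c)⁻¹ = fm i (-c) := by
  rw [fm, ← tr_inv, ep_inv, fm]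

/-- The diagonal matrix of the simple coroot `i`. -/
def hc {r : ℕ} (i : Fin r) (z : ℂˣ) : G r :=
  diag r (fun k => if k = i.castSucc then z else if k = i.succ then z⁻¹ else 1)

/-- This places the factor of a negative letter in `N₊ sᵢ N₊`, so that the chain of flags advances
by one simple reflection. -/
lemma fm_mul_hc (i : Fin r) (z : ℂˣ) :
    fm i ((z⁻¹ : ℂˣ) : ℂ) * hc i z = ep i z * sbar i * ep i ((z⁻¹ : ℂˣ) : ℂ) := by
  have hne : i.castSucc ≠ i.succ := (Fin.castSucc_lt_succ).ne
  apply Units.ext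
  simp only [Units.val_mul, hc]
  ext a b
  rw [mul_diag_apply, mul_ep_apply, mul_sbar_apply, mul_sbar_apply, ep_apply, ep_apply, ← Matrix.one_mul
    (fm i _).val, mul_fm_apply, one_apply, one_apply]
  by_cases hb : b = i.castSucc
  · subst hb
    by_cases ha : a = i.castSucc
    · subst ha; simp [hne, sg]
    · by_cases ha' : a = i.succ
      · subst ha'; simp [hne, hne.symm, sg]
      · simp [hne, sg, ha, ha']
  · by_cases hb' : b = i.succ
    · subst hb'
      by_cases ha : a = i.castSucc
      · subst ha; simp [hne, sg, hne.symm]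
      · by_cases ha' : a = i.succ
        · subst ha'; simp [hne, sg, hne.symm]
        · simp [hne, sg, ha, ha', hne.symm]
    · have : simple i b = b := Equiv.swap_apply_of_ne_of_ne hb hb'
      simp [this, hb, hb', sg]

/-- The lower triangular counterpart, used for positive letters and the opposite chain, where an
element of `N₋ sᵢ N₋` is wanted. -/
lemma ep_block (i : Fin r) (z : ℂˣ) :
    ep i (-(z : ℂ)) * hc i z = fm i (-((z⁻¹ : ℂˣ) : ℂ)) * sbar i * fm i (-(z : ℂ)) := by
  have hne : i.castSucc ≠ i.succ := (Fin.castSucc_lt_succ).ne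
  apply Units.ext
  simp only [Units.val_mul, hc]
  ext a b
  rw [mul_diag_apply, mul_fm_apply, mul_sbar_apply, mul_sbar_apply, ep_apply, ← Matrix.one_mul
    (fm i _).val, mul_fm_apply, mul_fm_apply, one_apply, one_apply, one_apply]
  by_cases hb : b = i.castSucc
  · subst hb
    by_cases ha : a = i.castSucc
    · subst ha; simp [hne, sg, hne.symm]
    · by_cases ha' : a = i.succ
      · subst ha'; simp [hne, sg, hne.symm]
      · simp [hne, sg, ha, ha']
  · by_cases hb' : b = i.succ
    · subst hb'
      by_cases ha : a = i.castSucc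
      · subst ha; simp [hne, sg, hne.symm]
      · by_cases ha' : a = i.succ
        · subst ha'; simp [sg, hne.symm]
        · simp [sg, ha, ha', hne.symm]
    · have : simple i b = b := Equiv.swap_apply_of_ne_of_ne hb hb'
      simp [this, hb, hb', sg]

end elementary

/-! ### The three-term identity for leading minors -/

section exchange
variable {r : ℕ}

/-- The Schur complement of the leading block of size `m`. -/
def schur {r : ℕ} (m : ℕ) (hm : m ≤ r + 1) (M : Matrix (Fin (r + 1)) (Fin (r + 1)) ℂ)
    (a b : Fin (r + 1)) : ℂ :=
  M a b - ∑ q : Fin m, (∑ p : Fin m, M a (Fin.castLE hm p) *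
    (M.submatrix (Fin.castLE hm) (Fin.castLE hm))⁻¹ p q) * M (Fin.castLE hm q) b

/-- Block elimination of the invertible leading block: the larger leading minors become minors of
its Schur complement. -/
lemma det_leading_eq (m t : ℕ) (h : m + t ≤ r + 1) (hm : m ≤ r + 1)
    (M : Matrix (Fin (r + 1)) (Fin (r + 1)) ℂ)
    (hA : (M.submatrix (Fin.castLE hm) (Fin.castLE hm)).det ≠ 0) :
    (M.submatrix (Fin.castLE h) (Fin.castLE h)).det =
      (M.submatrix (Fin.castLE hm) (Fin.castLE hm)).det *
        (Matrix.of fun x y : Fin t => schur m hm M (Fin.castLE h (Fin.natAdd m x))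
          (Fin.castLE h (Fin.natAdd m y))).det := by
  rw [← det_submatrix_equiv_self finSumFinEquiv, ← fromBlocks_toBlocks
    (Matrix.submatrix (M.submatrix _ _) (finSumFinEquiv (m := m) (n := t)) _)]
  have hA' : (M.submatrix (Fin.castLE hm) (Fin.castLE hm)) =
    (((M.submatrix (Fin.castLE h) (Fin.castLE h)).submatrix (finSumFinEquiv (m := m) (n := t))
      (finSumFinEquiv (m := m) (n := t)))).toBlocks₁₁ := rfl
  rw [← hA']
  have := (M.submatrix (Fin.castLE hm) (Fin.castLE hm)).invertibleOfIsUnitDet hA.isUnit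
  rw [det_fromBlocks₁₁]
  congr 2
  ext x y
  rw [Matrix.sub_apply, mul_apply, of_apply, schur, ← invOf_eq_nonsing_inv]
  rfl

lemma simple_of_lt {i : Fin r} {a : Fin (r + 1)} (h : a.val < i.val) :
    simple i a = a ∧ sg i a = 1 := by
  have h1 : a ≠ i.castSucc := by rintro rfl; simp at h
  have h2 : a ≠ i.succ := by rintro rfl; simp at h
  exact ⟨Equiv.swap_apply_of_ne_of_ne h1 h2, if_neg h2⟩

lemma sbar_mul_apply (M : Matrix (Fin (r + 1)) (Fin (r + 1)) ℂ) (i : Fin r)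
    (a b : Fin (r + 1)) : ((sbar i).val * M) a b = sg i (simple i a) * M (simple i a) b := by
  rw [mul_apply, Finset.sum_eq_single (simple i a)]
  · rw [sbar_apply, if_pos (by simp)]
  · intro c _ hc
    rw [sbar_apply, if_neg, zero_mul]
    rintro rfl
    simp at hc
  · simp

/-- `sbar i` acts on the indices just beyond the leading block of size `i`, so the block is
unchanged and only the column index of the Schur complement is permuted. -/
lemma schur_mul_sbar (i : Fin r) (hm : i.val ≤ r + 1)
    (M : Matrix (Fin (r + 1)) (Fin (r + 1)) ℂ) (a b : Fin (r + 1)) :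
    schur i.val hm (M * (sbar i).val) a b = schur i.val hm M a (simple i b) * sg i b := by
  have h1 : ∀ (c : Fin (r + 1)) (p : Fin i.val),
      (M * (sbar i).val) c (Fin.castLE hm p) = M c (Fin.castLE hm p) := by
    intro c p
    obtain ⟨h1, h2⟩ := simple_of_lt (i := i) (a := Fin.castLE hm p) p.2
    rw [mul_sbar_apply, h1, h2, mul_one]
  have h2 : (M * (sbar i).val).submatrix (Fin.castLE hm) (Fin.castLE hm) =
      M.submatrix (Fin.castLE hm) (Fin.castLE hm) := by
    ext p q
    rw [submatrix_apply, h1, submatrix_apply]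
  simp only [schur, h1, h2, mul_sbar_apply]
  rw [sub_mul, Finset.sum_mul]
  simp only [mul_assoc]

lemma schur_sbar_mul (i : Fin r) (hm : i.val ≤ r + 1)
    (M : Matrix (Fin (r + 1)) (Fin (r + 1)) ℂ) (a b : Fin (r + 1)) :
    schur i.val hm ((sbar i).val * M) a b = sg i (simple i a) * schur i.val hm M (simple i a) b := by
  have h1 : ∀ (c : Fin (r + 1)) (p : Fin i.val),
      ((sbar i).val * M) (Fin.castLE hm p) c = M (Fin.castLE hm p) c := by
    intro c p
    obtain ⟨h1, h2⟩ := simple_of_lt (i := i) (a := Fin.castLE hm p) p.2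
    rw [sbar_mul_apply, h1, h2, one_mul]
  have h2 : ((sbar i).val * M).submatrix (Fin.castLE hm) (Fin.castLE hm) =
      M.submatrix (Fin.castLE hm) (Fin.castLE hm) := by
    ext p q
    rw [submatrix_apply, h1, submatrix_apply]
  simp only [schur, h1, h2, sbar_mul_apply]
  rw [mul_sub, Finset.mul_sum]
  simp only [mul_assoc, Finset.mul_sum, Finset.sum_mul]

lemma lead_spacing_eq (i : Fin r) (M : Matrix (Fin (r + 1)) (Fin (r + 1)) ℂ)
    (hm : i.val ≤ r + 1) (h : lead (Letter.pos i).above M ≠ 0) :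
    lead (Letter.pos i).spacing M = lead (Letter.pos i).above M *
      schur i.val hm M i.castSucc i.castSucc := by
  have := det_leading_eq i.val 1 (by omega) hm M h
  rw [det_fin_one] at this
  exact this

lemma lead_below_eq (i : Fin r) (M : Matrix (Fin (r + 1)) (Fin (r + 1)) ℂ)
    (hm : i.val ≤ r + 1) (h : lead (Letter.pos i).above M ≠ 0) :
    lead (Letter.pos i).below M = lead (Letter.pos i).above M *
      (schur i.val hm M i.castSucc i.castSucc * schur i.val hm M i.succ i.succ -
        schur i.val hm M i.castSucc i.succ * schur i.val hm M i.succ i.castSucc) := by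
  have := det_leading_eq i.val 2 (by omega) hm M h
  rw [det_fin_two] at this
  exact this

lemma lead_above_mul_sbar (i : Fin r) (M : Matrix (Fin (r + 1)) (Fin (r + 1)) ℂ) :
    lead (Letter.pos i).above (M * (sbar i).val) = lead (Letter.pos i).above M := by
  rw [lead, lead]
  congr 1
  ext a b
  obtain ⟨h1, h2⟩ := simple_of_lt (i := i) (a := Fin.castLE (Nat.lt_succ_iff.1
    (Letter.pos i).above.2) b) b.2
  rw [submatrix_apply, mul_sbar_apply, h1, h2, mul_one, submatrix_apply]

lemma lead_above_sbar_mul (i : Fin r) (M : Matrix (Fin (r + 1)) (Fin (r + 1)) ℂ) :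
    lead (Letter.pos i).above ((sbar i).val * M) = lead (Letter.pos i).above M := by
  rw [lead, lead]
  congr 1
  ext a b
  obtain ⟨h1, h2⟩ := simple_of_lt (i := i) (a := Fin.castLE (Nat.lt_succ_iff.1
    (Letter.pos i).above.2) a) a.2
  rw [submatrix_apply, sbar_mul_apply, h1, h2, one_mul, submatrix_apply]

/-- The three-term identity for leading minors. -/
lemma lead_exchange (i : Fin r) (M : Matrix (Fin (r + 1)) (Fin (r + 1)) ℂ)
    (h : lead (Letter.pos i).above M ≠ 0) :
    lead (Letter.pos i).spacing ((sbar i).val * M) * lead (Letter.pos i).spacing (M * (sbar i).val) =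
      lead (Letter.pos i).spacing M *
        lead (Letter.pos i).spacing ((sbar i).val * M * (sbar i).val) +
      lead (Letter.pos i).above M * lead (Letter.pos i).below M := by
  have hm : i.val ≤ r + 1 := by omega
  have hne : i.castSucc ≠ i.succ := (Fin.castSucc_lt_succ).ne
  have h2 := lead_above_mul_sbar i M
  have h3 := lead_above_sbar_mul i M
  have h4 := lead_above_mul_sbar i ((sbar i).val * M)
  -- After division by the leading minor, the four minors in the spacing of `i` are, up to sign, the
  -- four entries of a 2 × 2 Schur complement, and the minor below is its determinant.
  rw [lead_spacing_eq i M hm h, lead_spacing_eq i _ hm (by rwa [h3]),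
    lead_spacing_eq i _ hm (by rwa [h2]), lead_spacing_eq i _ hm (by rwa [h4, h3]),
    lead_below_eq i M hm h, h4, h3, h2]
  simp only [schur_mul_sbar, schur_sbar_mul, simple_castSucc, sg, if_neg hne, if_true]
  ring

/-- The representative of a simple reflection as a product of elementary matrices. -/
lemma sbar_eq (i : Fin r) : sbar i = ep i (-1) * fm i 1 * ep i (-1) := by
  have h := fm_mul_hc i 1
  have h1 : hc i 1 = 1 := by
    rw [hc, ← map_one (diag r)]
    congr 1
    ext k
    simp
  rw [h1] at h
  simp only [mul_one, inv_one, Units.val_one] at h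
  rw [h, ← ep_inv]
  group

@[simp] lemma lead_one (s : Fin (r + 2)) :
    lead s (1 : Matrix (Fin (r + 1)) (Fin (r + 1)) ℂ) = 1 := by
  rw [lead, submatrix_one _ (Fin.castLE_injective _), det_one]

/-- In the factorization of `sbar i` the only entry below the diagonal is at `(i + 1, i)`. It
crosses the border of the leading block of size `s` only for `s` the spacing of `i`. -/
lemma lead_mul_sbar {i : Fin r} {s : Fin (r + 2)} (hs : (Letter.pos i).spacing ≠ s)
    (M : Matrix (Fin (r + 1)) (Fin (r + 1)) ℂ) : lead s (M * (sbar i).val) = lead s M := by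
  have key : ∀ N : Matrix (Fin (r + 1)) (Fin (r + 1)) ℂ, lead s (N * (fm i 1).val) = lead s N := by
    intro N
    rw [lead_mul_right]
    · have := lead_Nminus_mul s 1 (fm_mem i 1)
      rw [Matrix.mul_one] at this
      rw [this, lead_one, mul_one]
    · intro a b hb ha
      have := mul_fm_apply 1 i 1 a b
      rw [Matrix.one_mul] at this
      rw [this, one_apply, one_apply, if_neg (by rintro rfl; omega), zero_add]
      split_ifs with h1 h2
      · exfalso
        apply hs
        ext
        subst h1 h2
        simp [Letter.spacing, Letter.index] at *
        omega
      · simp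
      · rfl
  rw [sbar_eq, Units.val_mul, Units.val_mul, ← Matrix.mul_assoc, ← Matrix.mul_assoc,
    lead_mul_Nplus s _ (ep_mem i _), key, lead_mul_Nplus s _ (ep_mem i _)]

lemma lead_sbar_mul {i : Fin r} {s : Fin (r + 2)} (hs : (Letter.pos i).spacing ≠ s)
    (M : Matrix (Fin (r + 1)) (Fin (r + 1)) ℂ) : lead s ((sbar i).val * M) = lead s M := by
  have h := lead_mul_sbar hs (((sbar i).val * M)ᵀ)
  rw [transpose_mul, Matrix.mul_assoc, ← tr_val, tr_sbar, ← Units.val_mul, inv_mul_cancel,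
    Units.val_one, Matrix.mul_one, lead_transpose] at h
  rw [h, ← lead_transpose, transpose_mul, ← tr_val, tr_sbar]

end exchange

/-! ### Monomial matrices and relative positions of flags -/

section monomial
variable {r : ℕ}

/-- The matrix `y` represents the permutation `w` in the normalizer of the torus. -/
def Represents {r : ℕ} (y : G r) (w : Equiv.Perm (Fin (r + 1))) : Prop :=
  ∃ d : Fin (r + 1) → ℂˣ, y = weyl w * diag r d

@[simp] lemma weyl_one : weyl (1 : Equiv.Perm (Fin (r + 1))) = 1 := by
  apply Units.ext
  ext a b
  rw [weyl_apply, Units.val_one, one_apply]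
  rfl

lemma weyl_inv (w : Equiv.Perm (Fin (r + 1))) : (weyl w)⁻¹ = weyl w⁻¹ := by
  rw [inv_eq_iff_mul_eq_one, weyl_mul, mul_inv_cancel, weyl_one]

lemma Represents.mul {y y' : G r} {w w' : Equiv.Perm (Fin (r + 1))} (h : Represents y w)
    (h' : Represents y' w') : Represents (y * y') (w * w') := by
  obtain ⟨d, rfl⟩ := h
  obtain ⟨d', rfl⟩ := h'
  refine ⟨(d ∘ w') * d', ?_⟩
  rw [map_mul, ← weyl_mul, mul_assoc, ← mul_assoc (diag r d), diag_mul_weyl]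
  simp only [mul_assoc]

lemma Represents.inv {y : G r} {w : Equiv.Perm (Fin (r + 1))} (h : Represents y w) :
    Represents y⁻¹ w⁻¹ := by
  obtain ⟨d, rfl⟩ := h
  refine ⟨d⁻¹ ∘ ⇑w⁻¹, ?_⟩
  rw [← diag_mul_weyl, _root_.mul_inv_rev, weyl_inv, map_inv]

lemma Represents.apply {y : G r} {w : Equiv.Perm (Fin (r + 1))} (h : Represents y w) :
    ∃ d : Fin (r + 1) → ℂˣ, ∀ (M : Matrix (Fin (r + 1)) (Fin (r + 1)) ℂ) (a b : Fin (r + 1)),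
      ((y⁻¹ : G r).val * M * y.val) a b = ((d a)⁻¹ : ℂˣ) * M (w a) (w b) * d b := by
  obtain ⟨d, rfl⟩ := h
  refine ⟨d, fun M a b => ?_⟩
  rw [Units.val_mul (weyl w), ← Matrix.mul_assoc, mul_diag_apply, mul_weyl_apply]
  have : ((weyl w * diag r d)⁻¹ : G r).val * M = (diag r d⁻¹).val * (Mᵀ * (weyl w).val)ᵀ := by
    rw [_root_.mul_inv_rev, Units.val_mul, map_inv, Matrix.mul_assoc]
    congr 1
    rw [transpose_mul, transpose_transpose]
    congr 1
    rw [weyl_inv]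
    ext a b
    rw [transpose_apply, weyl_apply, weyl_apply]
    simp only [Equiv.Perm.eq_inv_iff_eq, eq_comm]
  rw [this, diag_mul_apply, transpose_apply, mul_weyl_apply, transpose_apply]
  rfl

lemma represents_sbar (i : Fin r) : Represents (sbar i) (simple i) := ⟨_, rfl⟩

lemma represents_wbar (l : List (Fin r)) : Represents (wbar l) (permOf l) := wbar_eq l

lemma represents_one : Represents (1 : G r) 1 := ⟨1, by simp⟩

lemma represents_prod {σ : Fin r → G r} (hσ : ∀ i, Represents (σ i) (simple i))
    (l : List (Fin r)) : Represents (l.map σ).prod (permOf l) := by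
  induction l with
  | nil => exact represents_one
  | cons i l ih =>
    rw [List.map_cons, List.prod_cons, permOf_cons]
    exact (hσ i).mul ih

lemma Represents.conj_mem {y : G r} {w : Equiv.Perm (Fin (r + 1))} (h : Represents y w)
    {n : G r} (hn : n ∈ Nplus r) (hz : ∀ a b, b < a → n.val (w a) (w b) = 0) :
    y⁻¹ * n * y ∈ Nplus r := by
  obtain ⟨d, hd⟩ := h.apply
  refine ⟨fun a b hab => ?_, fun a => ?_⟩
  · rw [Units.val_mul, Units.val_mul, hd, hz a b hab]
    simp
  · rw [Units.val_mul, Units.val_mul, hd, hn.2]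
    simp

/-- The rule `N w N s N = N w s N` for lengths that add. -/
lemma Represents.mul_mul_mem {y σ : G r} {w : Equiv.Perm (Fin (r + 1))} {i : Fin r}
    (hy : Represents y w) (hσ : Represents σ (simple i)) (hw : w i.castSucc < w i.succ)
    {n : G r} (hn : n ∈ Nplus r) :
    ∃ n₁ ∈ Nplus r, ∃ n₂ ∈ Nplus r, y * n * σ = n₁ * (y * σ) * n₂ := by
  -- Split off from `n` the root factor `ep i c`. It stays upper triangular when moved left through
  -- `y`, because `w` preserves the order of `i` and `i + 1`; the remaining factor has no entry at
  -- `(i, i + 1)` and can be moved right through `σ`.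
  set c := n.val i.castSucc i.succ with hc
  refine ⟨y⁻¹⁻¹ * ep i c * y⁻¹, ?_, σ⁻¹ * (ep i (-c) * n) * σ, ?_, ?_⟩
  · refine hy.inv.conj_mem (ep_mem i c) fun a b hab => ?_
    rw [ep_apply, if_neg (fun e => hab.ne' (w⁻¹.injective e))]
    split_ifs with h1 h2
    · rw [Equiv.Perm.inv_eq_iff_eq] at h1 h2
      subst h1 h2
      exact absurd hab hw.asymm
    all_goals simp
  · have hmem := (Nplus r).mul_mem (ep_mem i (-c)) hn
    refine hσ.conj_mem hmem fun a b hab => ?_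
    by_cases h : b = i.castSucc ∧ a = i.succ
    · obtain ⟨rfl, rfl⟩ := h
      rw [simple_castSucc, simple_succ, Units.val_mul, ep_mul_apply, if_pos rfl, hn.2, ← hc]
      ring
    · exact hmem.1 _ _ (simple_lt_simple hab h)
  · rw [← ep_inv]
    group

/-- A chain of flags in the relative positions given by a reduced word. -/
lemma chain_mem {σ : Fin r → G r} (hσ : ∀ i, Represents (σ i) (simple i)) (g : ℕ → G r)
    (l : List (Fin r)) (hl : Reduced l)
    (hg : ∀ j i, l[j]? = some i →
      ∃ n₁ ∈ Nplus r, ∃ n₂ ∈ Nplus r, g (j + 1) = g j * n₁ * σ i * n₂) :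
    ∃ n₁ ∈ Nplus r, ∃ n₂ ∈ Nplus r, g l.length = g 0 * n₁ * (l.map σ).prod * n₂ := by
  induction l using List.reverseRecOn with
  | nil => exact ⟨1, one_mem _, 1, one_mem _, by simp⟩
  | append_singleton l i ih =>
    obtain ⟨m₁, hm₁, m₂, hm₂, e⟩ := ih hl.left fun j k hj => hg j k (by
      rw [List.getElem?_append_left]
      · exact hj
      · exact (List.getElem?_eq_some_iff.1 hj).1)
    obtain ⟨p₁, hp₁, p₂, hp₂, e'⟩ := hg l.length i (by simp)
    obtain ⟨q₁, hq₁, q₂, hq₂, e''⟩ := (represents_prod hσ l).mul_mul_mem (hσ i) hl.lt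
      ((Nplus r).mul_mem hm₂ hp₁)
    refine ⟨m₁ * q₁, (Nplus r).mul_mem hm₁ hq₁, q₂ * p₂, (Nplus r).mul_mem hq₂ hp₂, ?_⟩
    rw [List.length_append, List.length_singleton, e', e, List.map_append, List.prod_append,
      List.map_singleton, List.prod_singleton]
    calc g 0 * m₁ * (l.map σ).prod * m₂ * p₁ * σ i * p₂
        = g 0 * m₁ * ((l.map σ).prod * (m₂ * p₁) * σ i) * p₂ := by simp only [mul_assoc]
      _ = _ := by rw [e'']; simp only [mul_assoc]

/-- Every term of the determinant vanishes. A nonzero term for `π` needs `w (sᵢ (π a)) ≤ w a` for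
all `a` in the leading block; summing over the block contradicts that `sᵢ` replaces its last index
by the next one, where `w` is larger. -/
lemma lead_conj_eq_zero {l : List (Fin r)} {i : Fin r} (hl : Reduced (l ++ [i])) {n : G r}
    (hn : n ∈ Nplus r) :
    lead (Letter.pos i).spacing ((sbar i)⁻¹ * (wbar l)⁻¹ * n * wbar l : G r).val = 0 := by
  obtain ⟨d, hd⟩ := (represents_wbar l).apply
  have hlt := hl.lt
  set w := permOf l
  have hs : i.val + 1 ≤ r + 1 := by omega
  have hz : ∀ a b, w b < w (simple i a) →
      ((sbar i)⁻¹ * (wbar l)⁻¹ * n * wbar l : G r).val a b = 0 := by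
    intro a b hab
    rw [mul_assoc (sbar i)⁻¹, mul_assoc (sbar i)⁻¹, Units.val_mul, sbar_inv_mul_apply,
      Units.val_mul, Units.val_mul, hd, hn.1 _ _ hab]
    simp
  change det (submatrix _ (Fin.castLE hs) (Fin.castLE hs)) = 0
  rw [det_apply]
  refine Finset.sum_eq_zero fun π _ => ?_
  have key : ∃ a : Fin (i.val + 1), w (Fin.castLE hs a) < w (simple i (Fin.castLE hs (π a))) := by
    by_contra! hcon
    have h1 : ∑ a : Fin (i.val + 1), (w (simple i (Fin.castLE hs a))).val =
        ∑ a : Fin (i.val + 1), (w (simple i (Fin.castLE hs (π a)))).val :=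
      (Equiv.sum_comp π _).symm
    have h2 : ∑ a : Fin (i.val + 1), (w (simple i (Fin.castLE hs (π a)))).val ≤
        ∑ a : Fin (i.val + 1), (w (Fin.castLE hs a)).val :=
      Finset.sum_le_sum fun a _ => hcon a
    rw [← h1, Fin.sum_univ_castSucc, Fin.sum_univ_castSucc] at h2
    have h3 : ∀ p : Fin i.val, simple i (Fin.castLE hs p.castSucc) = Fin.castLE hs p.castSucc :=
      fun p => (simple_of_lt (by simp)).1
    have h4 : Fin.castLE hs (Fin.last i.val) = i.castSucc := rfl
    simp only [h3, h4, simple_castSucc] at h2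
    have := Fin.lt_def.1 hlt
    omega
  obtain ⟨a, ha⟩ := key
  rw [Finset.prod_eq_zero (Finset.mem_univ a), smul_zero]
  exact hz _ _ ha

lemma lead_mul_of_mem_Nplus (s : Fin (r + 2)) (y : G r) {n : G r} (hn : n ∈ Nplus r) :
    lead s (y * n).val = lead s y.val := lead_mul_Nplus s _ hn

lemma lead_mul_of_mem_Nminus (s : Fin (r + 2)) (y : G r) {n : G r} (hn : n ∈ Nminus r) :
    lead s (n * y).val = lead s y.val := lead_Nminus_mul s _ hn

/-- Chains of decorated flags: `g` from the left, `k` from the right. -/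
structure IsChains {r : ℕ} (b a : List (Fin r)) (x : G r) (g k : ℕ → G r) : Prop where
  top : ∀ n i, (b ++ a.reverse)[n]? = some i →
    ∃ n₁ ∈ Nplus r, ∃ n₂ ∈ Nplus r, g (n + 1) = g n * n₁ * sbar i * n₂
  bot : ∀ m i, (b.reverse ++ a)[m]? = some i →
    ∃ n₁ ∈ Nminus r, ∃ n₂ ∈ Nminus r, k (m + 1) = n₁ * sbar i * n₂ * k m
  g_zero : g 0 ∈ Nplus r
  k_early : ∀ j ≤ b.length, k (b.length - j) = (wbar (b.take j))⁻¹
  g_late : ∀ j, g (b.length + j) = x * wbar (a.reverse.take j)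
  k_last : ∃ n ∈ Nminus r, ∃ d, k (b.length + a.length) = n * (diag r d * x⁻¹)

namespace IsChains
variable {b a : List (Fin r)} {x : G r} {g k : ℕ → G r}

lemma top_mem (h : IsChains b a x g k) {b₁ b₂ : List (Fin r)} (hb : b = b₁ ++ b₂)
    (hr : Reduced b₁) :
    ∃ n₁ ∈ Nplus r, ∃ n₂ ∈ Nplus r, g b₁.length = n₁ * wbar b₁ * n₂ := by
  obtain ⟨n₁, h₁, n₂, h₂, e⟩ := chain_mem represents_sbar g b₁ hr fun j i hj => h.top j i (by
    rw [hb, List.append_assoc, List.getElem?_append_left (List.getElem?_eq_some_iff.1 hj).1, hj])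
  exact ⟨g 0 * n₁, (Nplus r).mul_mem h.g_zero h₁, n₂, h₂, by rw [e, wbar]⟩

lemma bot_mem (h : IsChains b a x g k) {a₁ a₂ : List (Fin r)} (ha : a = a₁ ++ a₂)
    (hr : Reduced a₂) :
    ∃ n₁ ∈ Nminus r, ∃ n₂ ∈ Nminus r, k (b.length + a.length) =
      n₁ * wbar a₂.reverse * n₂ * k (b.length + a₁.length) := by
  obtain ⟨n₁, h₁, n₂, h₂, e⟩ := chain_mem (σ := fun i => (sbar i)⁻¹)
    (fun i => by simpa using (represents_sbar i).inv)
    (fun j => tr (k (b.length + a₁.length + j))) a₂ hr (by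
      intro j i hj
      obtain ⟨n₁, h₁, n₂, h₂, e⟩ := h.bot (b.length + a₁.length + j) i (by
        rw [ha, ← List.append_assoc, List.getElem?_append_right (by simp)]
        simpa using hj)
      refine ⟨tr n₂, h₂, tr n₁, h₁, ?_⟩
      rw [← add_assoc, e]
      simp [tr_sbar, mul_assoc])
  have e' := congrArg tr e
  refine ⟨tr n₂, h₂, tr n₁, h₁, ?_⟩
  have hw : ∀ l : List (Fin r), tr (l.map fun i => (sbar i)⁻¹).prod = wbar l.reverse := by
    intro l
    induction l with
    | nil => simp
    | cons i l ih => simp [ih, tr_sbar]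
  simp only [tr_tr, tr_mul, add_zero, hw] at e'
  rw [ha, List.length_append, ← add_assoc, e']
  simp only [mul_assoc]

/-- The leading minors of the products of the members of the chains. -/
theorem isPairing (h : IsChains b a x g k) (hb : Reduced b) (ha : Reduced a) :
    IsPairing b a fun s n m => lead s (k m * g n).val where
  top_const n i hi s hs m := by
    obtain ⟨n₁, h₁, n₂, h₂, e⟩ := h.top n i hi
    have hs' : (Letter.pos i).spacing ≠ s := hs
    rw [e, ← mul_assoc, ← mul_assoc, ← mul_assoc, Units.val_mul, lead_mul_Nplus s _ h₂,
      Units.val_mul, lead_mul_sbar hs', Units.val_mul, lead_mul_Nplus s _ h₁]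
  bot_const m i hi s hs n := by
    obtain ⟨n₁, h₁, n₂, h₂, e⟩ := h.bot m i hi
    rw [e, mul_assoc, mul_assoc, mul_assoc, Units.val_mul, lead_Nminus_mul s _ h₁,
      Units.val_mul, lead_sbar_mul hs, Units.val_mul, lead_Nminus_mul s _ h₂]
  exchange n m i hn hm hne := by
    obtain ⟨n₁, h₁, n₂, h₂, e⟩ := h.top n i hn
    obtain ⟨p₁, h₁', p₂, h₂', e'⟩ := h.bot m i hm
    have key : ∀ s, lead s (p₂ * k m * g n * n₁ : G r).val = lead s (k m * g n).val := by
      intro s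
      rw [Units.val_mul, lead_mul_Nplus s _ h₁, mul_assoc, Units.val_mul, lead_Nminus_mul s _ h₂']
    have := lead_exchange i (p₂ * k m * g n * n₁ : G r).val (by rw [key]; exact hne)
    rw [key, key, key] at this
    simp only [← Units.val_mul] at this
    have e1 : lead (Letter.pos i).spacing (k (m + 1) * g n).val =
        lead (Letter.pos i).spacing (sbar i * (p₂ * k m * g n * n₁) : G r).val := by
      rw [← lead_mul_of_mem_Nplus _ (k (m + 1) * g n) h₁, e',
        ← lead_mul_of_mem_Nminus _ (sbar i * (p₂ * k m * g n * n₁)) h₁']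
      simp only [mul_assoc]
    have e2 : lead (Letter.pos i).spacing (k m * g (n + 1)).val =
        lead (Letter.pos i).spacing (p₂ * k m * g n * n₁ * sbar i : G r).val := by
      rw [← lead_mul_of_mem_Nminus _ (k m * g (n + 1)) h₂', e,
        ← lead_mul_of_mem_Nplus _ (p₂ * k m * g n * n₁ * sbar i) h₂]
      simp only [mul_assoc]
    have e3 : lead (Letter.pos i).spacing (k (m + 1) * g (n + 1)).val =
        lead (Letter.pos i).spacing (sbar i * (p₂ * k m * g n * n₁) * sbar i : G r).val := by
      rw [← lead_mul_of_mem_Nplus _ (sbar i * (p₂ * k m * g n * n₁) * sbar i) h₂,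
        ← lead_mul_of_mem_Nminus _ (sbar i * (p₂ * k m * g n * n₁) * sbar i * n₂) h₁', e, e']
      simp only [mul_assoc]
    rw [e1, e2, e3]
    exact this
  left_zero b₁ i b₂ hb' := by
    obtain ⟨n₁, h₁, n₂, h₂, e⟩ := h.top_mem hb' (by rw [hb'] at hb; exact hb.left)
    -- Member `|b₂|` of the opposite chain is the inverse lift of `b₁ ++ [i]`, one letter more than
    -- the flag `g |b₁|` has passed.
    have hk := h.k_early (b₁.length + 1) (by rw [hb']; simp)
    have e1 : b.length - (b₁.length + 1) = b₂.length := by rw [hb']; simp; omega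
    have e2 : b.take (b₁.length + 1) = b₁ ++ [i] := by
      rw [hb', List.take_append]; simp
    rw [e1, e2] at hk
    rw [hk, e, ← mul_assoc, Units.val_mul, lead_mul_Nplus _ _ h₂, wbar_append, wbar_cons, wbar_nil,
      mul_one, _root_.mul_inv_rev, ← mul_assoc]
    refine lead_conj_eq_zero ?_ h₁
    rw [hb', List.append_cons] at hb
    exact hb.left
  right_zero a₁ i a₂ ha' := by
    have ha'' : a = (a₁ ++ [i]) ++ a₂ := by rw [ha']; simp
    obtain ⟨n₁, h₁, n₂, h₂, e⟩ := h.bot_mem ha'' (by rw [ha''] at ha; exact ha.right)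
    obtain ⟨n₀, h₀, d, hd⟩ := h.k_last
    rw [List.length_append, List.length_singleton, ← add_assoc, hd, ← eq_inv_mul_iff_mul_eq] at e
    obtain ⟨n₃, h₃, rfl⟩ : ∃ n ∈ Nminus r, n₁ = n₀ * n :=
      ⟨n₀⁻¹ * n₁, (Nminus r).mul_mem ((Nminus r).inv_mem h₀) h₁, by group⟩
    have hk : k (b.length + a₁.length + 1) =
        n₂⁻¹ * ((wbar a₂.reverse)⁻¹ * n₃⁻¹ * diag r d * x⁻¹) := by
      rw [mul_assoc _ (diag r d), e]
      group
    have hg := h.g_late (a₂.length + 1)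
    have e2 : a.reverse.take (a₂.length + 1) = a₂.reverse ++ [i] := by
      rw [ha'']
      simp [List.take_append]
    rw [e2, ← add_assoc] at hg
    obtain ⟨d', hd'⟩ := represents_wbar (a₂.reverse ++ [i])
    have hdw : diag r d * wbar (a₂.reverse ++ [i]) =
        wbar (a₂.reverse ++ [i]) * diag r (d ∘ permOf (a₂.reverse ++ [i])) := by
      rw [hd', ← mul_assoc, diag_mul_weyl, mul_assoc, mul_assoc, ← map_mul, ← map_mul, mul_comm d']
    -- Up to a lower unitriangular factor on the left and a diagonal one on the right, this is a
    -- conjugate of an element of `Nminus` times `sbar i`; its transpose has the form treated in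
    -- `lead_conj_eq_zero`.
    have e3 : k (b.length + a₁.length + 1) * g (b.length + a₂.length + 1) =
        n₂⁻¹ * ((wbar a₂.reverse)⁻¹ * n₃⁻¹ * wbar a₂.reverse * sbar i *
          diag r (d ∘ permOf (a₂.reverse ++ [i]))) := by
      calc _ = n₂⁻¹ * ((wbar a₂.reverse)⁻¹ * n₃⁻¹ * (diag r d * wbar (a₂.reverse ++ [i]))) := by
            rw [hk, hg]; group
        _ = _ := by rw [hdw, wbar_append]; simp [mul_assoc]
    rw [e3, Units.val_mul, lead_Nminus_mul _ _ ((Nminus r).inv_mem h₂), Units.val_mul,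
      lead_mul_diag, ← lead_transpose, ← tr_val]
    rw [mul_eq_zero_of_left]
    have := lead_conj_eq_zero (l := a₂.reverse) (i := i) (n := tr n₃⁻¹) (by
      have := ha.reverse
      rw [ha''] at this
      simp only [List.reverse_append, List.reverse_cons,
        ← List.append_cons] at this
      rw [List.append_cons] at this
      exact this.left) ((Nminus r).inv_mem h₃)
    simpa [tr_sbar, tr_wbar, mul_assoc] using this

end IsChains
end monomial

/-! ## Telescoping products of face variables -/

section telescope
variable {r : ℕ}

lemma ctr_eq_one_of_lt (c : Letter r) {n : Count r} (a : Label r → ℂˣ) {f : Label r}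
    (h : f.2 < n f.1) : c.ctr n a f = 1 := by
  obtain ⟨s, j⟩ := f
  refine ctr_other c n a ?_ ?_ ?_ ?_ <;> rintro e <;>
    simp only [Letter.left, Letter.right, Letter.top, Letter.bot, Prod.mk.injEq] at e <;>
    obtain ⟨rfl, rfl⟩ := e <;> simp at h

lemma prodCtr_eq_one_of_lt (w : List (Letter r)) {n : Count r} (a : Label r → ℂˣ) {f : Label r}
    (h : f.2 < n f.1) : prodCtr n w a f = 1 := by
  induction w generalizing n with
  | nil => rfl
  | cons c w ih => rw [prodCtr, ctr_eq_one_of_lt c a h, ih (h.trans_le (le_step c n _)), mul_one]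

lemma ctr_eq_one_of_gt (c : Letter r) {n : Count r} (a : Label r → ℂˣ) {f : Label r}
    (h : c.step n f.1 < f.2) : c.ctr n a f = 1 := by
  obtain ⟨s, j⟩ := f
  refine ctr_other c n a ?_ ?_ ?_ ?_ <;> rintro e <;>
    simp only [Letter.left, Letter.right, Letter.top, Letter.bot, Prod.mk.injEq] at e <;>
    obtain ⟨rfl, rfl⟩ := e <;> simp [Letter.step] at h

/-- The partial products `φ` at the current faces telescope to the products `X`. -/
def Telescopes {r : ℕ} (X a : Label r → ℂˣ) : Count r → (Fin r → ℂˣ) → List (Letter r) → Prop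
  | _, _, [] => True
  | n, φ, c :: w => ∃ φ' : Fin r → ℂˣ,
      φ c.index = c.ctr n a (c.left n) ∧
      (∀ i, i ≠ c.index → φ i = c.ctr n a ((Letter.pos i).left n) * φ' i) ∧
      X (c.right n) = c.ctr n a (c.right n) * φ' c.index ∧
      Telescopes X a (c.step n) φ' w

/-- `φ i` collects the contributions to the face currently open in the spacing of `i`, up to the
letter that closes it. A face with no closing letter is a boundary face and has no such condition.
-/
lemma Telescopes.prodCtr_eq {X a : Label r → ℂˣ} {n : Count r} {φ : Fin r → ℂˣ}
    {w : List (Letter r)} (h : Telescopes X a n φ w) :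
    (∀ i, 0 < occ w (Letter.pos i).spacing → prodCtr n w a ((Letter.pos i).left n) = φ i) ∧
    ∀ s j, n s < j → j < n s + occ w s → prodCtr n w a (s, j) = X (s, j) := by
  induction w generalizing n φ with
  | nil => exact ⟨fun i hi => by simp [occ_nil] at hi, fun s j h1 h2 => by simp [occ_nil] at h2; omega⟩
  | cons c w ih =>
    obtain ⟨φ', h1, h2, h3, h4⟩ := h
    obtain ⟨k1, k2⟩ := ih h4
    have hleft : (Letter.pos c.index).left n = c.left n := rfl
    have hright : (Letter.pos c.index).left (c.step n) = c.right n := by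
      rw [Letter.left, Letter.right]
      change (c.spacing, c.step n c.spacing) = _
      rw [step_spacing]
    refine ⟨fun i hi => ?_, fun s j hj hj' => ?_⟩
    · by_cases hic : i = c.index
      · subst hic
        rw [prodCtr, hleft, h1, prodCtr_eq_one_of_lt, mul_one]
        change n c.spacing < c.step n c.spacing
        rw [step_spacing]; omega
      · have hne : c.spacing ≠ (Letter.pos i).spacing := by
          rw [Ne, spacing_eq_iff]; exact fun e => hic e.symm
        rw [occ_cons, if_neg hne, add_zero] at hi
        rw [prodCtr, h2 i hic, ← k1 i hi, Letter.left, Letter.left, step_of_ne n hne]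
    · rw [prodCtr]
      by_cases hs : c.spacing = s
      · subst hs
        rw [occ_cons, if_pos rfl] at hj'
        rcases Nat.lt_or_ge (n c.spacing + 1) j with h | h
        · rw [ctr_eq_one_of_gt, one_mul]
          · exact k2 _ _ (by rwa [step_spacing]) (by rw [step_spacing]; omega)
          · change c.step n c.spacing < j
            rwa [step_spacing]
        · have hj1 : j = n c.spacing + 1 := by omega
          have := k1 c.index (show 0 < occ w c.spacing by omega)
          rw [hright] at this
          rw [hj1]
          change c.ctr n a (c.right n) * prodCtr _ w a (c.right n) = X (c.right n)
          rw [this, h3]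
      · rw [occ_cons, if_neg hs, add_zero] at hj'
        have hn : c.step n s = n s := step_of_ne n hs
        rw [ctr_eq_one_of_gt c a (by rw [hn]; exact hj), one_mul]
        exact k2 s j (by rwa [hn]) (by rwa [hn])

/-- Weights that are constant at the positive letters and satisfy the exchange relation without
right hand side at the negative letters. -/
def RowBalanced {r : ℕ} (a : Label r → ℂˣ) : Count r → List (Letter r) → Prop
  | _, [] => True
  | n, .pos i :: w => a ((Letter.pos i).right n) = a ((Letter.pos i).left n) ∧
      RowBalanced a ((Letter.pos i).step n) w
  | n, .neg i :: w => a ((Letter.neg i).left n) * a ((Letter.neg i).right n) =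
      a ((Letter.neg i).top n) * a ((Letter.neg i).bot n) ∧ RowBalanced a ((Letter.neg i).step n) w

/-- Weights that are constant at the negative letters and satisfy the exchange relation without
right hand side at the positive letters. -/
def ColBalanced {r : ℕ} (a : Label r → ℂˣ) : Count r → List (Letter r) → Prop
  | _, [] => True
  | n, .neg i :: w => a ((Letter.neg i).right n) = a ((Letter.neg i).left n) ∧
      ColBalanced a ((Letter.neg i).step n) w
  | n, .pos i :: w => a ((Letter.pos i).left n) * a ((Letter.pos i).right n) =
      a ((Letter.pos i).top n) * a ((Letter.pos i).bot n) ∧ ColBalanced a ((Letter.pos i).step n) w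

/-- The ratio of consecutive diagonal entries forced by a letter. -/
def Letter.ratio {r : ℕ} (c : Letter r) (n : Count r) (a : Label r → ℂˣ) : ℂˣ :=
  match c with
  | .pos i => a ((Letter.pos i).top n) * a ((Letter.pos i).bot n) /
      (a ((Letter.pos i).left n) * a ((Letter.pos i).right n))
  | .neg i => a ((Letter.neg i).right n) / a ((Letter.neg i).left n)

/-- The entries of `hmat`. -/
def hvec {r : ℕ} (s : Fin (r + 2)) (z : ℂˣ) (k : Fin (r + 1)) : ℂˣ := if k.val < s.val then z else 1

/-- The entries of `hc`. -/
def cvec {r : ℕ} (i : Fin r) (z : ℂˣ) (k : Fin (r + 1)) : ℂˣ :=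
  if k = i.castSucc then z else if k = i.succ then z⁻¹ else 1

/-- The diagonal entries after a letter. -/
def Letter.next {r : ℕ} (c : Letter r) (n : Count r) (a X : Label r → ℂˣ) (η : Fin (r + 1) → ℂˣ) :
    Fin (r + 1) → ℂˣ :=
  match c with
  | .pos i => η * hvec (Letter.pos i).spacing (X ((Letter.pos i).right n))
  | .neg i => (cvec i ((Letter.neg i).ratio n a))⁻¹ * η *
      hvec (Letter.neg i).spacing (X ((Letter.neg i).right n))

/-- The variables `a` solve the factorization problem with the data `X`. -/
def Solves {r : ℕ} (X a : Label r → ℂˣ) :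
    Count r → (Fin (r + 1) → ℂˣ) → List (Letter r) → Prop
  | _, _, [] => True
  | n, η, c :: w => η c.index.castSucc / η c.index.succ = c.ratio n a ∧
      Solves X a (c.step n) (c.next n a X η) w

lemma left_eq_of_ne {c : Letter r} {n : Count r} {i : Fin r} (h : i ≠ c.index) :
    (Letter.pos i).left (c.step n) = (Letter.pos i).left n := by
  have : c.spacing ≠ (Letter.pos i).spacing := by
    rw [Ne, spacing_eq_iff]; exact fun e => h e.symm
  rw [Letter.left, Letter.left, step_of_ne n this]

lemma Letter.left_step (c : Letter r) (n : Count r) :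
    (Letter.pos c.index).left (c.step n) = c.right n := by
  rw [Letter.left, Letter.right]
  change (c.spacing, c.step n c.spacing) = _
  rw [step_spacing]

lemma ctr_left_of_ne (c : Letter r) (n : Count r) (a : Label r → ℂˣ) {i : Fin r}
    (hi : i ≠ c.index) :
    c.ctr n a ((Letter.pos i).left n) = match c with
      | .pos k => if k.succ = i.castSucc then
          a ((Letter.pos k).right n) / a ((Letter.pos k).left n) else 1
      | .neg k => if i.succ = k.castSucc then
          a ((Letter.neg k).left n) / a ((Letter.neg k).right n) else 1 := by
  have hl : (Letter.pos i).left n ≠ c.left n := by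
    intro e
    have : (Letter.pos i).spacing = c.spacing := congrArg Prod.fst e
    rw [spacing_eq_iff] at this
    exact hi this
  have hr : (Letter.pos i).left n ≠ c.right n := by
    intro e
    have : (Letter.pos i).spacing = c.spacing := congrArg Prod.fst e
    rw [spacing_eq_iff] at this
    exact hi this
  have htop : (Letter.pos i).left n = c.top n ↔ i.succ = c.index.castSucc := by
    simp only [Letter.left, Letter.top, Prod.mk.injEq]
    constructor
    · rintro ⟨h, -⟩
      exact Fin.castSucc_injective _ h
    · intro h
      have : (Letter.pos i).spacing = c.above := congrArg Fin.castSucc h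
      exact ⟨this, by rw [this]⟩
  have hbot : (Letter.pos i).left n = c.bot n ↔ c.index.succ = i.castSucc := by
    simp only [Letter.left, Letter.bot, Prod.mk.injEq]
    have e : (Letter.pos i).spacing = i.castSucc.succ := rfl
    have e' : c.below = c.index.succ.succ := rfl
    constructor
    · rintro ⟨h, -⟩
      rw [e, e'] at h
      exact (Fin.succ_injective _ h).symm
    · intro h
      have : (Letter.pos i).spacing = c.below := by rw [e, e', h]
      exact ⟨this, by rw [this]⟩
  by_cases h1 : i.succ = c.index.castSucc
  · have h2 : ¬ c.index.succ = i.castSucc := by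
      simp [Fin.ext_iff] at h1 ⊢; omega
    rw [htop.2 h1, ctr_top]
    cases c
    · exact (if_neg h2).symm
    · exact (if_pos h1).symm
  · by_cases h2 : c.index.succ = i.castSucc
    · rw [hbot.2 h2, ctr_bot]
      cases c
      · exact (if_pos h2).symm
      · exact (if_neg h1).symm
    · rw [ctr_other c n a hl hr (fun e => h1 (htop.1 e)) (fun e => h2 (hbot.1 e))]
      cases c
      · exact (if_neg h2).symm
      · exact (if_neg h1).symm

lemma top_step (c : Letter r) (n : Count r) (a : Label r → ℂˣ) {i : Fin r} :
    a ((Letter.pos i).top (c.step n)) = if c.index.succ = i.castSucc then a (c.right n)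
      else a ((Letter.pos i).top n) := by
  split_ifs with h
  · have : c.spacing = (Letter.pos i).above := congrArg Fin.castSucc h
    rw [Letter.top, ← this, step_spacing, Letter.right]
  · have : c.spacing ≠ (Letter.pos i).above := fun e => h (Fin.castSucc_injective _ e)
    rw [Letter.top, step_of_ne n this, Letter.top]

lemma top_eq_left (c : Letter r) (n : Count r) {i : Fin r} (h : c.index.succ = i.castSucc) :
    (Letter.pos i).top n = c.left n := by
  have : c.spacing = (Letter.pos i).above := congrArg Fin.castSucc h
  rw [Letter.top, ← this, Letter.left]

lemma bot_step (c : Letter r) (n : Count r) (a : Label r → ℂˣ) {i : Fin r} :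
    a ((Letter.pos i).bot (c.step n)) = if i.succ = c.index.castSucc then a (c.right n)
      else a ((Letter.pos i).bot n) := by
  have e : c.spacing = c.index.castSucc.succ := rfl
  have e' : (Letter.pos i).below = i.succ.succ := rfl
  split_ifs with h
  · have : c.spacing = (Letter.pos i).below := by rw [e, e', h]
    rw [Letter.bot, ← this, step_spacing, Letter.right]
  · have : c.spacing ≠ (Letter.pos i).below := by
      rw [e, e']
      exact fun e => h (Fin.succ_injective _ e).symm
    rw [Letter.bot, step_of_ne n this, Letter.bot]

lemma bot_eq_left (c : Letter r) (n : Count r) {i : Fin r} (h : i.succ = c.index.castSucc) :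
    (Letter.pos i).bot n = c.left n := by
  have e : c.spacing = c.index.castSucc.succ := rfl
  have e' : (Letter.pos i).below = i.succ.succ := rfl
  have : c.spacing = (Letter.pos i).below := by rw [e, e', h]
  rw [Letter.bot, ← this, Letter.left]

/-- The quotient below/left acts as a potential: the balance relations turn every contribution into
a quotient of consecutive potentials, and no factor is left over when a face opens. -/
lemma RowBalanced.telescopes {a : Label r → ℂˣ} {w : List (Letter r)} {n : Count r}
    (h : RowBalanced a n w) :
    Telescopes 1 a n (fun i => a ((Letter.pos i).bot n) / a ((Letter.pos i).left n)) w := by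
  induction w generalizing n with
  | nil => trivial
  | cons c w ih =>
    refine ⟨fun i => a ((Letter.pos i).bot (c.step n)) / a ((Letter.pos i).left (c.step n)),
      ?_, ?_, ?_, ?_⟩
    · rw [ctr_left]
      cases c with
      | pos k =>
        obtain ⟨h1, -⟩ := h
        simp only [h1, Letter.index]
      | neg k =>
        obtain ⟨h1, -⟩ := h
        change a ((Letter.neg k).bot n) / a ((Letter.neg k).left n) = _
        rw [div_eq_div_iff_mul_eq_mul, mul_comm (a (Letter.right _ n)), h1, mul_comm]
    · intro i hi
      dsimp only
      rw [ctr_left_of_ne c n a hi, left_eq_of_ne hi, bot_step c n a]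
      cases c with
      | pos k =>
        obtain ⟨h1, -⟩ := h
        simp only [h1, div_self', ite_self, one_mul]
        split_ifs with h2
        · rw [bot_eq_left (Letter.pos k) n h2]
        · rfl
      | neg k =>
        dsimp only
        split_ifs with h1 h2 h2
        · rw [bot_eq_left (Letter.neg k) n h2, div_mul_div_cancel]
        · exact absurd h1 h2
        · exact absurd h2 h1
        · rw [one_mul]
    · have e : (Letter.pos c.index).bot (c.step n) = c.bot n := by
        rw [Letter.bot, Letter.bot]
        change (c.below, c.step n c.below) = _
        rw [step_below]
      dsimp only
      rw [ctr_right, e, Letter.left_step]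
      cases c with
      | pos k =>
        obtain ⟨h1, -⟩ := h
        simp [h1]
      | neg k =>
        obtain ⟨h1, -⟩ := h
        dsimp only
        rw [div_mul_div_comm, h1, div_self']
        rfl
    · cases c <;> exact ih h.2

lemma ratio_next {c : Letter r} {n : Count r} {a X : Label r → ℂˣ} {η : Fin (r + 1) → ℂˣ} {i : Fin r}
    (hi : i ≠ c.index) :
    c.next n a X η i.castSucc / c.next n a X η i.succ = η i.castSucc / η i.succ *
      match c with
      | .pos _ => 1
      | .neg k => if i.succ = k.castSucc ∨ k.succ = i.castSucc then (Letter.neg k).ratio n a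
          else 1 := by
  have hv : ∀ z, hvec c.spacing z i.castSucc = hvec c.spacing z i.succ := by
    intro z
    rw [hvec, hvec]
    have : i.val ≠ c.index.val := fun e => hi (Fin.ext e)
    simp only [Fin.val_castSucc, Fin.val_succ, spacing_val]
    congr 1
    simp only [eq_iff_iff]
    omega
  cases c with
  | pos k =>
    simp only [Letter.next, Pi.mul_apply, hv, mul_one]
    rw [mul_div_mul_right_eq_div]
  | neg k =>
    simp only [Letter.next, Pi.mul_apply, hv, Pi.inv_apply]
    rw [mul_div_mul_right_eq_div, mul_div_mul_comm, mul_comm]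
    congr 1
    have hne : i ≠ k := hi
    have h0 : i.castSucc ≠ k.castSucc := fun e => hne (Fin.castSucc_injective _ e)
    have h0' : i.succ ≠ k.succ := fun e => hne (Fin.succ_injective _ e)
    simp only [cvec, if_neg h0, if_neg h0']
    by_cases h1 : i.succ = k.castSucc
    · have h2 : ¬ i.castSucc = k.succ := by simp [Fin.ext_iff] at h1 ⊢; omega
      simp [h1, h2]
    · by_cases h2 : i.castSucc = k.succ
      · simp [h1, h2]
      · simp [h1, h2, eq_comm]

/-- The torus part is tracked by the simple roots of `η`. When a face opens, its factor `h`
multiplies the entry `i` of `η` but not the entry `i + 1`, so exactly `X` of that face enters the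
quotient. -/
lemma Solves.telescopes {X a : Label r → ℂˣ} {w : List (Letter r)} {n : Count r}
    {η : Fin (r + 1) → ℂˣ} (h : Solves X a n η w) :
    Telescopes X a n (fun i => η i.castSucc / η i.succ *
      (a ((Letter.pos i).left n) / a ((Letter.pos i).top n))) w := by
  induction w generalizing n η with
  | nil => trivial
  | cons c w ih =>
    obtain ⟨h1, h2⟩ := h
    refine ⟨_, ?_, ?_, ?_, ih h2⟩
    · dsimp only
      rw [h1, ctr_left]
      cases c with
      | pos k =>
        change a ((Letter.pos k).top n) * a ((Letter.pos k).bot n) /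
          (a ((Letter.pos k).left n) * a ((Letter.pos k).right n)) *
          (a ((Letter.pos k).left n) / a ((Letter.pos k).top n)) = _
        apply Units.ext; push_cast; field_simp
      | neg k =>
        change a ((Letter.neg k).right n) / a ((Letter.neg k).left n) *
          (a ((Letter.neg k).left n) / a ((Letter.neg k).top n)) = _
        apply Units.ext; push_cast; field_simp
    · intro i hi
      dsimp only
      rw [ctr_left_of_ne c n a hi, left_eq_of_ne hi, top_step c n a, ratio_next hi]
      by_cases h3 : c.index.succ = i.castSucc
      · rw [if_pos h3, top_eq_left c n h3]
        cases c with
        | pos k =>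
          have h3' : k.succ = i.castSucc := h3
          dsimp only
          rw [if_pos h3']
          apply Units.ext; push_cast; field_simp
        | neg k =>
          have h3' : k.succ = i.castSucc := h3
          have h4 : ¬ i.succ = k.castSucc := by simp [Fin.ext_iff] at h3' ⊢; omega
          dsimp only [Letter.ratio]
          rw [if_neg h4, if_pos (Or.inr h3')]
          apply Units.ext; push_cast; field_simp
      · rw [if_neg h3]
        cases c with
        | pos k =>
          have h3' : ¬ k.succ = i.castSucc := h3
          simp [h3']
        | neg k =>
          have h3' : ¬ k.succ = i.castSucc := h3
          dsimp only [Letter.ratio]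
          by_cases h4 : i.succ = k.castSucc
          · rw [if_pos h4, if_pos (Or.inl h4)]
            apply Units.ext; push_cast; field_simp
          · rw [if_neg h4, if_neg (by tauto)]
            simp
    · have e : (Letter.pos c.index).top (c.step n) = c.top n := by
        rw [Letter.top, Letter.top]
        change (c.above, c.step n c.above) = _
        rw [step_above]
      have h3 : hvec c.spacing (X (c.right n)) c.index.castSucc = X (c.right n) :=
        if_pos (by simp [spacing_val])
      have h4 : hvec c.spacing (X (c.right n)) c.index.succ = 1 :=
        if_neg (by simp [spacing_val])
      rw [ctr_right, e, Letter.left_step]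
      cases c with
      | pos k =>
        simp only [Letter.next, Pi.mul_apply]
        rw [h3, h4, mul_one, mul_div_right_comm, h1]
        dsimp only [Letter.ratio]
        apply Units.ext; push_cast; field_simp
      | neg k =>
        have h5 : cvec k ((Letter.neg k).ratio n a) k.castSucc = (Letter.neg k).ratio n a :=
          if_pos rfl
        have h6 : cvec k ((Letter.neg k).ratio n a) k.succ = ((Letter.neg k).ratio n a)⁻¹ := by
          rw [cvec, if_neg (Fin.castSucc_lt_succ).ne', if_pos rfl]
        simp only [Letter.next, Pi.mul_apply, Pi.inv_apply]
        rw [h3, h4, mul_one, mul_div_right_comm, mul_div_mul_comm, h1]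
        dsimp only [Letter.index]
        rw [h5, h6]
        dsimp only [Letter.ratio]
        apply Units.ext; push_cast; field_simp

/-- All ratios are then 1, so balanced weights solve the factorization problem with trivial data,
and the telescoping already proved for solutions applies to them. -/
lemma ColBalanced.solves {a : Label r → ℂˣ} {w : List (Letter r)} {n : Count r}
    (h : ColBalanced a n w) : Solves 1 a n 1 w := by
  have hv : ∀ s : Fin (r + 2), hvec s (1 : ℂˣ) = 1 := fun s => funext fun k => ite_self _
  induction w generalizing n with
  | nil => trivial
  | cons c w ih =>
    cases c with
    | pos k =>
      obtain ⟨h1, h2⟩ := h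
      refine ⟨?_, ?_⟩
      · simp only [Letter.ratio, h1, Pi.one_apply, div_self']
      · have := ih h2
        simpa [Letter.next, hv] using this
    | neg k =>
      obtain ⟨h1, h2⟩ := h
      have h3 : (Letter.neg k).ratio n a = 1 := by simp [Letter.ratio, h1]
      refine ⟨?_, ?_⟩
      · simp [h3]
      · have := ih h2
        have hc : cvec k (1 : ℂˣ) = 1 := by
          funext j; simp [cvec]
        simpa [Letter.next, hv, h3, hc] using this

/-- The factorization problem has a solution with given variables at the first faces. -/
lemma exists_solves (X : Label r → ℂˣ) (w : List (Letter r)) (n : Count r) (η : Fin (r + 1) → ℂˣ)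
    (a₀ : Label r → ℂˣ) :
    ∃ a : Label r → ℂˣ, (∀ s j, j ≤ n s → a (s, j) = a₀ (s, j)) ∧ Solves X a n η w := by
  induction w generalizing n η a₀ with
  | nil => exact ⟨a₀, fun _ _ _ => rfl, trivial⟩
  | cons c w ih =>
    -- The only new variable in the ratio is that of the face opened by the letter. It occurs with
    -- exponent ±1, so the equation can be solved for it.
    have key : ∃ z : ℂˣ, η c.index.castSucc / η c.index.succ =
        match c with
        | .pos k => a₀ ((Letter.pos k).top n) * a₀ ((Letter.pos k).bot n) /
            (a₀ ((Letter.pos k).left n) * z)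
        | .neg k => z / a₀ ((Letter.neg k).left n) := by
      cases c with
      | pos k =>
        refine ⟨a₀ ((Letter.pos k).top n) * a₀ ((Letter.pos k).bot n) /
          (a₀ ((Letter.pos k).left n) * (η k.castSucc / η k.succ)), ?_⟩
        dsimp only [Letter.index]
        apply Units.ext; push_cast; field_simp
      | neg k => exact ⟨η k.castSucc / η k.succ * a₀ ((Letter.neg k).left n), by simp [Letter.index]⟩
    obtain ⟨z, hz⟩ := key
    set a₁ := Function.update a₀ (c.right n) z with ha₁
    have h1 : ∀ s j, j ≤ n s → a₁ (s, j) = a₀ (s, j) := by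
      intro s j hj
      rw [ha₁, Function.update_of_ne]
      intro e
      simp only [Letter.right, Prod.mk.injEq] at e
      obtain ⟨rfl, rfl⟩ := e
      omega
    have hr : ∀ η', ∃ a : Label r → ℂˣ, (∀ s j, j ≤ c.step n s → a (s, j) = a₁ (s, j)) ∧
      Solves X a (c.step n) η' w := fun η' => ih _ η' a₁
    have hratio : ∀ a : Label r → ℂˣ, (∀ s j, j ≤ c.step n s → a (s, j) = a₁ (s, j)) →
        η c.index.castSucc / η c.index.succ = c.ratio n a := by
      intro a ha
      have e1 : a (c.left n) = a₀ (c.left n) :=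
        (ha _ _ (le_step c n _)).trans (h1 _ _ le_rfl)
      have e2 : a (c.top n) = a₀ (c.top n) := (ha _ _ (le_step c n _)).trans (h1 _ _ le_rfl)
      have e3 : a (c.bot n) = a₀ (c.bot n) := (ha _ _ (le_step c n _)).trans (h1 _ _ le_rfl)
      have e4 : a (c.right n) = z :=
        (ha _ _ (by rw [step_spacing])).trans (Function.update_self _ _ _)
      rw [hz]
      cases c <;> simp only [Letter.ratio, e1, e2, e3, e4]
    have hnext : ∀ a a' : Label r → ℂˣ, c.ratio n a = c.ratio n a' →
        c.next n a X η = c.next n a' X η := by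
      intro a a' h
      cases c with
      | pos k => rfl
      | neg k => simp only [Letter.next, h]
    obtain ⟨a, ha, hs⟩ := hr (c.next n a₁ X η)
    refine ⟨a, fun s j hj => (ha s j (hj.trans (le_step c n s))).trans (h1 s j hj),
      hratio a ha, ?_⟩
    rw [hnext a a₁ ((hratio a ha).symm.trans (hratio a₁ fun _ _ _ => rfl))]
    exact hs

end telescope

/-! ## The factorization of the elements of the double Bruhat cell -/

section factorization
variable {r : ℕ}

/-- The elementary factor of a letter in terms of the face variables. -/
def Letter.mat {r : ℕ} (c : Letter r) (n : Count r) (a : Label r → ℂˣ) : G r :=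
  match c with
  | .pos i => ep i ((Letter.pos i).ratio n a : ℂˣ)
  | .neg i => fm i (((Letter.neg i).ratio n a)⁻¹ : ℂˣ) * hc i ((Letter.neg i).ratio n a)

/-- The product of the elementary factors of a word. -/
def xmat {r : ℕ} (a : Label r → ℂˣ) : Count r → List (Letter r) → G r
  | _, [] => 1
  | n, c :: w => c.mat n a * xmat a (c.step n) w

lemma xmat_append (a : Label r → ℂˣ) (w w' : List (Letter r)) (n : Count r) :
    xmat a n (w ++ w') = xmat a n w * xmat a (fun s => n s + occ w s) w' := by
  induction w generalizing n with
  | nil => simp [xmat, occ_nil]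
  | cons c w ih => simp only [List.cons_append, xmat, ih, mul_assoc, step_add_occ]

/-- The product of the factors of `χ̃` over the letters of a word. -/
def chiMat {r : ℕ} (X : Label r → ℂˣ) : Count r → List (Letter r) → G r
  | _, [] => 1
  | n, c :: w => c.e * hmat c.spacing (X (c.right n)) * chiMat X (c.step n) w

lemma diag_mul_ep (d : Fin (r + 1) → ℂˣ) (i : Fin r) (z : ℂ) :
    diag r d * ep i z = ep i (d i.castSucc * z * ((d i.succ)⁻¹ : ℂˣ)) * diag r d := by
  have hne : i.castSucc ≠ i.succ := (Fin.castSucc_lt_succ).ne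
  apply Units.ext
  simp only [Units.val_mul]
  ext a b
  rw [mul_ep_apply, mul_diag_apply, ep_apply, diag_apply, diag_apply]
  by_cases hb : b = i.succ
  · subst hb
    by_cases ha : a = i.castSucc
    · subst ha; simp [hne, mul_comm]
    · by_cases ha' : a = i.succ
      · subst ha'; simp [hne.symm]
      · simp [ha, ha']
  · by_cases ha : a = b
    · subst ha; simp [hb]
    · simp [ha, hb]

lemma diag_mul_fm (d : Fin (r + 1) → ℂˣ) (i : Fin r) (z : ℂ) :
    diag r d * fm i z = fm i (d i.succ * z * ((d i.castSucc)⁻¹ : ℂˣ)) * diag r d := by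
  have h := diag_mul_ep d⁻¹ i z
  have h' : ep i z * diag r d = diag r d * ep i ((d i.castSucc)⁻¹ * z * d i.succ) := by
    rw [map_inv, inv_mul_eq_iff_eq_mul, ← mul_assoc, eq_mul_inv_iff_mul_eq] at h
    simpa using h
  have h2 := congrArg tr h'
  simp only [tr_mul, tr_diag] at h2
  rw [fm, h2, fm]
  congr 3
  push_cast
  ring

lemma pos_e (i : Fin r) : (Letter.pos i).e = ep i 1 := rfl

lemma neg_e (i : Fin r) : (Letter.neg i).e = fm i 1 := by
  apply Units.ext
  change transvection _ _ _ = (transvection _ _ _)ᵀ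
  simp [transvection]

lemma hc_eq (i : Fin r) (z : ℂˣ) : hc i z = diag r (cvec i z) := rfl

lemma hmat_eq (s : Fin (r + 2)) (z : ℂˣ) : hmat s z = diag r (hvec s z) := rfl

lemma diag_mul_letter (c : Letter r) (n : Count r) (X a : Label r → ℂˣ) (η : Fin (r + 1) → ℂˣ)
    (h : η c.index.castSucc / η c.index.succ = c.ratio n a) :
    diag r η * (c.e * hmat c.spacing (X (c.right n))) = c.mat n a * diag r (c.next n a X η) := by
  cases c with
  | pos i =>
    simp only [Letter.index] at h
    rw [pos_e, ← mul_assoc, diag_mul_ep, Letter.mat, ← h, Letter.next, map_mul, hmat_eq, mul_assoc]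
    congr 2
    push_cast
    ring
  | neg i =>
    simp only [Letter.index] at h
    rw [neg_e, ← mul_assoc, diag_mul_fm, Letter.mat, ← h, Letter.next, map_mul, map_mul, map_inv,
      hmat_eq, hc_eq, ← h]
    have : ((η i.castSucc / η i.succ)⁻¹ : ℂˣ) = (η i.succ : ℂ) * 1 * ((η i.castSucc)⁻¹ : ℂˣ) := by
      push_cast
      rw [inv_div, mul_one]
      rfl
    rw [this]
    group

lemma Solves.diag_mul_chiMat {X a : Label r → ℂˣ} {w : List (Letter r)} {n : Count r}
    {η : Fin (r + 1) → ℂˣ} (h : Solves X a n η w) :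
    ∃ η', diag r η * chiMat X n w = xmat a n w * diag r η' := by
  induction w generalizing n η with
  | nil => exact ⟨η, by simp [chiMat, xmat]⟩
  | cons c w ih =>
    obtain ⟨η', h'⟩ := ih h.2
    refine ⟨η', ?_⟩
    rw [chiMat, xmat, ← mul_assoc, diag_mul_letter c n X a η h.1, mul_assoc, h', mul_assoc]

lemma prod_ofFn_letters (X : Label r → ℂˣ) (w : List (Letter r)) (n : Count r) :
    (List.ofFn fun k : Fin w.length => w[k].e *
      hmat w[k].spacing (X (w[k].spacing, n w[k].spacing + occ (w.take (k + 1)) w[k].spacing))).prod =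
      chiMat X n w := by
  induction w generalizing n with
  | nil => rfl
  | cons c w ih =>
    rw [chiMat, ← ih]
    refine (congrArg List.prod (List.ofFn_succ (n := w.length))).trans ?_
    rw [List.prod_cons]
    congr 1
    · simp [occ_cons, occ_nil, Letter.right]
    · simp [step_add_occ]

/-- The extension of a function on the faces to all labels. -/
def extend {r : ℕ} {w : List (Letter r)} (X : Face w → ℂˣ) (x : Label r) : ℂˣ :=
  if h : x.2 ≤ occ w x.1 then X ⟨x.1, x.2, Nat.lt_succ_of_le h⟩ else 1

lemma extend_lab {w : List (Letter r)} (X : Face w → ℂˣ) (f : Face w) :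
    extend X (lab f) = X f := dif_pos (Nat.le_of_lt_succ f.2.2)

lemma chiTilde_eq (w : List (Letter r)) (X : Face w → ℂˣ) :
    ∃ η, chiTilde w X = diag r η * chiMat (extend X) 0 w := by
  refine ⟨(List.ofFn fun s : Fin (r + 2) => hvec s (X (faceAt w s 0))).prod, ?_⟩
  change (List.ofFn fun s => diag r (hvec s (X (faceAt w s 0)))).prod * _ = _
  rw [map_list_prod, List.map_ofFn, ← prod_ofFn_letters]
  congr 3
  funext k
  have := extend_lab X (faceAt w w[k].spacing (k + 1))
  rw [lab_faceAt] at this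
  simp only [Pi.zero_apply, zero_add, this]

/-- The diagonal matrix with the face variables as leading minors. -/
def dmat {r : ℕ} (a : Label r → ℂˣ) (n : Count r) : G r :=
  diag r fun j => a (j.succ, n j.succ) / a (j.castSucc, n j.castSucc)

lemma lead_dmat (a : Label r → ℂˣ) (n : Count r) (s : Fin (r + 2)) :
    lead s (dmat a n).val = (a (s, n s) / a (0, n 0) : ℂˣ) := by
  rw [dmat, lead_diag, ← Units.coe_prod]
  congr 1
  obtain ⟨s, hs⟩ := s
  induction s with
  | zero => simp
  | succ s ih =>
    rw [Fin.prod_univ_castSucc]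
    have := ih (by omega)
    refine (congrArg₂ (· * ·) this rfl).trans ?_
    exact div_mul_div_cancel' _ _ _

lemma dmat_step (a : Label r → ℂˣ) (n : Count r) (c : Letter r) :
    dmat a (c.step n) = hc c.index (a (c.right n) / a (c.left n)) * dmat a n := by
  rw [dmat, dmat, hc, ← map_mul]
  congr 1
  funext j
  have e : c.spacing = c.index.castSucc.succ := rfl
  have e' : c.spacing = c.index.succ.castSucc := rfl
  have hr : (c.spacing, c.step n c.spacing) = c.right n := by rw [step_spacing]; rfl
  rw [Pi.mul_apply]
  by_cases h1 : j = c.index.castSucc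
  · subst h1
    rw [if_pos rfl, ← e, hr]
    have : c.step n c.above = n c.above := step_above c n
    change a (c.right n) / a (c.above, c.step n c.above) =
      a (c.right n) / a (c.left n) * (a (c.left n) / a (c.above, n c.above))
    rw [this, div_mul_div_cancel]
  · rw [if_neg h1]
    have h1' : c.spacing ≠ j.succ := fun h => h1 (Fin.succ_injective _ (e.symm.trans h)).symm
    rw [step_of_ne n h1']
    by_cases h2 : j = c.index.succ
    · subst h2
      rw [if_pos rfl, ← e', hr, inv_div]
      change a _ / _ = a (c.left n) / a (c.right n) * (a _ / a (c.left n))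
      rw [mul_comm, div_mul_div_cancel]
    · have h2' : c.spacing ≠ j.castSucc := fun h => h2 (Fin.castSucc_injective _ (e'.symm.trans h)).symm
      rw [if_neg h2, step_of_ne n h2', one_mul]

lemma neg_mat (i : Fin r) (n : Count r) (a : Label r → ℂˣ) :
    ∃ n₁ ∈ Nplus r, ∃ n₂ ∈ Nplus r, (Letter.neg i).mat n a = n₁ * sbar i * n₂ :=
  ⟨_, ep_mem i _, _, ep_mem i _, fm_mul_hc i _⟩

lemma pos_mat_mem (i : Fin r) (n : Count r) (a : Label r → ℂˣ) :
    (Letter.pos i).mat n a ∈ Nplus r := ep_mem i _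

/-- The opposite flag attached to a prefix is `N₋` times `dmat` times the inverse of `xmat`;
negative letters do not move it. -/
lemma dmat_neg (i : Fin r) (n : Count r) (a : Label r → ℂˣ) :
    ∃ m ∈ Nminus r, dmat a ((Letter.neg i).step n) * ((Letter.neg i).mat n a)⁻¹ = m * dmat a n := by
  have hcomm : ∀ z, hc i z * dmat a n = dmat a n * hc i z := by
    intro z
    rw [dmat, hc, ← map_mul, ← map_mul, mul_comm]
  have h := dmat_step a n (Letter.neg i)
  have h' : (Letter.neg i).mat n a = fm i (((Letter.neg i).ratio n a)⁻¹ : ℂˣ) *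
    hc (Letter.neg i).index (a ((Letter.neg i).right n) / a ((Letter.neg i).left n)) := rfl
  refine ⟨fm i ((a (i.succ.succ, n i.succ.succ) / a (i.succ.castSucc, n i.succ.castSucc) : ℂˣ) *
    -(((Letter.neg i).ratio n a)⁻¹ : ℂˣ) * ((a (i.castSucc.succ, n i.castSucc.succ) /
      a (i.castSucc.castSucc, n i.castSucc.castSucc))⁻¹ : ℂˣ)), fm_mem i _, ?_⟩
  rw [h, h', _root_.mul_inv_rev, fm_inv]
  simp only [Letter.index]
  rw [hcomm, mul_assoc, mul_inv_cancel_left, dmat, diag_mul_fm]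

/-- A positive letter moves the opposite flag by `sbar i`. The ratio in `mat` is chosen to turn the
conjugated parameter into the one demanded by `ep_block`. -/
lemma dmat_pos (i : Fin r) (n : Count r) (a : Label r → ℂˣ) :
    ∃ m₁ ∈ Nminus r, ∃ m₂ ∈ Nminus r,
      dmat a ((Letter.pos i).step n) * ((Letter.pos i).mat n a)⁻¹ = m₁ * sbar i * m₂ * dmat a n := by
  have hne : i.castSucc ≠ i.succ := (Fin.castSucc_lt_succ).ne
  set z := a ((Letter.pos i).right n) / a ((Letter.pos i).left n) with hz
  refine ⟨fm i (-((z⁻¹ : ℂˣ) : ℂ)), fm_mem i _, fm i (-(z : ℂ)), fm_mem i _, ?_⟩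
  · rw [← ep_block i z, dmat_step, ← hz, mul_assoc]
    change hc i z * (dmat a n * (ep i _)⁻¹) = _
    rw [ep_inv, dmat, diag_mul_ep, ← mul_assoc]
    congr 1
    rw [hc, diag_mul_ep]
    congr 2
    simp only [if_true, if_neg hne.symm, inv_inv]
    change (z : ℂ) * ((a ((Letter.pos i).left n) / a ((Letter.pos i).top n) : ℂˣ) *
      (-((Letter.pos i).ratio n a : ℂˣ)) * (((a ((Letter.pos i).bot n) / a ((Letter.pos i).left n))⁻¹ : ℂˣ) : ℂ)) *
      z = -z
    rw [hz, Letter.ratio]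
    push_cast
    field_simp

end factorization

/-! ## The chains of flags of a point of the cell -/

section chains
variable {r : ℕ}

lemma exists_split {α β : Type} (f : α → Option β) {W : List α} {n : ℕ} {i : β}
    (h : (W.filterMap f)[n]? = some i) :
    ∃ v c v', W = v ++ c :: v' ∧ f c = some i ∧ (v.filterMap f).length = n := by
  induction W generalizing n with
  | nil => simp at h
  | cons c W ih =>
    cases hc : f c with
    | none =>
      rw [List.filterMap_cons_none hc] at h
      obtain ⟨v, d, v', rfl, h1, h2⟩ := ih h
      exact ⟨c :: v, d, v', rfl, h1, by rw [List.filterMap_cons_none hc, h2]⟩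
    | some j =>
      rw [List.filterMap_cons_some hc] at h
      cases n with
      | zero =>
        simp only [List.getElem?_cons_zero, Option.some.injEq] at h
        exact ⟨[], c, W, rfl, by rw [hc, h], rfl⟩
      | succ n =>
        rw [List.getElem?_cons_succ] at h
        obtain ⟨v, d, v', rfl, h1, h2⟩ := ih h
        exact ⟨c :: v, d, v', rfl, h1, by rw [List.filterMap_cons_some hc, List.length_cons, h2]⟩

/-- Prefixes with equally many selected letters differ by a stretch without such letters, so a
quantity unchanged along these stretches depends on the count alone. Used for both chains and for
functions on faces. -/
lemma exists_representatives {α β γ : Type} [Inhabited γ] (f : α → Option β) (W : List α)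
    (F : List α → γ) (rel : γ → γ → Prop) (hsymm : ∀ x y, rel x y → rel y x)
    (h : ∀ v t, v ++ t <+: W → t.filterMap f = [] → rel (F v) (F (v ++ t))) :
    ∃ g : ℕ → γ, ∀ v, v <+: W → rel (F v) (g (v.filterMap f).length) := by
  classical
  refine ⟨fun n => if hn : ∃ v, v <+: W ∧ (v.filterMap f).length = n then F hn.choose else default,
    fun v hv => ?_⟩
  have hn : ∃ v', v' <+: W ∧ (v'.filterMap f).length = (v.filterMap f).length := ⟨v, hv, rfl⟩
  simp only [dif_pos hn]
  obtain ⟨h1, h2⟩ := hn.choose_spec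
  generalize hn.choose = v₀ at h1 h2
  rcases List.prefix_or_prefix_of_prefix h1 hv with ⟨t, rfl⟩ | ⟨t, rfl⟩
  · refine hsymm _ _ (h v₀ t hv ?_)
    rw [List.filterMap_append, List.length_append] at h2
    exact List.eq_nil_of_length_eq_zero (by omega)
  · refine h v t h1 ?_
    rw [List.filterMap_append, List.length_append] at h2
    exact List.eq_nil_of_length_eq_zero (by omega)

lemma xmat_mem_Nplus (a : Label r → ℂˣ) (t : List (Letter r)) (n : Count r) (h : negs t = []) :
    xmat a n t ∈ Nplus r := by
  induction t generalizing n with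
  | nil => exact one_mem _
  | cons c t ih =>
    cases c with
    | pos i => exact (Nplus r).mul_mem (pos_mat_mem i n a) (ih _ h)
    | neg i => simp at h

lemma dmat_xmat_mem (a : Label r → ℂˣ) (t : List (Letter r)) (n : Count r) (h : poss t = []) :
    dmat a (fun s => n s + occ t s) * (xmat a n t)⁻¹ * (dmat a n)⁻¹ ∈ Nminus r := by
  induction t generalizing n with
  | nil =>
    simp only [occ_nil, add_zero, xmat, inv_one, mul_one, mul_inv_cancel]
    exact one_mem _
  | cons c t ih =>
    cases c with
    | pos i => simp at h
    | neg i =>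
      obtain ⟨m, hm, e⟩ := dmat_neg i n a
      have h1 := ih ((Letter.neg i).step n) h
      simp only [step_add_occ] at h1
      have h2 := (Nminus r).mul_mem h1 hm
      rw [← mul_inv_eq_iff_eq_mul] at e
      rw [← e] at h2
      rw [xmat]
      convert h2 using 1
      group

/-- The chains of flags of the point with given face variables. -/
lemma exists_chains (a : Label r → ℂˣ) (W : List (Letter r)) (ha : ∀ s, a (s, 0) = 1) :
    ∃ g k, IsChains (negs W) (poss W) (xmat a 0 W) g k ∧
      ∀ v, v <+: W → (∃ n ∈ Nplus r, g (negs v).length = xmat a 0 v * n) ∧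
        ∃ m ∈ Nminus r, k ((negs W).length + (poss v).length) =
          m * (dmat a (occ v) * (xmat a 0 v)⁻¹) := by
  obtain ⟨g₀, hg₀⟩ := exists_representatives Letter.neg? W (xmat a 0)
    (fun x y => ∃ n ∈ Nplus r, y = x * n)
    (by rintro x y ⟨n, hn, rfl⟩; exact ⟨n⁻¹, (Nplus r).inv_mem hn, by group⟩)
    (fun v t _ ht => ⟨_, xmat_mem_Nplus a t _ ht, xmat_append a v t 0⟩)
  obtain ⟨k₀, hk₀⟩ := exists_representatives Letter.pos? W
    (fun v => dmat a (occ v) * (xmat a 0 v)⁻¹)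
    (fun x y => ∃ n ∈ Nminus r, y = n * x)
    (by rintro x y ⟨n, hn, rfl⟩; exact ⟨n⁻¹, (Nminus r).inv_mem hn, by group⟩)
    (fun v t _ ht => ⟨_, dmat_xmat_mem a t (occ v) ht, by
      have : occ (v ++ t) = fun s => occ v s + occ t s := funext fun s => occ_append v t s
      rw [this, xmat_append]
      simp only [Pi.zero_apply, zero_add]
      group⟩)
  -- The normalization at the first faces makes the opposite flag before any letter equal to `N₋`,
  -- so that the added part of the chain, which ends in `1`, fits to it.
  have hd0 : dmat a (occ ([] : List (Letter r))) = 1 := by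
    rw [dmat, ← map_one (diag r)]
    congr 1
    funext j
    simp [occ_nil, ha]
  set b := negs W with hb
  set p := poss W with hp
  set x := xmat a 0 W with hx
  -- Both chains are glued at `|b|`: flags of prefixes on one side, explicit lifts on the other. The
  -- exact values on the explicit side, rather than values up to unipotents, are what later produces
  -- minors of `x`.
  let g : ℕ → G r := fun n => if n < b.length then g₀ n else x * wbar (p.reverse.take (n - b.length))
  let k : ℕ → G r := fun m => if m ≤ b.length then (wbar (b.take (b.length - m)))⁻¹
    else k₀ (m - b.length)
  have hg_late : ∀ j, g (b.length + j) = x * wbar (p.reverse.take j) := by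
    intro j
    simp [g]
  have hG : ∀ v, v <+: W → ∃ n ∈ Nplus r, g (negs v).length = xmat a 0 v * n := by
    intro v hv
    by_cases h : (negs v).length < b.length
    · simp only [g, if_pos h]
      exact hg₀ v hv
    · obtain ⟨t, rfl⟩ := hv
      have ht : negs t = [] := by
        rw [hb, negs_append, List.length_append] at h
        exact List.eq_nil_of_length_eq_zero (by omega)
      have h1 : (negs v).length = b.length + 0 := by rw [hb, negs_append, ht]; simp
      refine ⟨_, xmat_mem_Nplus a t (fun s => (0 : Count r) s + occ v s) ht, ?_⟩
      rw [h1, hg_late, hx, List.take_zero, wbar_nil, mul_one, xmat_append]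
  have hK : ∀ v, v <+: W → ∃ m ∈ Nminus r, k (b.length + (poss v).length) =
      m * (dmat a (occ v) * (xmat a 0 v)⁻¹) := by
    intro v hv
    by_cases h : (poss v).length = 0
    · have ht := List.eq_nil_of_length_eq_zero h
      have h1 := dmat_xmat_mem a v 0 ht
      have e0 : (0 : Count r) = occ ([] : List (Letter r)) := rfl
      rw [e0, hd0, ← e0, inv_one, mul_one] at h1
      simp only [Pi.zero_apply, zero_add] at h1
      refine ⟨_, (Nminus r).inv_mem h1, ?_⟩
      simp [k, h]
    · have : ¬ (b.length + (poss v).length ≤ b.length) := by omega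
      simp only [k, if_neg this, Nat.add_sub_cancel_left]
      exact hk₀ v hv
  refine ⟨g, k, ⟨?_, ?_, ?_, ?_, hg_late, ?_⟩, fun v hv => ⟨hG v hv, hK v hv⟩⟩
  · intro n i hi
    by_cases hn : n < b.length
    · rw [List.getElem?_append_left hn] at hi
      obtain ⟨v, c, v', hW, hc, hl⟩ := exists_split Letter.neg? hi
      have hc' : c = .neg i := by
        cases c with
        | pos j => simp [Letter.neg?] at hc
        | neg j => simpa [Letter.neg?] using hc
      subst hc'
      obtain ⟨n₁, h₁, e₁⟩ := hG v ⟨_, hW.symm⟩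
      obtain ⟨n₂, h₂, e₂⟩ := hG (v ++ [.neg i]) ⟨v', by rw [hW]; simp⟩
      obtain ⟨m₁, h₃, m₂, h₄, e₃⟩ := neg_mat i (occ v) a
      have hl' : (negs v).length = n := hl
      rw [hl'] at e₁
      have hl2 : (negs (v ++ [Letter.neg i])).length = n + 1 := by simp [hl']
      rw [hl2] at e₂
      refine ⟨n₁⁻¹ * m₁, (Nplus r).mul_mem ((Nplus r).inv_mem h₁) h₃, m₂ * n₂,
        (Nplus r).mul_mem h₄ h₂, ?_⟩
      rw [e₂, e₁, xmat_append]
      simp only [Pi.zero_apply, zero_add, xmat, mul_one]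
      have : (Letter.neg i).mat (fun s => occ v s) a = m₁ * sbar i * m₂ := e₃
      rw [this]
      group
    · rw [List.getElem?_append_right (not_lt.1 hn)] at hi
      obtain ⟨j, rfl⟩ := Nat.exists_eq_add_of_le (not_lt.1 hn)
      rw [Nat.add_sub_cancel_left] at hi
      refine ⟨1, one_mem _, 1, one_mem _, ?_⟩
      rw [add_assoc, hg_late, hg_late, List.take_add_one, hi]
      simp [mul_assoc]
  · intro m i hi
    by_cases hm : m < b.length
    · rw [List.getElem?_append_left (by simpa using hm), List.getElem?_reverse hm] at hi
      refine ⟨1, one_mem _, 1, one_mem _, ?_⟩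
      have h1 : m + 1 ≤ b.length := hm
      have h2 : b.length - m = (b.length - 1 - m) + 1 := by omega
      have h3 : b.length - (m + 1) = b.length - 1 - m := by omega
      simp only [k, if_pos h1, if_pos hm.le]
      rw [h2, h3, List.take_add_one, hi]
      simp
    · have hm' : b.reverse.length ≤ m := by simpa using hm
      rw [List.getElem?_append_right hm'] at hi
      obtain ⟨j, rfl⟩ := Nat.exists_eq_add_of_le hm'
      rw [Nat.add_sub_cancel_left] at hi
      obtain ⟨v, c, v', hW, hc, hl⟩ := exists_split Letter.pos? hi
      have hc' : c = .pos i := by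
        cases c with
        | pos j => simpa [Letter.pos?] using hc
        | neg j => simp [Letter.pos?] at hc
      subst hc'
      obtain ⟨n₁, h₁, e₁⟩ := hK v ⟨_, hW.symm⟩
      obtain ⟨n₂, h₂, e₂⟩ := hK (v ++ [.pos i]) ⟨v', by rw [hW]; simp⟩
      obtain ⟨m₁, h₃, m₂, h₄, e₃⟩ := dmat_pos i (occ v) a
      have hl' : (poss v).length = j := hl
      rw [hl'] at e₁
      have hl2 : (poss (v ++ [Letter.pos i])).length = j + 1 := by simp [hl']
      rw [hl2] at e₂
      have hocc : occ (v ++ [Letter.pos i]) = (Letter.pos i).step (occ v) := by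
        rw [step_eq]; exact funext fun s => occ_append _ _ s
      rw [List.length_reverse, add_assoc, e₂, e₁]
      refine ⟨n₂ * m₁, (Nminus r).mul_mem h₂ h₃, m₂ * n₁⁻¹,
        (Nminus r).mul_mem h₄ ((Nminus r).inv_mem h₁), ?_⟩
      have hx' : xmat a 0 (v ++ [Letter.pos i]) = xmat a 0 v * (Letter.pos i).mat (occ v) a := by
        rw [xmat_append]
        simp only [Pi.zero_apply, zero_add, xmat, mul_one]
      rw [hocc, hx', _root_.mul_inv_rev, ← mul_assoc (dmat a _), e₃]
      group
  · obtain ⟨n, hn, e⟩ := hG [] (List.nil_prefix)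
    have e' : g 0 = n := e.trans (one_mul n)
    rwa [e']
  · intro j hj
    have h1 : b.length - j ≤ b.length := Nat.sub_le _ _
    simp only [k, if_pos h1]
    rw [Nat.sub_sub_self hj]
  · obtain ⟨m, hm, e⟩ := hK W (List.prefix_refl W)
    exact ⟨m, hm, _, e⟩

end chains

/-! ## Minors and dominating sets -/

section minors
variable {r : ℕ}

/-- The image of the first `s` indices under a permutation. -/
def firstImage {r : ℕ} (w : Equiv.Perm (Fin (r + 1))) (s : Fin (r + 2)) : Finset (Fin (r + 1)) :=
  Finset.univ.filter fun a => (w⁻¹ a).val < s.val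

lemma minor_eq {m : ℕ} {I J : Finset (Fin (r + 1))} (hI : I.card = m) (hJ : J.card = m) (x : G r) :
    minor I J x = (x.val.submatrix (I.orderEmbOfFin hI) (J.orderEmbOfFin hJ)).det := by
  subst hI
  exact dif_pos hJ

lemma minor_of_card_ne {I J : Finset (Fin (r + 1))} (h : J.card ≠ I.card) (x : G r) :
    minor I J x = 0 := dif_neg h

lemma minor_tr (I J : Finset (Fin (r + 1))) (x : G r) : minor I J (tr x) = minor J I x := by
  by_cases h : J.card = I.card
  · rw [minor_eq h.symm rfl, minor_eq rfl h.symm, tr_val, ← transpose_submatrix, det_transpose]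
  · rw [minor_of_card_ne h, minor_of_card_ne (Ne.symm h)]

/-- If both indices lie in `J`, the interchange of columns and the sign in `sbar i` cancel. If `i +
1` is not in `J`, then `simple i` is monotone on `J` and no sign occurs. The excluded case is the
one in which a sign would remain. -/
lemma minor_mul_sbar (I J : Finset (Fin (r + 1))) (i : Fin r)
    (h : i.succ ∈ J → i.castSucc ∈ J) (x : G r) :
    minor I (J.map (simple i).toEmbedding) x = minor I J (x * sbar i) := by
  have hne : i.castSucc ≠ i.succ := (Fin.castSucc_lt_succ).ne
  by_cases hc : J.card = I.card
  swap
  · rw [minor_of_card_ne hc, minor_of_card_ne (by rwa [Finset.card_map])]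
  rw [minor_eq rfl hc, minor_eq rfl (by rw [Finset.card_map, hc])]
  by_cases hs : i.succ ∈ J
  · have hcs := h hs
    have hmap : J.map (simple i).toEmbedding = J := by
      ext a
      simp only [Finset.mem_map_equiv]
      have : (simple i).symm a = simple i a := by rw [Equiv.symm_apply_eq, simple_simple]
      rw [this]
      by_cases h1 : a = i.castSucc
      · subst h1; simp [hs, hcs]
      · by_cases h2 : a = i.succ
        · subst h2; simp [hs, hcs]
        · rw [simple, Equiv.swap_apply_of_ne_of_ne h1 h2]
    simp only [hmap]
    obtain ⟨p, hp⟩ : ∃ p, J.orderEmbOfFin hc p = i.castSucc := by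
      have : i.castSucc ∈ Set.range (J.orderEmbOfFin hc) := by
        rw [Finset.range_orderEmbOfFin]; exact hcs
      exact this
    obtain ⟨q, hq⟩ : ∃ q, J.orderEmbOfFin hc q = i.succ := by
      have : i.succ ∈ Set.range (J.orderEmbOfFin hc) := by
        rw [Finset.range_orderEmbOfFin]; exact hs
      exact this
    have hpq : p ≠ q := by rintro rfl; exact hne (hp.symm.trans hq)
    have hsw : ∀ k, J.orderEmbOfFin hc (Equiv.swap p q k) = simple i (J.orderEmbOfFin hc k) := by
      intro k
      by_cases h1 : k = p
      · subst h1; rw [Equiv.swap_apply_left, hp, hq, simple_castSucc]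
      · by_cases h2 : k = q
        · subst h2; rw [Equiv.swap_apply_right, hp, hq, simple_succ]
        · rw [Equiv.swap_apply_of_ne_of_ne h1 h2, simple, Equiv.swap_apply_of_ne_of_ne]
          · rw [← hp]; exact fun e => h1 ((J.orderEmbOfFin hc).injective e)
          · rw [← hq]; exact fun e => h2 ((J.orderEmbOfFin hc).injective e)
    have hm : (x * sbar i : G r).val.submatrix (I.orderEmbOfFin rfl) (J.orderEmbOfFin hc) =
        Matrix.of fun a b => sg i (J.orderEmbOfFin hc b) *
          ((x.val.submatrix (I.orderEmbOfFin rfl) (J.orderEmbOfFin hc)).submatrix id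
            (Equiv.swap p q)) a b := by
      ext a b
      rw [submatrix_apply, Units.val_mul, mul_sbar_apply, of_apply, submatrix_apply,
        submatrix_apply, hsw, id, mul_comm]
    have hsg : ∏ b, sg i (J.orderEmbOfFin hc b) = -1 := by
      rw [Finset.prod_eq_single q]
      · rw [hq, sg, if_pos rfl]
      · intro b _ hb
        rw [sg, if_neg]
        rw [← hq]; exact fun e => hb ((J.orderEmbOfFin hc).injective e)
      · simp
    rw [hm, det_mul_row, hsg, det_permute', Equiv.Perm.sign_swap hpq]
    simp
  · have hmono : StrictMono fun k => simple i (J.orderEmbOfFin hc k) := by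
      intro a b hab
      refine simple_lt_simple ((J.orderEmbOfFin hc).strictMono hab) ?_
      rintro ⟨-, e⟩
      exact hs (e ▸ Finset.orderEmbOfFin_mem J hc b)
    rw [← Finset.orderEmbOfFin_unique (s := J.map (simple i).toEmbedding) (by
      rw [Finset.card_map, hc]) (fun k => ?_) hmono]
    · congr 1
      ext a b
      rw [submatrix_apply, submatrix_apply, Units.val_mul, mul_sbar_apply, sg, if_neg, mul_one]
      intro e
      exact hs (e ▸ Finset.orderEmbOfFin_mem J hc b)
    · exact Finset.mem_map_of_mem _ (Finset.orderEmbOfFin_mem J hc k)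

lemma firstImage_simple_mul (i : Fin r) (w : Equiv.Perm (Fin (r + 1))) (s : Fin (r + 2)) :
    firstImage (simple i * w) s = (firstImage w s).map (simple i).toEmbedding := by
  ext a
  simp only [firstImage, Finset.mem_filter, Finset.mem_univ, true_and, Finset.mem_map_equiv]
  rfl

/-- Reducedness excludes the bad case of `minor_mul_sbar` at every letter, so the lift `wbar`
carries leading columns to the columns of `firstImage` without sign. -/
lemma minor_mul_wbar (I : Finset (Fin (r + 1))) {l : List (Fin r)} (hl : Reduced l) (s : Fin (r + 2))
    (x : G r) : minor I (firstImage (permOf l) s) x = minor I (firstImage 1 s) (x * wbar l) := by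
  induction l generalizing x with
  | nil => simp
  | cons i l ih =>
    rw [permOf_cons, firstImage_simple_mul, minor_mul_sbar, ih (hl.right (l := [i])), wbar_cons,
      mul_assoc]
    simp only [firstImage, Finset.mem_filter, Finset.mem_univ, true_and]
    exact fun h => (Fin.lt_def.1 hl.inv_lt).trans h

lemma minor_wbar_mul (J : Finset (Fin (r + 1))) {l : List (Fin r)} (hl : Reduced l) (s : Fin (r + 2))
    (x : G r) :
    minor (firstImage (permOf l) s) J x = minor (firstImage 1 s) J ((wbar l)⁻¹ * x) := by
  rw [← minor_tr, minor_mul_wbar J hl, ← minor_tr]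
  simp [tr_wbar]

lemma card_firstImage_one (s : Fin (r + 2)) :
    (firstImage (1 : Equiv.Perm (Fin (r + 1))) s).card = s.val := by
  have : firstImage (1 : Equiv.Perm (Fin (r + 1))) s =
      Finset.univ.map (Fin.castLEEmb (Nat.lt_succ_iff.1 s.2)) := by
    ext a
    simp only [firstImage, Finset.mem_filter, Finset.mem_univ, true_and, Finset.mem_map,
      Fin.castLEEmb_apply]
    exact ⟨fun h => ⟨⟨a.val, h⟩, rfl⟩, by rintro ⟨b, rfl⟩; exact b.2⟩
  rw [this, Finset.card_map, Finset.card_univ, Fintype.card_fin]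

lemma minor_firstImage_one (s : Fin (r + 2)) (x : G r) :
    minor (firstImage 1 s) (firstImage 1 s) x = lead s x.val := by
  have hc := card_firstImage_one (r := r) s
  rw [minor_eq hc hc, lead, ← Finset.orderEmbOfFin_unique hc (f := Fin.castLE (Nat.lt_succ_iff.1 s.2))]
  · intro a
    simp only [firstImage, Finset.mem_filter, Finset.mem_univ, true_and]
    exact a.2
  · exact Fin.strictMono_castLE _

lemma minor_eq_lead {l l' : List (Fin r)} (hl : Reduced l) (hl' : Reduced l') (s : Fin (r + 2))
    (x : G r) : minor (firstImage (permOf l) s) (firstImage (permOf l') s) x =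
      lead s ((wbar l)⁻¹ * x * wbar l' : G r).val := by
  rw [minor_mul_wbar _ hl', minor_wbar_mul _ hl, minor_firstImage_one, mul_assoc]

end minors

/-! ### Dominating sets and face functions -/

section dominating
variable {r : ℕ}

lemma foldl_crossRight (v : List (Letter r)) (a : Fin (r + 1)) :
    v.foldl Letter.crossRight a = (permOf (negs v))⁻¹ a := by
  induction v generalizing a with
  | nil => rfl
  | cons c v ih =>
    rw [List.foldl_cons, ih]
    cases c with
    | pos i => rfl
    | neg i => rw [negs_cons_neg, permOf_cons, _root_.mul_inv_rev, simple_inv]; rfl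

lemma foldr_crossLeft (v : List (Letter r)) (a : Fin (r + 1)) :
    v.foldr Letter.crossLeft a = (permOf (poss v).reverse)⁻¹ a := by
  rw [permOf_reverse, inv_inv]
  induction v with
  | nil => rfl
  | cons c v ih =>
    rw [List.foldr_cons, ih]
    cases c with
    | pos i => rw [poss_cons_pos, permOf_cons]; rfl
    | neg i => rfl

lemma simple_lt_iff {i : Fin r} {s : Fin (r + 2)} (h : (Letter.pos i).spacing ≠ s)
    (a : Fin (r + 1)) : (simple i a).val < s.val ↔ a.val < s.val := by
  have hs : i.val + 1 ≠ s.val := by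
    intro e; apply h; ext; simpa using e
  by_cases h1 : a = i.castSucc
  · subst h1; simp; omega
  · by_cases h2 : a = i.succ
    · subst h2; simp; omega
    · rw [simple, Equiv.swap_apply_of_ne_of_ne h1 h2]

lemma foldl_crossRight_lt_iff {t : List (Letter r)} {s : Fin (r + 2)} (h : occ t s = 0)
    (a : Fin (r + 1)) : (t.foldl Letter.crossRight a).val < s.val ↔ a.val < s.val := by
  induction t generalizing a with
  | nil => rfl
  | cons c t ih =>
    rw [occ_cons] at h
    have hc : c.spacing ≠ s := by rintro rfl; simp at h
    rw [List.foldl_cons, ih (by omega)]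
    cases c with
    | pos i => rfl
    | neg i => exact simple_lt_iff hc a

lemma foldr_crossLeft_lt_iff {t : List (Letter r)} {s : Fin (r + 2)} (h : occ t s = 0)
    (a : Fin (r + 1)) : (t.foldr Letter.crossLeft a).val < s.val ↔ a.val < s.val := by
  induction t with
  | nil => rfl
  | cons c t ih =>
    rw [occ_cons] at h
    have hc : c.spacing ≠ s := by rintro rfl; simp at h
    rw [List.foldr_cons, ← ih (by omega)]
    cases c with
    | pos i => exact simple_lt_iff hc _
    | neg i => rfl

/-- The set may be computed at any position meeting the face: letters in other spacings never carry
a strand across the spacing of the face. -/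
lemma domI_eq {v v' : List (Letter r)} {f : Face (v ++ v')} (hf : lab f = (f.1, occ v f.1)) :
    domI (v ++ v') f = firstImage (permOf (negs v)) f.1 := by
  ext a
  simp only [domI, firstImage, Finset.mem_filter, Finset.mem_univ, true_and, ← foldl_crossRight]
  constructor
  · rintro ⟨m, hm, h1, h2⟩
    have h3 := congrArg lab h1
    rw [lab_faceAt, hf] at h3
    have h4 : occ ((v ++ v').take m) f.1 = occ v f.1 := congrArg Prod.snd h3
    rw [rightLevel] at h2
    have h5 := List.prefix_or_prefix_of_prefix (List.take_prefix m (v ++ v'))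
      (List.prefix_append v v')
    clear h1 h3 hf hm
    generalize f.1 = s at h2 h4 ⊢
    generalize (v ++ v').take m = u at h2 h4 h5
    rcases h5 with ⟨t, ht⟩ | ⟨t, ht⟩
    · rw [← ht, occ_append] at h4
      rw [← ht, List.foldl_append, foldl_crossRight_lt_iff (by omega)]
      exact h2
    · rw [← ht, occ_append] at h4
      rw [← ht, List.foldl_append, foldl_crossRight_lt_iff (by omega)] at h2
      exact h2
  · intro h
    refine ⟨v.length, by simp, lab_injective _ ?_, ?_⟩
    · rw [lab_faceAt, hf, List.take_left]
    · rw [rightLevel, List.take_left]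
      exact h

lemma domJ_eq {v v' : List (Letter r)} {f : Face (v ++ v')} (hf : lab f = (f.1, occ v f.1)) :
    domJ (v ++ v') f = firstImage (permOf (poss v').reverse) f.1 := by
  ext a
  simp only [domJ, firstImage, Finset.mem_filter, Finset.mem_univ, true_and, ← foldr_crossLeft]
  constructor
  · rintro ⟨m, hm, h1, h2⟩
    have h3 := congrArg lab h1
    rw [lab_faceAt, hf] at h3
    have h4 : occ ((v ++ v').take m) f.1 = occ v f.1 := congrArg Prod.snd h3
    have h5 := List.take_append_drop m (v ++ v')
    rw [leftLevel] at h2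
    clear h1 h3 hf hm
    generalize f.1 = s at h2 h4 ⊢
    generalize (v ++ v').take m = u at h4 h5
    generalize (v ++ v').drop m = u' at h2 h5
    rcases List.append_eq_append_iff.1 h5 with ⟨t, h6, h7⟩ | ⟨t, h6, h7⟩
    · rw [h7, List.foldr_append, foldr_crossLeft_lt_iff] at h2
      · exact h2
      · have := congrArg (fun l => occ l s) h6
        simp only [occ_append] at this
        omega
    · rw [h7, List.foldr_append, foldr_crossLeft_lt_iff]
      · exact h2
      · have := congrArg (fun l => occ l s) h6
        simp only [occ_append] at this
        omega
  · intro h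
    refine ⟨v.length, by simp, lab_injective _ ?_, ?_⟩
    · rw [lab_faceAt, hf, List.take_left]
    · rw [leftLevel, List.drop_left]
      exact h

lemma exists_prefix (W : List (Letter r)) (s : Fin (r + 2)) {j : ℕ} (h : j ≤ occ W s) :
    ∃ v v', W = v ++ v' ∧ occ v s = j := by
  induction W generalizing j with
  | nil => exact ⟨[], [], rfl, by rw [occ_nil] at *; omega⟩
  | cons c W ih =>
    cases j with
    | zero => exact ⟨[], _, rfl, rfl⟩
    | succ j =>
      by_cases hc : c.spacing = s
      · rw [occ_cons, if_pos hc] at h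
        obtain ⟨v, v', rfl, h'⟩ := ih (j := j) (by omega)
        exact ⟨c :: v, v', rfl, by rw [occ_cons, if_pos hc, h']⟩
      · rw [occ_cons, if_neg hc] at h
        obtain ⟨v, v', rfl, h'⟩ := ih (j := j + 1) h
        exact ⟨c :: v, v', rfl, by rw [occ_cons, if_neg hc, h', add_zero]⟩

/-- The face functions as leading minors. -/
lemma faceMinor_eq {W v v' : List (Letter r)} (hW : W = v ++ v') (hn : Reduced (negs W))
    (hp : Reduced (poss W)) {f : Face W} (hf : lab f = (f.1, occ v f.1)) (x : G r) :
    faceMinor W f x = lead f.1 ((wbar (negs v))⁻¹ * x * wbar (poss v').reverse : G r).val := by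
  subst hW
  rw [faceMinor, domI_eq hf, domJ_eq hf]
  rw [negs_append] at hn
  rw [poss_append] at hp
  exact minor_eq_lead hn.left hp.right.reverse f.1 x

end dominating

/-! ### Membership in the double Bruhat cell -/

section cells
variable {r : ℕ}

lemma doubleCoset_of_Nplus {y w n₁ n₂ : G r} {p : Equiv.Perm (Fin (r + 1))} (hw : Represents w p)
    (h₁ : n₁ ∈ Nplus r) (h₂ : n₂ ∈ Nplus r) (d : Fin (r + 1) → ℂˣ)
    (hy : y = n₁ * w * n₂ * diag r d) :
    y ∈ DoubleCoset.doubleCoset (weyl p) (Bplus r) (Bplus r) := by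
  obtain ⟨d', rfl⟩ := hw
  rw [DoubleCoset.mem_doubleCoset]
  refine ⟨n₁, h₁.1, diag r d' * n₂ * diag r d, fun i j hij => ?_, by rw [hy]; group⟩
  rw [Units.val_mul, mul_diag_apply, Units.val_mul, diag_mul_apply, h₂.1 i j hij]
  simp

lemma doubleCoset_of_Nminus {y w n₁ n₂ : G r} {p : Equiv.Perm (Fin (r + 1))} (hw : Represents w p)
    (h₁ : n₁ ∈ Nminus r) (h₂ : n₂ ∈ Nminus r) (d : Fin (r + 1) → ℂˣ)
    (hy : y = n₁ * w * n₂ * diag r d) :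
    y ∈ DoubleCoset.doubleCoset (weyl p) (Bminus r) (Bminus r) := by
  obtain ⟨d', rfl⟩ := hw
  rw [DoubleCoset.mem_doubleCoset]
  refine ⟨n₁, fun i j hij => h₁.1 j i hij, diag r d' * n₂ * diag r d, fun i j hij => ?_,
    by rw [hy]; group⟩
  have : n₂.val i j = 0 := h₂.1 j i hij
  rw [Units.val_mul, mul_diag_apply, Units.val_mul, diag_mul_apply, this]
  simp

/-- The ends of the two chains are `N₊` and `xN₊`, and `N₋` and `N₋ d x⁻¹`. Along reduced words
their relative positions are the full permutations, which are the two Bruhat conditions on `x`. -/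
lemma IsChains.mem_cell {b a : List (Fin r)} {x : G r} {g k : ℕ → G r} (h : IsChains b a x g k)
    (hb : Reduced b) (ha : Reduced a) (d : Fin (r + 1) → ℂˣ) :
    x * diag r d ∈ cell (permOf b) (permOf a) := by
  constructor
  · obtain ⟨n₁, h₁, n₂, h₂, e⟩ := h.top_mem (List.append_nil b).symm hb
    have := h.g_late 0
    rw [List.take_zero, wbar_nil, mul_one, add_zero] at this
    rw [this] at e
    exact doubleCoset_of_Nplus (represents_wbar b) h₁ h₂ d (by rw [e])
  · obtain ⟨n₁, h₁, n₂, h₂, e⟩ := h.bot_mem (List.nil_append a).symm ha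
    have := h.k_early 0 (Nat.zero_le _)
    rw [List.take_zero, wbar_nil, inv_one, Nat.sub_zero] at this
    obtain ⟨n₀, h₀, d', hd⟩ := h.k_last
    rw [List.length_nil, add_zero, this, mul_one, hd] at e
    have hr := (represents_wbar a.reverse).inv
    rw [permOf_reverse, inv_inv] at hr
    refine doubleCoset_of_Nminus hr ((Nminus r).inv_mem h₂)
      ((Nminus r).mul_mem ((Nminus r).inv_mem h₁) h₀) (d' * d) ?_
    rw [map_mul]
    rw [← mul_assoc, mul_inv_eq_iff_eq_mul] at e
    have hx : x = (n₁ * wbar a.reverse * n₂)⁻¹ * (n₀ * diag r d') := by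
      rw [e]; group
    rw [hx]
    group

end cells

/-! ### Torus weights of the face functions -/

section weights
variable {r : ℕ}

/-- The product of the first `s` values. -/
def firstProd {r : ℕ} (φ : Fin (r + 1) → ℂˣ) (s : Fin (r + 2)) : ℂˣ :=
  ∏ j : Fin s.val, φ (Fin.castLE (Nat.lt_succ_iff.1 s.2) j)

lemma firstProd_succ (φ : Fin (r + 1) → ℂˣ) (j : Fin (r + 1)) :
    firstProd φ j.succ = firstProd φ j.castSucc * φ j :=
  Fin.prod_univ_castSucc (n := j.val) _

lemma firstProd_simple (φ : Fin (r + 1) → ℂˣ) {i : Fin r} {s : Fin (r + 2)}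
    (h : (Letter.pos i).spacing ≠ s) : firstProd (φ ∘ simple i) s = firstProd φ s := by
  have hs : i.val + 1 ≠ s.val := by
    intro e; apply h; ext; simpa using e
  obtain ⟨s, hs'⟩ := s
  simp only at hs
  induction s with
  | zero => rfl
  | succ s ih =>
    have e : (⟨s + 1, hs'⟩ : Fin (r + 2)) = (⟨s, by omega⟩ : Fin (r + 1)).succ := rfl
    rw [e, firstProd_succ, firstProd_succ]
    by_cases h1 : i.val + 1 = s
    · subst h1
      have e1 : (⟨i.val + 1, by omega⟩ : Fin (r + 1)) = i.succ := rfl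
      have e2 : (⟨i.val + 1, by omega⟩ : Fin (r + 1)).castSucc = i.castSucc.succ := rfl
      have e3 : i.castSucc.castSucc = (⟨i.val, by omega⟩ : Fin (r + 2)) := rfl
      have key : firstProd (φ ∘ simple i) i.castSucc.castSucc = firstProd φ i.castSucc.castSucc := by
        refine Finset.prod_congr rfl fun j _ => ?_
        exact congrArg φ (simple_of_lt j.2).1
      rw [e2, firstProd_succ, firstProd_succ, e1, key]
      simp only [Function.comp_apply, simple_castSucc, simple_succ]
      rw [mul_right_comm]
    · have := ih (by omega) (fun e => h1 (by simpa [Letter.spacing, Letter.index, Fin.ext_iff] using e))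
        h1
      refine congrArg₂ (· * ·) this ?_
      simp only [Function.comp_apply]
      congr 1
      refine Equiv.swap_apply_of_ne_of_ne ?_ ?_
      · simp [Fin.ext_iff]; omega
      · simp [Fin.ext_iff]; omega

/-- With `P` the product before `i`, both sides are `P² φᵢ φᵢ₊₁`. -/
lemma firstProd_exchange (φ : Fin (r + 1) → ℂˣ) (i : Fin r) :
    firstProd φ (Letter.pos i).spacing * firstProd (φ ∘ simple i) (Letter.pos i).spacing =
      firstProd φ (Letter.pos i).above * firstProd φ (Letter.pos i).below := by
  have e1 : (Letter.pos i).spacing = i.castSucc.succ := rfl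
  have e2 : (Letter.pos i).below = i.succ.succ := rfl
  have e3 : i.succ.castSucc = i.castSucc.succ := rfl
  have e4 : (Letter.pos i).above = i.castSucc.castSucc := rfl
  have key := firstProd_simple φ (spacing_ne_above (Letter.pos i))
  rw [e4] at key
  rw [e1, e2, e4, firstProd_succ, firstProd_succ, firstProd_succ, e3, firstProd_succ, key]
  simp only [Function.comp_apply, simple_castSucc]
  simp only [mul_left_comm, mul_comm]

lemma exists_faceFunction (W : List (Letter r)) (Λ : List (Letter r) → Fin (r + 2) → ℂˣ)
    (h : ∀ v t s, v ++ t <+: W → occ t s = 0 → Λ (v ++ t) s = Λ v s) :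
    ∃ a : Label r → ℂˣ, ∀ v s, v <+: W → a (s, occ v s) = Λ v s := by
  have hocc : ∀ (s : Fin (r + 2)) (v : List (Letter r)),
      (v.filterMap fun c => if c.spacing = s then some () else none).length = occ v s := by
    intro s v
    induction v with
    | nil => rfl
    | cons c v ih =>
      rw [occ_cons, ← ih]
      by_cases hc : c.spacing = s <;> simp [hc]
  have key : ∀ s : Fin (r + 2), ∃ g : ℕ → ℂˣ, ∀ v, v <+: W → Λ v s = g (occ v s) := by
    intro s
    obtain ⟨g, hg⟩ := exists_representatives
      (fun c : Letter r => if c.spacing = s then some () else none) W (fun v => Λ v s) Eq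
      (fun _ _ => Eq.symm) (fun v t hv ht => (h v t s hv (by rw [← hocc, ht]; rfl)).symm)
    exact ⟨g, fun v hv => by rw [hg v hv, hocc]⟩
  choose g hg using key
  exact ⟨fun x => g x.1 x.2, fun v s hv => (hg s v hv).symm⟩

lemma rowBalanced_of_forall {W : List (Letter r)} (a : Label r → ℂˣ)
    (hpos : ∀ v i v', W = v ++ .pos i :: v' →
      a ((Letter.pos i).right (occ v)) = a ((Letter.pos i).left (occ v)))
    (hneg : ∀ v i v', W = v ++ .neg i :: v' →
      a ((Letter.neg i).left (occ v)) * a ((Letter.neg i).right (occ v)) =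
        a ((Letter.neg i).top (occ v)) * a ((Letter.neg i).bot (occ v))) :
    RowBalanced a 0 W := by
  have key : ∀ w v, W = v ++ w → RowBalanced a (occ v) w := by
    intro w
    induction w with
    | nil => exact fun _ _ => trivial
    | cons c w ih =>
      intro v hv
      have hocc : occ (v ++ [c]) = c.step (occ v) := by
        rw [step_eq]; exact funext fun s => occ_append _ _ s
      have := ih (v ++ [c]) (by rw [hv]; simp)
      rw [hocc] at this
      cases c with
      | pos i => exact ⟨hpos v i w hv, this⟩
      | neg i => exact ⟨hneg v i w hv, this⟩
  exact key W [] rfl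

lemma colBalanced_of_forall {W : List (Letter r)} (a : Label r → ℂˣ)
    (hneg : ∀ v i v', W = v ++ .neg i :: v' →
      a ((Letter.neg i).right (occ v)) = a ((Letter.neg i).left (occ v)))
    (hpos : ∀ v i v', W = v ++ .pos i :: v' →
      a ((Letter.pos i).left (occ v)) * a ((Letter.pos i).right (occ v)) =
        a ((Letter.pos i).top (occ v)) * a ((Letter.pos i).bot (occ v))) :
    ColBalanced a 0 W := by
  have key : ∀ w v, W = v ++ w → ColBalanced a (occ v) w := by
    intro w
    induction w with
    | nil => exact fun _ _ => trivial
    | cons c w ih =>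
      intro v hv
      have hocc : occ (v ++ [c]) = c.step (occ v) := by
        rw [step_eq]; exact funext fun s => occ_append _ _ s
      have := ih (v ++ [c]) (by rw [hv]; simp)
      rw [hocc] at this
      cases c with
      | pos i => exact ⟨hpos v i w hv, this⟩
      | neg i => exact ⟨hneg v i w hv, this⟩
  exact key W [] rfl

lemma right_eq_occ (c : Letter r) (v : List (Letter r)) :
    c.right (occ v) = (c.spacing, occ (v ++ [c]) c.spacing) := by
  rw [occ_append, occ_cons, if_pos rfl, occ_nil, zero_add]; rfl

lemma firstProd_comp_of_occ (φ : Fin (r + 1) → ℂˣ) {l : List (Fin r)} {s : Fin (r + 2)}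
    (h : ∀ i ∈ l, (Letter.pos i).spacing ≠ s) : firstProd (φ ∘ permOf l) s = firstProd φ s := by
  induction l generalizing φ with
  | nil => rfl
  | cons i l ih =>
    have : φ ∘ permOf (i :: l) = (φ ∘ simple i) ∘ permOf l := by
      rw [permOf_cons]; rfl
    rw [this, ih _ fun j hj => h j (List.mem_cons_of_mem _ hj),
      firstProd_simple φ (h i List.mem_cons_self)]

lemma occ_eq_zero {t : List (Letter r)} {s : Fin (r + 2)} (h : occ t s = 0) {c : Letter r}
    (hc : c ∈ t) : c.spacing ≠ s := by
  rw [occ, List.countP_eq_zero] at h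
  simpa using h c hc

lemma spacing_ne_of_mem_negs {t : List (Letter r)} {s : Fin (r + 2)} (h : occ t s = 0) {i : Fin r}
    (hi : i ∈ negs t) : (Letter.pos i).spacing ≠ s := by
  rw [negs, List.mem_filterMap] at hi
  obtain ⟨c, hc, e⟩ := hi
  cases c with
  | pos j => simp [Letter.neg?] at e
  | neg j =>
    obtain rfl : j = i := by simpa [Letter.neg?] using e
    have := occ_eq_zero h hc
    exact this

lemma spacing_ne_of_mem_poss {t : List (Letter r)} {s : Fin (r + 2)} (h : occ t s = 0) {i : Fin r}
    (hi : i ∈ poss t) : (Letter.pos i).spacing ≠ s := by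
  rw [poss, List.mem_filterMap] at hi
  obtain ⟨c, hc, e⟩ := hi
  cases c with
  | neg j => simp [Letter.pos?] at e
  | pos j =>
    obtain rfl : j = i := by simpa [Letter.pos?] using e
    have := occ_eq_zero h hc
    exact this

lemma exists_rowWeights (W : List (Letter r)) (φ : Fin (r + 1) → ℂˣ) :
    ∃ a : Label r → ℂˣ, RowBalanced a 0 W ∧ ∀ v v', W = v ++ v' → ∀ s,
      a (s, occ v s) = firstProd (φ ∘ permOf (negs v)) s := by
  obtain ⟨a, ha⟩ := exists_faceFunction W (fun v => firstProd (φ ∘ permOf (negs v))) (by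
    intro v t s _ ht
    have : φ ∘ permOf (negs (v ++ t)) = (φ ∘ permOf (negs v)) ∘ permOf (negs t) := by
      rw [negs_append, permOf_append]; rfl
    rw [this, firstProd_comp_of_occ _ fun i hi => spacing_ne_of_mem_negs ht hi])
  refine ⟨a, rowBalanced_of_forall a ?_ ?_, fun v v' h s => ha v s ⟨v', h.symm⟩⟩
  · intro v i v' h
    rw [right_eq_occ, Letter.left, ha v _ ⟨_, h.symm⟩, ha (v ++ [Letter.pos i]) _ ⟨v', by rw [h]; simp⟩]
    simp
  · intro v i v' h
    rw [right_eq_occ, Letter.left, Letter.top, Letter.bot, ha v _ ⟨_, h.symm⟩,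
      ha v _ ⟨_, h.symm⟩, ha v _ ⟨_, h.symm⟩, ha (v ++ [Letter.neg i]) _ ⟨v', by rw [h]; simp⟩]
    have : φ ∘ permOf (negs (v ++ [Letter.neg i])) = (φ ∘ permOf (negs v)) ∘ simple i := by
      rw [negs_append, permOf_append]
      simp [Function.comp_assoc]
    rw [this]
    exact firstProd_exchange _ i

lemma exists_colWeights (W : List (Letter r)) (φ : Fin (r + 1) → ℂˣ) :
    ∃ a : Label r → ℂˣ, ColBalanced a 0 W ∧ ∀ v v', W = v ++ v' → ∀ s,
      a (s, occ v s) = firstProd (φ ∘ permOf (poss v').reverse) s := by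
  obtain ⟨a, ha⟩ := exists_faceFunction W
    (fun v => firstProd (φ ∘ permOf (poss (W.drop v.length)).reverse)) (by
    rintro v t s ⟨t', rfl⟩ ht
    have e1 : (v ++ t ++ t').drop v.length = t ++ t' := by simp
    have e2 : (v ++ t ++ t').drop (v ++ t).length = t' := List.drop_left
    rw [e1, e2]
    have : φ ∘ permOf (poss (t ++ t')).reverse =
        (φ ∘ permOf (poss t').reverse) ∘ permOf (poss t).reverse := by
      rw [poss_append, List.reverse_append, permOf_append]; rfl
    rw [this]
    exact (firstProd_comp_of_occ _ fun i hi =>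
      spacing_ne_of_mem_poss ht (List.mem_reverse.1 hi)).symm)
  have ha' : ∀ v v', W = v ++ v' → ∀ s,
      a (s, occ v s) = firstProd (φ ∘ permOf (poss v').reverse) s := by
    intro v v' h s
    rw [ha v s ⟨v', h.symm⟩, h, List.drop_left]
  refine ⟨a, colBalanced_of_forall a ?_ ?_, ha'⟩
  · intro v i v' h
    rw [right_eq_occ, Letter.left, ha' v _ h, ha' (v ++ [Letter.neg i]) v' (by rw [h]; simp)]
    simp
  · intro v i v' h
    rw [right_eq_occ, Letter.left, Letter.top, Letter.bot, ha' v _ h, ha' v _ h, ha' v _ h,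
      ha' (v ++ [Letter.pos i]) v' (by rw [h]; simp)]
    set ψ := φ ∘ permOf (poss v').reverse with hψ
    have : φ ∘ permOf (poss (Letter.pos i :: v')).reverse = ψ ∘ simple i := by
      rw [poss_cons_pos, List.reverse_cons, permOf_append, hψ]
      simp [Function.comp_assoc]
    have e := firstProd_exchange ψ i
    rw [this, mul_comm, e, firstProd_simple ψ (spacing_ne_above (Letter.pos i)),
      firstProd_simple ψ (spacing_ne_below (Letter.pos i))]

lemma cycProd_mul (x y z : Label r) (a b : Label r → ℂˣ) (f : Label r) :
    cycProd x y z (a * b) f = cycProd x y z a f * cycProd x y z b f := by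
  simp only [cycProd, Pi.mul_apply]
  split_ifs <;> (apply Units.ext; push_cast; field_simp)

lemma prodCtr_mul (w : List (Letter r)) (n : Count r) (a b : Label r → ℂˣ) (f : Label r) :
    prodCtr n w (a * b) f = prodCtr n w a f * prodCtr n w b f := by
  induction w generalizing n with
  | nil => simp [prodCtr]
  | cons c w ih =>
    have : c.ctr n (a * b) f = c.ctr n a f * c.ctr n b f := by
      cases c <;> exact cycProd_mul _ _ _ a b f
    rw [prodCtr, prodCtr, prodCtr, this, ih, mul_mul_mul_comm]

lemma lead_diag_eq (s : Fin (r + 2)) (d : Fin (r + 1) → ℂˣ) :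
    lead s (diag r d).val = (firstProd d s : ℂˣ) := by
  rw [lead_diag, firstProd, Units.coe_prod]

lemma lead_diag_mul (s : Fin (r + 2)) (M : G r) (d : Fin (r + 1) → ℂˣ) :
    lead s (diag r d * M).val = (firstProd d s : ℂˣ) * lead s M.val := by
  rw [← lead_transpose, ← tr_val, tr_mul, tr_diag, Units.val_mul, lead_mul_diag, tr_val,
    lead_transpose, lead_diag_eq, mul_comm]

lemma diag_mul_represents {y : G r} {w : Equiv.Perm (Fin (r + 1))} (h : Represents y w)
    (d : Fin (r + 1) → ℂˣ) : diag r d * y = y * diag r (d ∘ w) := by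
  obtain ⟨d', rfl⟩ := h
  rw [← mul_assoc, diag_mul_weyl, mul_assoc, mul_assoc, ← map_mul, ← map_mul, mul_comm d']

/-- The torus acts on the face functions by weights that do not change the inner coordinates. -/
lemma exists_weights {W : List (Letter r)} (hn : Reduced (negs W)) (hp : Reduced (poss W))
    (d d' : Fin (r + 1) → ℂˣ) :
    ∃ ω : Label r → ℂˣ, (∀ (x : G r) (f : Face W),
      faceMinor W f (diag r d * x * diag r d') = ω (lab f) * faceMinor W f x) ∧
      ∀ f : InnerFace W, prodCtr 0 W ω (lab f.1) = 1 := by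
  obtain ⟨a, ha, ha'⟩ := exists_rowWeights W d
  obtain ⟨b, hb, hb'⟩ := exists_colWeights W d'
  refine ⟨a * b, fun x f => ?_, fun f => ?_⟩
  · obtain ⟨v, v', hW, hv⟩ := exists_prefix W f.1 (Nat.le_of_lt_succ f.2.2)
    have hf : lab f = (f.1, occ v f.1) := by rw [hv]; rfl
    rw [faceMinor_eq hW hn hp hf, faceMinor_eq hW hn hp hf, hf, Pi.mul_apply, ha' v v' hW,
      hb' v v' hW]
    have h1 := diag_mul_represents (represents_wbar (negs v)) d
    have h2 := diag_mul_represents (represents_wbar (poss v').reverse) d'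
    have h3 : (wbar (negs v))⁻¹ * (diag r d * x * diag r d') * wbar (poss v').reverse =
        diag r (d ∘ permOf (negs v)) * ((wbar (negs v))⁻¹ * x * wbar (poss v').reverse) *
          diag r (d' ∘ permOf (poss v').reverse) := by
      have h1' : (wbar (negs v))⁻¹ * diag r d = diag r (d ∘ permOf (negs v)) * (wbar (negs v))⁻¹ := by
        rw [inv_mul_eq_iff_eq_mul, ← mul_assoc, ← h1, mul_inv_cancel_right]
      calc _ = ((wbar (negs v))⁻¹ * diag r d) * x * (diag r d' * wbar (poss v').reverse) := by
            group
        _ = _ := by rw [h1', h2]; group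
    rw [h3, Units.val_mul _ (diag r (d' ∘ _)), lead_mul_diag, lead_diag_mul, lead_diag_eq]
    push_cast
    ring
  · have h1 := ha.telescopes.prodCtr_eq.2 f.1.1 f.1.2.val f.2.1
    have h2 := hb.solves.telescopes.prodCtr_eq.2 f.1.1 f.1.2.val f.2.1
    have hlt : f.1.2.val < (0 : Count r) f.1.1 + occ W f.1.1 := by
      rw [Pi.zero_apply, zero_add]; exact f.2.2
    rw [prodCtr_mul]
    refine (congrArg₂ (· * ·) (h1 hlt) (h2 hlt)).trans ?_
    simp

end weights

/-! ## The composition of `ψ` and `χ` -/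

section main
variable {r : ℕ} {W : List (Letter r)}

lemma bigSeed_p_eq (A : Label r → ℂˣ) (f : Face W) :
    (bigSeed W).p (fun g : Face W => A (lab g)) f = prodCtr 0 W A (lab f) := by
  rw [← prod_zpow_eps (W := W) A W 0 (fun s => by simp) (lab f)]
  exact Finset.prod_congr rfl fun (g : Face W) _ =>
    congrArg (fun k : ℤ => A (lab g) ^ k) (bigSeed_ε W f g)

/-- The point with the coordinates `Xt` lies in the cell, and its face functions are the variables
of a point with the inner coordinates obtained from those of `Xt` by the cluster composition. -/
lemma exists_faceMinor_chiTilde (hn : Reduced (negs W)) (hp : Reduced (poss W))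
    {C : (seed W).Torus → (seed W).Torus → Prop}
    (hC : ∀ Pr, IsPairing (negs W) (poss W) Pr → ∀ X z,
        IsCoord W Pr W 0 (negs W).length X → C X z →
        ∃ x : Label r → ℂˣ, (∀ v v', W = v ++ v' → ∀ s, (x (s, occ v s) : ℂ) =
            Pr s ((negs W).length + (poss v').length) (negs v').length) ∧
          ∀ f : InnerFace W, z f = prodCtr 0 W x (lab f.1))
    (Xt : Face W → ℂˣ) (y : InnerFace W → ℂˣ) (hy : C (fun f : InnerFace W => Xt f.1) y) :
    chiTilde W Xt ∈ cell (permOf (negs W)) (permOf (poss W)) ∧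
      ∃ A : Label r → ℂˣ, (∀ f : Face W, (A (lab f) : ℂ) = faceMinor W f (chiTilde W Xt)) ∧
        ∀ f : InnerFace W, y f = prodCtr 0 W A (lab f.1) := by
  obtain ⟨η, hη⟩ := chiTilde_eq W Xt
  obtain ⟨a, ha, hs⟩ := exists_solves (extend Xt) W 0 η 1
  have ha0 : ∀ s, a (s, 0) = 1 := fun s => ha s 0 le_rfl
  obtain ⟨η', hη'⟩ := hs.diag_mul_chiMat
  obtain ⟨g, k, hgk, hface⟩ := exists_chains a W ha0
  have hx : chiTilde W Xt = diag r 1 * xmat a 0 W * diag r η' := by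
    rw [hη, hη', map_one, one_mul]
  refine ⟨by rw [hη, hη']; exact hgk.mem_cell hn hp η', ?_⟩
  -- At a prefix of `W` the product of the two members is, up to unipotent factors, the diagonal
  -- matrix `dmat`. Its leading minors are the solution `a`, and the monomials of `a` are the inner
  -- coordinates of `Xt`.
  have hcoord : IsCoord W (fun s n m => lead s (k m * g n).val) W 0 (negs W).length
      (fun f : InnerFace W => Xt f.1) := by
    refine ⟨a, fun v v' hv s => ?_, fun f => ?_⟩
    · obtain ⟨⟨n, hn', e⟩, m, hm, e'⟩ := hface v ⟨v', hv.symm⟩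
      rw [pairAt, zero_add, e, e', mul_assoc, lead_mul_of_mem_Nminus s _ hm, ← mul_assoc,
        lead_mul_of_mem_Nplus s _ hn', inv_mul_cancel_right, lead_dmat]
      have h0 : occ v 0 = 0 := by
        rw [occ, List.countP_eq_zero]
        intro c _
        simp [Fin.ext_iff, spacing_val]
      rw [h0, ha0, div_one]
    · have h1 := hs.telescopes.prodCtr_eq.2 f.1.1 f.1.2.val f.2.1
        (by rw [Pi.zero_apply, zero_add]; exact f.2.2)
      exact ((extend_lab Xt f.1).symm.trans h1.symm)
  obtain ⟨A, hA, hyA⟩ := hC _ (hgk.isPairing hn hp) _ y hcoord hy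
  -- The chains belong to `xmat a 0 W`, which differs from `χ̃` by the right torus factor `η'`; `ω`
  -- corrects for it.
  obtain ⟨ω, hω, hω'⟩ := exists_weights hn hp 1 η'
  refine ⟨ω * A, fun f => ?_, fun f => ?_⟩
  · obtain ⟨v, v', hW, hv⟩ := exists_prefix W f.1 (Nat.le_of_lt_succ f.2.2)
    have hf : lab f = (f.1, occ v f.1) := by rw [hv]; rfl
    rw [hx, hω, Pi.mul_apply, Units.val_mul, faceMinor_eq hW hn hp hf]
    congr 1
    rw [hf, hA v v' hW]
    have e1 : (negs v').length = (negs W).length - (negs v).length := by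
      rw [hW, negs_append, List.length_append]; omega
    have e2 : (negs W).take (negs v).length = negs v := by
      rw [hW, negs_append, List.take_left]
    have e3 : (poss W).reverse.take (poss v').length = (poss v').reverse := by
      rw [hW, poss_append, List.reverse_append]
      exact List.take_left' (by simp)
    -- After the moves only the explicit parts of the chains occur, and the pairing becomes the
    -- leading minor that represents the face function.
    rw [e1, hgk.k_early _ (by rw [hW, negs_append, List.length_append]; omega), e2, hgk.g_late, e3,
      mul_assoc]
  · rw [hyA, prodCtr_mul, hω', one_mul]

lemma exists_of_rel {x x' : cell (permOf (negs W)) (permOf (poss W))}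
    (h : Quotient.mk (cellSetoid _ _) x = Quotient.mk (cellSetoid _ _) x') :
    ∃ d d', x'.1 = diag r d * x.1 * diag r d' := by
  have h1 := Quotient.exact h
  obtain ⟨_, ⟨d, rfl⟩, _, ⟨d', rfl⟩, e⟩ := DoubleCoset.rel_iff.1 h1
  exact ⟨d, d', e⟩

theorem isClusterTransformation_psi_chi (hn : Reduced (negs W)) (hp : Reduced (poss W)) :
    IsClusterTransformation (seed W) (seed W)
      (Relation.Comp (chi (permOf (negs W)) (permOf (poss W)) W)
        (psi (permOf (negs W)) (permOf (poss W)) W)) := by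
  obtain ⟨R, C, hRC, hC⟩ := exists_composition W
  obtain ⟨P, hP, _, _, _, _, hgen⟩ := hRC.generic
  refine ⟨R, hRC.isClusterComposition, P, hP.ne_zero, fun X hX => ?_⟩
  obtain ⟨y, hy, hR, -⟩ := hgen X hX
  refine ⟨y, fun z => ⟨⟨?_, ?_⟩, hR z⟩⟩
  · rintro ⟨c, ⟨Xt, hXt, x, hx, hxc⟩, x', hx'c, A', hA', hz⟩
    have hy' : C (fun f : InnerFace W => Xt f.1) y := by
      have : (fun f : InnerFace W => Xt f.1) = X := hXt
      rwa [this]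
    obtain ⟨-, A, hA, hyA⟩ := exists_faceMinor_chiTilde hn hp hC Xt y hy'
    -- The representative used by `ψ` need not be the one produced by `χ̃`; they differ by the torus
    -- on both sides, which inner coordinates do not see.
    obtain ⟨d, d', hdd⟩ := exists_of_rel (hxc.trans hx'c.symm)
    obtain ⟨ω, hω, hω'⟩ := exists_weights hn hp d d'
    rw [← hz]
    have hAA : ∀ f : Face W, A' f = (ω * A) (lab f) := by
      intro f
      apply Units.ext
      rw [Pi.mul_apply, Units.val_mul, hA f, ← hx, ← hω, ← hdd]
      exact hA' f
    funext f
    have h1 : A' = fun g : Face W => (ω * A) (lab g) := funext hAA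
    change (bigSeed W).p A' f.1 = y f
    rw [h1]
    refine (bigSeed_p_eq (ω * A) f.1).trans ?_
    rw [prodCtr_mul]
    exact (congrArg₂ (· * ·) (hω' f) (hyA f).symm).trans (one_mul _)
  · rintro rfl
    classical
    -- Any units at the boundary faces would do: the graph of `χ` asks only for some lift of `X`
    -- through `q`.
    let Xt : Face W → ℂˣ := fun f =>
      if h : 0 < f.2.val ∧ f.2.val < occ W f.1 then X (⟨f, h⟩ : InnerFace W) else 1
    have hXt : (fun f : InnerFace W => Xt f.1) = X := by
      funext f
      exact dif_pos f.2
    obtain ⟨hcell, A, hA, hyA⟩ := exists_faceMinor_chiTilde hn hp hC Xt z (by rwa [hXt])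
    refine ⟨Quotient.mk _ ⟨_, hcell⟩, ⟨Xt, hXt, ⟨_, hcell⟩, rfl, rfl⟩, ⟨_, hcell⟩, rfl,
      fun f : Face W => A (lab f), hA, ?_⟩
    funext f
    exact (bigSeed_p_eq A f.1).trans (hyA f).symm

end main

end DoubleBruhat

end

theorem proposition3p18 (r : ℕ) (u v : Equiv.Perm (Fin (r + 1)))
    (w : List (DoubleBruhat.Letter r)) (hw : DoubleBruhat.IsReducedPairWord u v w) :
    DoubleBruhat.IsClusterTransformation (DoubleBruhat.seed w) (DoubleBruhat.seed w)
      (Relation.Comp (DoubleBruhat.chi u v w) (DoubleBruhat.psi u v w)) := by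
  obtain ⟨rfl, hn⟩ := hw.1.reduced
  obtain ⟨rfl, hp⟩ := hw.2.reduced
  exact DoubleBruhat.isClusterTransformation_psi_chi hn hp
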